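/- Let $b_1,b_2\in\mathbb R$ with $b_1\ge 1$ and $0\le b_2\le 2+b_1$, and consider on $\mathbb R\times\mathbb R^2$ the equation $$i u_t=-\Delta u+|x|^{b_1}|u|^2u+|x|^{b_2}|u|^4u,\qquad u(0)=\varphi .$$ Let $u$ be a global regular (strong) solution, that is, $u\in C(\mathbb R;H^2(\mathbb R^2))\cap C^1(\mathbb R;L^2(\mathbb R^2))$, $u(0)=\varphi$, and the equation holds in $L^2(\mathbb R^2)$ at every time $t\in\mathbb R$, where $u_t$ is the derivative of the $L^2$-valued curve $u$ and $\Delta u$ is the distributional Laplacian. Suppose that $xu\in C(\mathbb R;L^2(\mathbb R^2))$ and that $u$ scatters in $L^2$: there are $C^\infty$ functions $\varphi_+,\varphi_-\in L^2(\mathbb R^2)$ such that, with $u_\pm(t)=e^{it\Delta}\varphi_\pm$, $$\lim_{t\to+\infty}\|u(t)-u_+(t)\|_{L^2}=0,\qquad \lim_{t\to-\infty}\|u(t)-u_-(t)\|_{L^2}=0 .$$ Then $u(t)=0$ and $u_+(t)=u_-(t)=0$ in $L^2(\mathbb R^2)$ for every $t\in\mathbb R$. -/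

import Mathlib

open MeasureTheory Filter Topology
open scoped SchwartzMap FourierTransform Laplacian ContDiff ENNReal

noncomputable section

namespace ICQNLS

/-- The Euclidean plane `ℝ²`. -/
abbrev Plane : Type := EuclideanSpace ℝ (Fin 2)

/-- The complex Hilbert space `L²(ℝ²)`. -/
abbrev L2 : Type := Lp ℂ 2 (volume : Measure Plane)

/-- The symbol of `e^{itΔ}`. With the Fourier transform `𝓕 f (ξ) = ∫ e^{-2πi x·ξ} f(x) dx`
of Mathlib, `-Δ` has the symbol `(2π|ξ|)²`. -/
def propagatorSymbol (t : ℝ) (ξ : Plane) : ℂ :=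
  Complex.exp (-Complex.I * ((t * (2 * Real.pi * ‖ξ‖) ^ 2 : ℝ) : ℂ))

theorem norm_propagatorSymbol (t : ℝ) (ξ : Plane) : ‖propagatorSymbol t ξ‖ = 1 := by
  have h : -Complex.I * ((t * (2 * Real.pi * ‖ξ‖) ^ 2 : ℝ) : ℂ)
      = ((-(t * (2 * Real.pi * ‖ξ‖) ^ 2) : ℝ) : ℂ) * Complex.I := by
    push_cast; ring
  rw [propagatorSymbol, h, Complex.norm_exp_ofReal_mul_I]

theorem memLp_propagatorSymbol (t : ℝ) :
    MemLp (propagatorSymbol t) ∞ (volume : Measure Plane) := by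
  have hc : Continuous (propagatorSymbol t) := by
    unfold propagatorSymbol
    fun_prop
  exact memLp_top_of_bound hc.aestronglyMeasurable 1
    (Eventually.of_forall fun ξ => (norm_propagatorSymbol t ξ).le)

/-- The free Schrödinger propagator `e^{itΔ} f = 𝓕⁻¹ (e^{-it|2πξ|²} 𝓕 f)` on `L²(ℝ²)`. -/
def propagator (t : ℝ) (f : L2) : L2 :=
  𝓕⁻ ((memLp_propagatorSymbol t).toLp (propagatorSymbol t) • 𝓕 f : L2)

/-- `u ∈ C(ℝ; H^s(ℝ²))`: each `u(t)` belongs to the Sobolev space `H^s` and `t ↦ u(t)` is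
continuous for its norm, the `L²` norm of the Bessel potential of order `s`. -/
def ContinuousInSobolev (s : ℝ) (u : ℝ → L2) : Prop :=
  ∃ w : ℝ → L2, Continuous w ∧
    ∀ t, TemperedDistribution.besselPotential Plane ℂ s (u t : 𝓢'(Plane, ℂ)) = w t

/-- `x u ∈ C(ℝ; L²(ℝ²))`, where `x` is the position vector: both `x₁ u` and `x₂ u` are continuous
curves in `L²`. -/
def ContinuousMulPosition (u : ℝ → L2) : Prop :=
  ∀ j : Fin 2, ∃ w : ℝ → L2, Continuous w ∧
    ∀ t, ∀ᵐ x : Plane, w t x = ((x j : ℝ) : ℂ) * u t x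

/-- `u` solves `i u_t = -Δu + K₁ |u|² u + K₂ |u|⁴ u` at every time, as an identity in `L²(ℝ²)`.
Here `u_t` is the derivative of the `L²`-valued curve `u` and `Δu` is the distributional
Laplacian, which is required to be an `L²` function. -/
def SolvesEquation (K₁ K₂ : Plane → ℂ) (u : ℝ → L2) : Prop :=
  ∀ t, ∃ u_t lap : L2, HasDerivAt u u_t t ∧
    (lap : 𝓢'(Plane, ℂ)) = Δ (u t : 𝓢'(Plane, ℂ)) ∧
    ∀ᵐ x : Plane, Complex.I * u_t x =
      -lap x + K₁ x * ((‖u t x‖ : ℂ) ^ 2 * u t x) + K₂ x * ((‖u t x‖ : ℂ) ^ 4 * u t x)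

/-- `u` is a global regular solution of the inhomogeneous cubic-quintic Schrödinger equation with
coefficients `K₁`, `K₂` and initial value `φ`: `u ∈ C(ℝ; H²) ∩ C¹(ℝ; L²)`, the equation holds
in `L²` at every time, and `u(0) = φ`. -/
structure IsGlobalSmoothSolution (K₁ K₂ : Plane → ℂ) (φ : L2) (u : ℝ → L2) : Prop where
  continuous_sobolev : ContinuousInSobolev 2 u
  contDiff : ContDiff ℝ 1 u
  solves : SolvesEquation K₁ K₂ u
  initial : u 0 = φ

/-- An element of `L²(ℝ²)` is smooth if it has a `C^∞` representative. -/
def IsSmooth (f : L2) : Prop :=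
  ∃ g : Plane → ℂ, ContDiff ℝ ∞ g ∧ ∀ᵐ x : Plane, f x = g x

/-- `u` scatters in `L²` to `u_±(t) = e^{itΔ} φ_±`, as `t → ±∞`. -/
def ScattersTo (u : ℝ → L2) (φp φm : L2) : Prop :=
  Tendsto (fun t => ‖u t - propagator t φp‖) atTop (𝓝 0) ∧
  Tendsto (fun t => ‖u t - propagator t φm‖) atBot (𝓝 0)

/-- The coefficient `|x|^b`. -/
def powerCoeff (b : ℝ) (x : Plane) : ℂ := ((‖x‖ ^ b : ℝ) : ℂ)

end ICQNLS

end

/-! The nonlinearity is of long range: along a scattering solution it decays too slowly to be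
integrable in time, unless the asymptotic profile is zero. A free solution looks for large t like
t⁻¹ e^{i|x|²/4t} W(x/t). In the variable y = x/t and with the quadratic phase removed (`lens`), u(t)
therefore converges in L² to a profile W with ‖W‖ = ‖φ₊‖ (`ScattersTo.exists_tendsto_lens`). If v is
the lens transform of u, that of the force is t^(b₁-2) (|y|^b₁ |v|²v + t^(b₂-2-b₁) |y|^b₂ |v|⁴v)
(`IsForce.lens_apply`), and b₁ ≥ 1 makes the prefactor at least 1/t for t ≥ 1. Pair e^{-itΔ}u with a
state chosen so that, in lens variables, the test function does not depend on t. The pairing is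
bounded by conservation of mass, and its derivative is the pairing of the force with that test
function up to O(t⁻²) (`IsFlow.hasDerivAt_lensPairing`). A nonzero limit of the rescaled derivative
would make the pairing grow at least like log t (`eq_zero_of_hasDerivAt_of_tendsto`). So the
limiting force vanishes against every test function, hence W = 0 and φ₊ = 0; conservation of mass
then gives u = 0 and φ₋ = 0.

Convergence in L² alone does not pass to the limit in the cubic and quintic terms. The missing
weighted L⁴ and L⁶ bounds are the decay P(t) = O(t^(b₁-2)) of the potential energy
(`IsFlow.exists_potentialEnergy_le`). It comes from the pseudoconformal law: ‖(x + 2it∇)u‖² + 8t²P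
has derivative at most 8 b₁ t P when b₂ ≤ 2 + b₁, and Grönwall's inequality from t = 1 concludes.

For the rigorous version, u is written as `resolvent` of a continuous L² curve w, so that its
derivatives are bounded operators applied to w and identities extend from Schwartz functions by
density. The weight |x|² is replaced by (1 - e^{-ε|x|²})/ε, and ε tends to 0 only in the inequality
integrated in time. Quadratic functionals are differentiated by symmetry
(`hasDerivAt_re_inner_of_symm`) and the potential energy by convexity (`hasDerivAt_of_subgradient`),
with no regularity beyond that of the solution. -/

noncomputable section

namespace ICQNLS

open scoped LineDeriv ComplexConjugate

/-! ### Fourier multipliers on L² and the Bessel potential. -/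

section

open Classical in
/-- Multiplication by an essentially bounded function, as an operator on `L²`. -/
def mulOp (m : Plane → ℂ) : L2 →L[ℂ] L2 :=
  if h : MemLp m ∞ (volume : Measure Plane) then
    LinearMap.mkContinuous
      { toFun := fun f => (h.toLp m • f : L2)
        map_add' := fun f g => Lp.add_smul _ f g
        map_smul' := fun c f => (Lp.smul_comm c _ f).symm }
      ‖h.toLp m‖ (fun f => Lp.norm_smul_le _ f)
  else 0

theorem mulOp_eq {m : Plane → ℂ} (h : MemLp m ∞ (volume : Measure Plane)) (f : L2) :
    mulOp m f = (h.toLp m • f : L2) := by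
  rw [mulOp, dif_pos h]; rfl

theorem coeFn_mulOp {m : Plane → ℂ} (h : MemLp m ∞ (volume : Measure Plane)) (f : L2) :
    ∀ᵐ x, mulOp m f x = m x * f x := by
  rw [mulOp_eq h]
  filter_upwards [Lp.coeFn_lpSMul (r := 2) (h.toLp m) f, h.coeFn_toLp] with x h1 h2
  rw [h1, Pi.smul_apply', h2, smul_eq_mul]

/-- The Fourier multiplier with an essentially bounded symbol, as an operator on `L²`. -/
def multiplier (m : Plane → ℂ) : L2 →L[ℂ] L2 :=
  ((Lp.fourierTransformₗᵢ Plane ℂ).symm : L2 →L[ℂ] L2) ∘L mulOp m ∘L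
    ((Lp.fourierTransformₗᵢ Plane ℂ) : L2 →L[ℂ] L2)

theorem multiplier_apply (m : Plane → ℂ) (f : L2) : multiplier m f = 𝓕⁻ (mulOp m (𝓕 f)) := rfl

/-- Links the bounded operator with the distributional calculus, where derivatives are multipliers
and symbols compose. -/
theorem coe_multiplier {m : Plane → ℂ} (h : MemLp m ∞ (volume : Measure Plane))
    (hm : m.HasTemperateGrowth) (f : L2) :
    (multiplier m f : 𝓢'(Plane, ℂ)) = TemperedDistribution.fourierMultiplierCLM ℂ m f := by
  rw [multiplier_apply, mulOp_eq h, ← Lp.fourierInv_toTemperedDistribution_eq,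
    Lp.toTemperedDistribution_smul_eq hm, ← Lp.fourier_toTemperedDistribution_eq,
    TemperedDistribution.fourierMultiplierCLM_apply]

theorem coe_injective {f g : L2} (h : (f : 𝓢'(Plane, ℂ)) = g) : f = g :=
  LinearMap.ker_eq_bot.mp (Lp.ker_toTemperedDistributionCLM_eq_bot (F := ℂ)
    (μ := (volume : Measure Plane)) (p := 2)) h

/-- The symbol `(1 + |ξ|²)⁻¹`. -/
def resolventSymbol (ξ : Plane) : ℂ := (((1 + ‖ξ‖ ^ 2) ^ (-1 : ℝ) : ℝ) : ℂ)

/-- The standard basis vectors of the plane. -/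
def basisVec (j : Fin 2) : Plane := EuclideanSpace.basisFun (Fin 2) ℝ j

theorem inner_basisVec (x : Plane) (j : Fin 2) : inner ℝ x (basisVec j) = x j := by
  rw [basisVec, real_inner_comm, EuclideanSpace.basisFun_inner]

/-- The symbol of `∂ⱼ` composed with the resolvent. -/
def derivSymbol (j : Fin 2) (ξ : Plane) : ℂ :=
  2 * Real.pi * Complex.I * ((ξ j : ℝ) : ℂ) * resolventSymbol ξ

/-- The symbol of the Laplacian composed with the resolvent. -/
def laplacianSymbol (ξ : Plane) : ℂ :=
  -((2 * Real.pi) ^ 2 * ‖ξ‖ ^ 2 : ℝ) * resolventSymbol ξ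

theorem hasTemperateGrowth_resolventSymbol : resolventSymbol.HasTemperateGrowth := by
  unfold resolventSymbol; fun_prop

theorem hasTemperateGrowth_coord (j : Fin 2) :
    (fun ξ : Plane => ((ξ j : ℝ) : ℂ)).HasTemperateGrowth := by
  have : (fun ξ : Plane => ((ξ j : ℝ) : ℂ)) = fun ξ => ((inner ℝ ξ (basisVec j) : ℝ) : ℂ) := by
    ext ξ; rw [inner_basisVec]
  rw [this]; fun_prop

theorem hasTemperateGrowth_derivSymbol (j : Fin 2) : (derivSymbol j).HasTemperateGrowth := by
  have h1 := hasTemperateGrowth_coord j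
  have h2 := hasTemperateGrowth_resolventSymbol
  unfold derivSymbol; fun_prop

theorem hasTemperateGrowth_laplacianSymbol : laplacianSymbol.HasTemperateGrowth := by
  have h2 := hasTemperateGrowth_resolventSymbol
  unfold laplacianSymbol; fun_prop

theorem norm_resolventSymbol (ξ : Plane) : ‖resolventSymbol ξ‖ = (1 + ‖ξ‖ ^ 2)⁻¹ := by
  rw [resolventSymbol, Complex.norm_real, Real.rpow_neg_one, Real.norm_of_nonneg (by positivity)]

theorem memLp_top_of_temperate {m : Plane → ℂ} (hm : m.HasTemperateGrowth) (C : ℝ)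
    (hC : ∀ ξ, ‖m ξ‖ ≤ C) : MemLp m ∞ (volume : Measure Plane) :=
  memLp_top_of_bound hm.1.continuous.aestronglyMeasurable C (Eventually.of_forall hC)

theorem memLp_resolventSymbol : MemLp resolventSymbol ∞ (volume : Measure Plane) := by
  refine memLp_top_of_temperate hasTemperateGrowth_resolventSymbol 1 fun ξ => ?_
  rw [norm_resolventSymbol]
  exact inv_le_one_of_one_le₀ (by nlinarith [sq_nonneg ‖ξ‖])

theorem abs_coord_le (x : Plane) (j : Fin 2) : |x j| ≤ ‖x‖ := by
  simpa using PiLp.norm_apply_le x j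

theorem memLp_derivSymbol (j : Fin 2) : MemLp (derivSymbol j) ∞ (volume : Measure Plane) := by
  refine memLp_top_of_temperate (hasTemperateGrowth_derivSymbol j) (2 * Real.pi) fun ξ => ?_
  rw [derivSymbol, norm_mul, norm_resolventSymbol]
  have h : ‖(2 * Real.pi * Complex.I * ((ξ j : ℝ) : ℂ) : ℂ)‖ = 2 * Real.pi * |ξ j| := by
    simp [abs_of_pos Real.pi_pos]
  rw [h, ← div_eq_mul_inv, div_le_iff₀ (by positivity)]
  have := abs_coord_le ξ j
  have : |ξ j| ≤ 1 + ‖ξ‖ ^ 2 := by nlinarith [sq_nonneg (‖ξ‖ - 1)]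
  exact mul_le_mul_of_nonneg_left this (by positivity)

theorem memLp_laplacianSymbol : MemLp laplacianSymbol ∞ (volume : Measure Plane) := by
  refine memLp_top_of_temperate hasTemperateGrowth_laplacianSymbol ((2 * Real.pi) ^ 2) fun ξ => ?_
  rw [laplacianSymbol, norm_mul, norm_resolventSymbol, norm_neg, Complex.norm_real,
    Real.norm_of_nonneg (by positivity), ← div_eq_mul_inv, div_le_iff₀ (by positivity)]
  nlinarith [sq_nonneg (2 * Real.pi)]

/-- The Bessel potential of order `-2`, which maps `L²` onto `H²`. -/
def resolvent : L2 →L[ℂ] L2 := multiplier resolventSymbol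

/-- The derivative `∂ⱼ` of the Bessel potential of order `-2`. -/
def derivOp (j : Fin 2) : L2 →L[ℂ] L2 := multiplier (derivSymbol j)

/-- The Laplacian of the Bessel potential of order `-2`. -/
def laplacianOp : L2 →L[ℂ] L2 := multiplier laplacianSymbol

theorem coe_resolvent (w : L2) :
    (resolvent w : 𝓢'(Plane, ℂ)) = TemperedDistribution.besselPotential Plane ℂ (-2) w := by
  rw [resolvent, coe_multiplier memLp_resolventSymbol hasTemperateGrowth_resolventSymbol,
    TemperedDistribution.besselPotential]
  congr 2
  ext ξ
  rw [resolventSymbol]; norm_num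

theorem coe_derivOp (j : Fin 2) (w : L2) :
    (derivOp j w : 𝓢'(Plane, ℂ)) = ∂_{basisVec j} (resolvent w : 𝓢'(Plane, ℂ)) := by
  have hc := hasTemperateGrowth_coord j
  have hr := hasTemperateGrowth_resolventSymbol
  rw [derivOp, resolvent, coe_multiplier (memLp_derivSymbol j) (hasTemperateGrowth_derivSymbol j),
    coe_multiplier memLp_resolventSymbol hr,
    TemperedDistribution.lineDeriv_eq_fourierMultiplierCLM,
    TemperedDistribution.fourierMultiplierCLM_fourierMultiplierCLM_apply hr
      (by simpa only [inner_basisVec] using hc),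
    ← smul_apply, ← TemperedDistribution.fourierMultiplierCLM_smul]
  · congr 2
    ext ξ
    simp only [derivSymbol, Pi.smul_apply, Pi.mul_apply, smul_eq_mul, inner_basisVec]
    ring
  · exact hr.mul (by simpa only [inner_basisVec] using hc)

theorem coe_laplacianOp (w : L2) :
    (laplacianOp w : 𝓢'(Plane, ℂ)) = Δ (resolvent w : 𝓢'(Plane, ℂ)) := by
  have hr := hasTemperateGrowth_resolventSymbol
  rw [laplacianOp, resolvent, coe_multiplier memLp_laplacianSymbol
    hasTemperateGrowth_laplacianSymbol, coe_multiplier memLp_resolventSymbol hr,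
    TemperedDistribution.laplacian_eq_fourierMultiplierCLM,
    TemperedDistribution.fourierMultiplierCLM_fourierMultiplierCLM_apply hr (by fun_prop)]
  have : laplacianSymbol = ((-(2 * Real.pi) ^ 2 : ℝ) : ℂ) •
      (resolventSymbol * fun x : Plane => Complex.ofReal (‖x‖ ^ 2)) := by
    ext ξ
    simp only [laplacianSymbol, Pi.smul_apply, Pi.mul_apply, smul_eq_mul]
    push_cast
    ring
  rw [this, TemperedDistribution.fourierMultiplierCLM_smul (hr.mul (by fun_prop))]
  rfl

theorem resolvent_toLp (ψ : 𝓢(Plane, ℂ)) : resolvent (ψ.toLp 2) =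
    (SchwartzMap.fourierMultiplierCLM ℂ resolventSymbol ψ).toLp 2 := by
  have hr := hasTemperateGrowth_resolventSymbol
  apply coe_injective
  rw [resolvent, coe_multiplier memLp_resolventSymbol hr, Lp.toTemperedDistribution_toLp_eq,
    TemperedDistribution.fourierMultiplierCLM_toTemperedDistributionCLM_eq hr,
    Lp.toTemperedDistribution_toLp_eq]

/-- On Schwartz functions, the Bessel potential is a Schwartz function `g`, and the operators
`derivOp` and `laplacianOp` give its derivatives. -/
theorem exists_schwartz_resolvent (ψ : 𝓢(Plane, ℂ)) : ∃ g : 𝓢(Plane, ℂ),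
    resolvent (ψ.toLp 2) = g.toLp 2 ∧ (∀ j, derivOp j (ψ.toLp 2) = (∂_{basisVec j} g).toLp 2) ∧
    laplacianOp (ψ.toLp 2) = (Δ g).toLp 2 := by
  have h0 := resolvent_toLp ψ
  refine ⟨SchwartzMap.fourierMultiplierCLM ℂ resolventSymbol ψ, h0, fun j => ?_, ?_⟩
  · apply coe_injective
    rw [coe_derivOp, h0, Lp.toTemperedDistribution_toLp_eq, Lp.toTemperedDistribution_toLp_eq,
      TemperedDistribution.lineDerivOp_toTemperedDistributionCLM_eq]
  · apply coe_injective
    rw [coe_laplacianOp, h0, Lp.toTemperedDistribution_toLp_eq, Lp.toTemperedDistribution_toLp_eq,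
      TemperedDistribution.laplacian_toTemperedDistributionCLM_eq]

/-- Schwartz functions are dense, so an identity between continuous expressions in w needs checking
only on them. -/
theorem l2_induction {p : L2 → Prop} (hp : IsClosed {w | p w})
    (h : ∀ ψ : 𝓢(Plane, ℂ), p (ψ.toLp 2)) (w : L2) : p w :=
  DenseRange.induction_on (p := p)
    (SchwartzMap.denseRange_toLpCLM (E := Plane) (F := ℂ) (p := 2) ENNReal.ofNat_ne_top) w hp h

/-- Trades an H² curve u for an L² curve w: derivatives of u become bounded operators applied to w,
and continuity in H² becomes continuity of w. -/
theorem eq_resolvent_of_sobolev {f w : L2}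
    (h : TemperedDistribution.besselPotential Plane ℂ 2 (f : 𝓢'(Plane, ℂ)) = w) :
    f = resolvent w := by
  apply coe_injective
  rw [coe_resolvent, ← h, TemperedDistribution.besselPotential_besselPotential_apply]
  simp

theorem tendsto_ae_of_tendsto {f : ℕ → L2} {g : L2} (h : Tendsto f atTop (𝓝 g)) :
    ∃ ns : ℕ → ℕ, StrictMono ns ∧ ∀ᵐ x, Tendsto (fun n => f (ns n) x) atTop (𝓝 (g x)) :=
  (tendstoInMeasure_of_tendsto_Lp h).exists_seq_tendsto_ae

/-! ### The Sobolev embedding of H² into the bounded functions. -/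

theorem memLp_two_resolventSymbol : MemLp resolventSymbol 2 (volume : Measure Plane) := by
  have hcont := hasTemperateGrowth_resolventSymbol.1.continuous
  rw [memLp_two_iff_integrable_sq_norm hcont.aestronglyMeasurable]
  -- The squared symbol is (1 + |ξ|²)^(-r/2) with r = 4, which exceeds the dimension 2.
  have h := integrable_rpow_neg_one_add_norm_sq (E := Plane) (μ := volume) (r := 4) (by simp; norm_num)
  refine h.congr (Eventually.of_forall fun x => ?_)
  simp only [norm_resolventSymbol]
  rw [show (-4 / 2 : ℝ) = ((-2 : ℤ) : ℝ) by norm_num, Real.rpow_intCast]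
  rw [zpow_neg, inv_pow]; norm_cast

theorem integral_norm_mul_le_of_memLp {a b : Plane → ℂ} (ha : MemLp a 2 volume)
    (hb : MemLp b 2 volume) :
    ∫ ξ, ‖a ξ * b ξ‖ ≤ (eLpNorm a 2 volume).toReal * (eLpNorm b 2 volume).toReal := by
  have e2 : ∫ ξ, ‖a ξ * b ξ‖ = (eLpNorm (a • b) 1 volume).toReal := by
    rw [eLpNorm_one_eq_lintegral_enorm]
    exact integral_norm_eq_lintegral_enorm (ha.1.mul hb.1)
  rw [e2, ← ENNReal.toReal_mul]
  exact ENNReal.toReal_mono (ENNReal.mul_ne_top ha.2.ne hb.2.ne)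
    (eLpNorm_smul_le_mul_eLpNorm hb.1 ha.1)

theorem norm_fourierInv_le (h : 𝓢(Plane, ℂ)) (x : Plane) :
    ‖(𝓕⁻ h : 𝓢(Plane, ℂ)) x‖ ≤ ∫ ξ, ‖h ξ‖ := by
  rw [SchwartzMap.fourierInv_coe, Real.fourierInv_eq]
  refine (norm_integral_le_integral_norm _).trans (le_of_eq ?_)
  simp

/-- An inverse Fourier transform is bounded by the L¹ norm of its argument; Cauchy–Schwarz splits
off the symbol, and Plancherel identifies the other factor. -/
theorem norm_fourierMultiplier_resolventSymbol_le (ψ : 𝓢(Plane, ℂ)) (x : Plane) :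
    ‖SchwartzMap.fourierMultiplierCLM ℂ resolventSymbol ψ x‖ ≤
      (eLpNorm resolventSymbol 2 volume).toReal * ‖ψ.toLp 2‖ := by
  have hr := hasTemperateGrowth_resolventSymbol
  rw [SchwartzMap.fourierMultiplierCLM_apply]
  refine (norm_fourierInv_le _ x).trans ?_
  simp only [SchwartzMap.smulLeftCLM_apply_apply hr, smul_eq_mul]
  refine (integral_norm_mul_le_of_memLp memLp_two_resolventSymbol
    ((𝓕 ψ : 𝓢(Plane, ℂ)).memLp 2)).trans (le_of_eq ?_)
  have h := Lp.norm_fourier_eq (ψ.toLp 2 (volume : Measure Plane))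
  rw [SchwartzMap.toLp_fourier_eq, SchwartzMap.norm_toLp] at h
  rw [h]

/-- The Sobolev embedding `H² ⊂ L^∞` of the plane. -/
theorem exists_norm_resolvent_le : ∃ C : ℝ, 0 ≤ C ∧ ∀ w : L2, ∀ᵐ x, ‖resolvent w x‖ ≤ C * ‖w‖ := by
  refine ⟨(eLpNorm resolventSymbol 2 volume).toReal, ENNReal.toReal_nonneg, fun w => ?_⟩
  refine l2_induction (p := fun w => ∀ᵐ x, ‖resolvent w x‖ ≤
    (eLpNorm resolventSymbol 2 volume).toReal * ‖w‖) ?_ ?_ w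
  · refine IsSeqClosed.isClosed fun f g hf hg => ?_
    obtain ⟨ns, hns, h⟩ := tendsto_ae_of_tendsto ((resolvent.continuous.tendsto g).comp hg)
    filter_upwards [h, ae_all_iff.mpr hf] with x hx hf
    refine le_of_tendsto_of_tendsto' hx.norm
      ((hg.comp hns.tendsto_atTop).norm.const_mul _) fun n => hf (ns n)
  · intro ψ
    rw [resolvent_toLp]
    filter_upwards [(SchwartzMap.fourierMultiplierCLM ℂ resolventSymbol ψ).coeFn_toLp 2] with x hx
    rw [hx]
    exact norm_fourierMultiplier_resolventSymbol_le ψ x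

end

section

/-! ### Real weights and integration by parts -/

/-- Multiplication by a bounded real weight. -/
def mulR (m : Plane → ℝ) : L2 →L[ℂ] L2 := mulOp fun x => (m x : ℂ)

/-- A bounded measurable real function. -/
structure BddWeight (m : Plane → ℝ) : Prop where
  meas : Measurable m
  bdd : ∃ C, ∀ x, |m x| ≤ C

theorem BddWeight.memLp {m : Plane → ℝ} (h : BddWeight m) :
    MemLp (fun x => (m x : ℂ)) ∞ (volume : Measure Plane) := by
  obtain ⟨C, hC⟩ := h.bdd
  refine memLp_top_of_bound (Complex.measurable_ofReal.comp h.meas).aestronglyMeasurable C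
    (Eventually.of_forall fun x => ?_)
  rw [Complex.norm_real]
  exact hC x

theorem BddWeight.coeFn_mulR {m : Plane → ℝ} (h : BddWeight m) (f : L2) :
    ∀ᵐ x, mulR m f x = m x * f x := coeFn_mulOp h.memLp f

theorem inner_eq_integral (f g : L2) : inner ℂ f g = ∫ x, conj (f x) * g x := by
  rw [L2.inner_def]
  simp only [RCLike.inner_apply]
  congr with x
  ring

theorem integrable_conj_mul (f g : L2) : Integrable fun x : Plane => conj (f x) * g x := by
  refine (L2.integrable_inner (𝕜 := ℂ) f g).congr (Eventually.of_forall fun x => ?_)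
  simp only [RCLike.inner_apply]
  ring

theorem BddWeight.inner_mulR_left {m : Plane → ℝ} (h : BddWeight m) (f g : L2) :
    inner ℂ (mulR m f) g = inner ℂ f (mulR m g) := by
  rw [inner_eq_integral, inner_eq_integral]
  refine integral_congr_ae ?_
  filter_upwards [h.coeFn_mulR f, h.coeFn_mulR g] with x h1 h2
  rw [h1, h2, map_mul, Complex.conj_ofReal]
  ring

/-- `m'` is the derivative of `m` in the `j`-th coordinate direction. -/
def HasPartial (j : Fin 2) (m m' : Plane → ℝ) : Prop :=
  ∀ x, HasDerivAt (fun s : ℝ => m (x + s • basisVec j)) (m' x) 0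

/-- Integration by parts against the constant 1. Only pointwise directional derivatives and
integrability are needed, so that weights such as x_j |x|^b are allowed. -/
theorem integral_partial_eq_zero {F F' : Plane → ℂ} (j : Fin 2)
    (h : ∀ x, HasDerivAt (fun s : ℝ => F (x + s • basisVec j)) (F' x) 0)
    (hF : Integrable F) (hF' : Integrable F') : ∫ x, F' x = 0 := by
  have := integral_bilinear_hasLineDerivAt_right_eq_neg_left_of_integrable (μ := volume)
    (f := fun _ : Plane => (1 : ℂ)) (f' := fun _ => 0) (g := F) (g' := F') (v := basisVec j)
    (B := ContinuousLinearMap.mul ℝ ℂ) (by simp) (by simpa using hF') (by simpa using hF)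
    (fun x _ => hasDerivAt_const (0 : ℝ) (1 : ℂ)) (fun x _ => h x)
  simpa using this

theorem hasDerivAt_schwartz (g : 𝓢(Plane, ℂ)) (x v : Plane) :
    HasDerivAt (fun s : ℝ => g (x + s • v)) ((∂_{v} g : 𝓢(Plane, ℂ)) x) 0 := by
  have := (g.differentiableAt (x := x)).hasFDerivAt.hasLineDerivAt v
  rwa [← SchwartzMap.lineDerivOp_apply_eq_fderiv] at this

theorem integrable_mul_schwartz {m : Plane → ℂ} (hm : Measurable m) {C : ℝ} (hC : ∀ x, ‖m x‖ ≤ C)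
    (g h : 𝓢(Plane, ℂ)) : Integrable fun x => conj (g x) * (m x * h x) := by
  have h1 : Integrable fun x => conj (g x) * m x * h x := by
    refine h.integrable.bdd_mul (c := SchwartzMap.seminorm ℝ 0 0 g * C)
      ((Complex.continuous_conj.comp g.continuous).measurable.mul hm).aestronglyMeasurable
      (Eventually.of_forall fun x => ?_)
    rw [norm_mul, RCLike.norm_conj]
    exact mul_le_mul (SchwartzMap.norm_le_seminorm ℝ g x) (hC x) (norm_nonneg _) (by positivity)
  simpa only [mul_assoc] using h1

theorem BddWeight.integrable_schwartz {m : Plane → ℝ} (hm : BddWeight m) (g h : 𝓢(Plane, ℂ)) :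
    Integrable fun x => conj (g x) * (m x * h x) := by
  obtain ⟨C, hC⟩ := hm.bdd
  exact integrable_mul_schwartz (Complex.measurable_ofReal.comp hm.meas) (C := C)
    (fun x => by simpa using hC x) g h

theorem BddWeight.inner_mulR_schwartz {m : Plane → ℝ} (hm : BddWeight m) (g h : 𝓢(Plane, ℂ)) :
    inner ℂ (g.toLp 2 : L2) (mulR m (h.toLp 2)) = ∫ x, conj (g x) * (m x * h x) := by
  rw [inner_eq_integral]
  refine integral_congr_ae ?_
  filter_upwards [hm.coeFn_mulR (h.toLp 2), h.coeFn_toLp 2, g.coeFn_toLp 2] with x h1 h2 h3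
  rw [h1, h2, h3]

/-- Integration by parts against a weight, for Schwartz functions. -/
theorem inner_partial_schwartz {m m' : Plane → ℝ} {j : Fin 2} (hm : BddWeight m) (hm' : BddWeight m')
    (h : HasPartial j m m') (f g : 𝓢(Plane, ℂ)) :
    inner ℂ ((∂_{basisVec j} f : 𝓢(Plane, ℂ)).toLp 2 : L2) (mulR m (g.toLp 2)) =
      -inner ℂ (f.toLp 2 : L2) (mulR m' (g.toLp 2)) -
        inner ℂ (f.toLp 2 : L2) (mulR m ((∂_{basisVec j} g : 𝓢(Plane, ℂ)).toLp 2)) := by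
  rw [hm.inner_mulR_schwartz, hm'.inner_mulR_schwartz, hm.inner_mulR_schwartz]
  have i0 := hm.integrable_schwartz f g
  have i1 := hm.integrable_schwartz (∂_{basisVec j} f) g
  have i2 := hm'.integrable_schwartz f g
  have i3 := hm.integrable_schwartz f (∂_{basisVec j} g)
  have i23 : Integrable fun x => conj (f x) * (m' x * g x) +
    conj (f x) * (m x * (∂_{basisVec j} g : 𝓢(Plane, ℂ)) x) := i2.add i3
  have key := integral_partial_eq_zero j (F := fun x => conj (f x) * (m x * g x))
    (F' := fun x => conj ((∂_{basisVec j} f : 𝓢(Plane, ℂ)) x) * (m x * g x) +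
      (conj (f x) * (m' x * g x) + conj (f x) * (m x * (∂_{basisVec j} g : 𝓢(Plane, ℂ)) x)))
    (fun x => ?_) i0 (i1.add i23)
  · rw [integral_add i1 i23, integral_add i2 i3] at key
    linear_combination key
  · have d1 := (hasDerivAt_schwartz f x (basisVec j)).star
    have d2 := (h x).ofReal_comp
    have d3 := hasDerivAt_schwartz g x (basisVec j)
    have := d1.mul (d2.mul d3)
    refine this.congr_deriv ?_
    simp only [zero_smul, add_zero, Complex.star_def, Pi.mul_apply]
    ring

/-- Both derivatives are Fourier multipliers, and the product of symbols commutes. -/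
theorem lineDeriv_comm_schwartz (g : 𝓢(Plane, ℂ)) (v w : Plane) :
    (∂_{v} (∂_{w} g) : 𝓢(Plane, ℂ)) = ∂_{w} (∂_{v} g) := by
  have hv : (fun x : Plane => inner ℝ x v).HasTemperateGrowth := by fun_prop
  have hw : (fun x : Plane => inner ℝ x w).HasTemperateGrowth := by fun_prop
  simp only [SchwartzMap.lineDeriv_eq_fourierMultiplierCLM,
    ← SchwartzMap.fourierMultiplierCLM_ofReal ℂ hv, ← SchwartzMap.fourierMultiplierCLM_ofReal ℂ hw,
    map_smul]
  rw [SchwartzMap.fourierMultiplierCLM_fourierMultiplierCLM_apply (by fun_prop) (by fun_prop),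
    SchwartzMap.fourierMultiplierCLM_fourierMultiplierCLM_apply (by fun_prop) (by fun_prop),
    mul_comm (fun x : Plane => (RCLike.ofReal (inner ℝ x v) : ℂ))]

theorem toLp_laplacian (g : 𝓢(Plane, ℂ)) : ((Δ g : 𝓢(Plane, ℂ)).toLp 2 : L2) =
    ∑ j, (∂_{basisVec j} (∂_{basisVec j} g) : 𝓢(Plane, ℂ)).toLp 2 := by
  rw [SchwartzMap.laplacian_eq_sum (EuclideanSpace.basisFun (Fin 2) ℝ),
    ← SchwartzMap.toLpCLM_apply (𝕜 := ℂ), map_sum]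
  rfl

/-- The function, its gradient and its Laplacian are separate slots of `p`, so on Schwartz functions
they become genuine derivatives of one g. Bilinear identities are reduced one slot at a time, the
other argument being frozen. -/
theorem schwartz_induction {p : L2 → L2 → (Fin 2 → L2) → L2 → Prop}
    (hp : IsClosed {w | p w (resolvent w) (fun j => derivOp j w) (laplacianOp w)})
    (h : ∀ (w : L2) (g : 𝓢(Plane, ℂ)),
      p w (g.toLp 2) (fun j => (∂_{basisVec j} g : 𝓢(Plane, ℂ)).toLp 2)
        (∑ j, (∂_{basisVec j} (∂_{basisVec j} g) : 𝓢(Plane, ℂ)).toLp 2)) (w : L2) :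
    p w (resolvent w) (fun j => derivOp j w) (laplacianOp w) := by
  refine l2_induction (p := fun w => p w (resolvent w) (fun j => derivOp j w) (laplacianOp w))
    hp (fun ψ => ?_) w
  obtain ⟨g, h0, h1, h2⟩ := exists_schwartz_resolvent ψ
  simp only [h0, h1, h2, toLp_laplacian]
  exact h _ g

theorem bddWeight_const (c : ℝ) : BddWeight fun _ => c := ⟨measurable_const, |c|, fun _ => le_rfl⟩

theorem mulR_one (f : L2) : mulR (fun _ => 1) f = f := by
  refine Lp.ext ?_
  filter_upwards [(bddWeight_const 1).coeFn_mulR f] with x hx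
  rw [hx]; simp

theorem mulR_zero (f : L2) : mulR (fun _ => 0) f = 0 := by
  refine Lp.ext ?_
  filter_upwards [(bddWeight_const 0).coeFn_mulR f, Lp.coeFn_zero ℂ 2 (volume : Measure Plane)]
    with x hx h0
  rw [hx, h0]; simp

theorem hasPartial_const (j : Fin 2) (c : ℝ) : HasPartial j (fun _ => c) (fun _ => 0) :=
  fun _ => hasDerivAt_const _ _

theorem inner_partial_schwartz_one (j : Fin 2) (f g : 𝓢(Plane, ℂ)) :
    inner ℂ ((∂_{basisVec j} f : 𝓢(Plane, ℂ)).toLp 2 : L2) (g.toLp 2) =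
      -inner ℂ (f.toLp 2 : L2) ((∂_{basisVec j} g : 𝓢(Plane, ℂ)).toLp 2) := by
  have := inner_partial_schwartz (bddWeight_const 1) (bddWeight_const 0) (hasPartial_const j 1) f g
  simpa [mulR_one, mulR_zero] using this

theorem inner_resolvent_laplacianOp_eq (v w : L2) :
    inner ℂ (resolvent v) (laplacianOp w) = -∑ j, inner ℂ (derivOp j v) (derivOp j w) := by
  refine schwartz_induction (p := fun _ f d _ => inner ℂ f (laplacianOp w) =
    -∑ j, inner ℂ (d j) (derivOp j w)) (isClosed_eq (by fun_prop) (by fun_prop)) (fun _ f => ?_) v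
  refine schwartz_induction (p := fun _ g d l => inner ℂ (f.toLp 2 : L2) l =
    -∑ j, inner ℂ ((∂_{basisVec j} f : 𝓢(Plane, ℂ)).toLp 2 : L2) (d j))
    (isClosed_eq (by fun_prop) (by fun_prop)) (fun _ g => ?_) w
  simp only [inner_sum, inner_partial_schwartz_one, Finset.sum_neg_distrib, neg_neg]

theorem inner_laplacianOp_resolvent (v w : L2) :
    inner ℂ (laplacianOp v) (resolvent w) = inner ℂ (resolvent v) (laplacianOp w) := by
  rw [← inner_conj_symm, inner_resolvent_laplacianOp_eq, inner_resolvent_laplacianOp_eq]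
  simp [inner_conj_symm]

theorem re_inner_resolvent_laplacianOp (w : L2) :
    (inner ℂ (resolvent w) (laplacianOp w)).re = -∑ j, ‖derivOp j w‖ ^ 2 := by
  rw [inner_resolvent_laplacianOp_eq]
  simp only [Complex.neg_re, Complex.re_sum, inner_self_eq_norm_sq_to_K]
  norm_cast

/-! ### Vector fields -/

/-- A bounded vector field `a` with bounded derivatives `ja j k = ∂ⱼ aₖ`, divergence `dv` and
gradient of the divergence `gd`. -/
structure AdmissibleField (a : Fin 2 → Plane → ℝ) (ja : Fin 2 → Fin 2 → Plane → ℝ)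
    (dv : Plane → ℝ) (gd : Fin 2 → Plane → ℝ) : Prop where
  bdd : ∀ k, BddWeight (a k)
  bdd_jac : ∀ j k, BddWeight (ja j k)
  bdd_div : BddWeight dv
  bdd_grad : ∀ j, BddWeight (gd j)
  partial_field : ∀ j k, HasPartial j (a k) (ja j k)
  div_eq : ∀ x, dv x = ∑ k, ja k k x
  partial_div : ∀ j, HasPartial j dv (gd j)

/-- The symmetric operator `-i (a · ∇ + (div a) / 2)`, composed with the resolvent. -/
def transport (a : Fin 2 → Plane → ℝ) (dv : Plane → ℝ) : L2 →L[ℂ] L2 :=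
  (-Complex.I) • (∑ k, mulR (a k) ∘L derivOp k + (1 / 2 : ℂ) • (mulR dv ∘L resolvent))

theorem transport_apply (a : Fin 2 → Plane → ℝ) (dv : Plane → ℝ) (w : L2) :
    transport a dv w = (-Complex.I) • (∑ k, mulR (a k) (derivOp k w) +
      (1 / 2 : ℂ) • mulR dv (resolvent w)) := by
  simp [transport]

variable {a : Fin 2 → Plane → ℝ} {ja : Fin 2 → Fin 2 → Plane → ℝ} {dv : Plane → ℝ}
  {gd : Fin 2 → Plane → ℝ}

theorem AdmissibleField.mulR_div (h : AdmissibleField a ja dv gd) (f : L2) :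
    mulR dv f = mulR (ja 0 0) f + mulR (ja 1 1) f := by
  refine Lp.ext ?_
  filter_upwards [h.bdd_div.coeFn_mulR f, (h.bdd_jac 0 0).coeFn_mulR f,
    (h.bdd_jac 1 1).coeFn_mulR f, Lp.coeFn_add (mulR (ja 0 0) f) (mulR (ja 1 1) f)]
    with x h1 h2 h3 h4
  rw [h4, Pi.add_apply, h1, h2, h3, h.div_eq, Fin.sum_univ_two]
  push_cast
  ring

theorem inner_partial_resolvent {m m' : Plane → ℝ} {j : Fin 2} (hm : BddWeight m)
    (hm' : BddWeight m') (h : HasPartial j m m') (v w : L2) :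
    inner ℂ (derivOp j v) (mulR m (resolvent w)) =
      -inner ℂ (resolvent v) (mulR m' (resolvent w)) -
        inner ℂ (resolvent v) (mulR m (derivOp j w)) := by
  refine schwartz_induction (p := fun _ f d _ => inner ℂ (d j) (mulR m (resolvent w)) =
      -inner ℂ f (mulR m' (resolvent w)) - inner ℂ f (mulR m (derivOp j w)))
      (isClosed_eq (by fun_prop) (by fun_prop)) (fun _ f => ?_) v
  exact schwartz_induction (p := fun _ g d _ =>
      inner ℂ ((∂_{basisVec j} f : 𝓢(Plane, ℂ)).toLp 2 : L2) (mulR m g) =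
      -inner ℂ (f.toLp 2 : L2) (mulR m' g) - inner ℂ (f.toLp 2 : L2) (mulR m (d j)))
      (isClosed_eq (by fun_prop) (by fun_prop)) (fun _ g => inner_partial_schwartz hm hm' h f g) w

/-- Moving a · ∇ across the inner product costs a sign and the full divergence of a; the added half
divergence balances the two sides, and the factor -i turns skew symmetry into symmetry. -/
theorem AdmissibleField.inner_transport (h : AdmissibleField a ja dv gd) (v w : L2) :
    inner ℂ (transport a dv v) (resolvent w) = inner ℂ (resolvent v) (transport a dv w) := by
  have h0 := inner_partial_resolvent (h.bdd 0) (h.bdd_jac 0 0) (h.partial_field 0 0) v w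
  have h1 := inner_partial_resolvent (h.bdd 1) (h.bdd_jac 1 1) (h.partial_field 1 1) v w
  have h2 := congrArg (inner ℂ (resolvent v)) (h.mulR_div (resolvent w))
  rw [inner_add_right] at h2
  simp only [transport_apply, Fin.sum_univ_two, inner_smul_left, inner_smul_right, inner_add_left,
    inner_add_right, (h.bdd _).inner_mulR_left, h.bdd_div.inner_mulR_left, h0, h1, map_neg,
    Complex.conj_I, map_div₀, map_one, map_ofNat, h2]
  ring

/-- The derivative of `∫ ρ |f|²` along the free flow. -/
theorem AdmissibleField.inner_laplacian_weight {ρ : Plane → ℝ} (h : AdmissibleField a ja dv gd)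
    (hρ : BddWeight ρ) (hρa : ∀ k, HasPartial k ρ (a k)) (w : L2) :
    (inner ℂ (Complex.I • laplacianOp w) (mulR ρ (resolvent w))).re =
      (inner ℂ (resolvent w) (transport a dv w)).re := by
  have key : inner ℂ (laplacianOp w) (mulR ρ (resolvent w)) =
      -∑ j, (inner ℂ (derivOp j w) (mulR (a j) (resolvent w)) +
        inner ℂ (derivOp j w) (mulR ρ (derivOp j w))) := by
    refine schwartz_induction (p := fun _ f d l => inner ℂ l (mulR ρ f) =
      -∑ j, (inner ℂ (d j) (mulR (a j) f) + inner ℂ (d j) (mulR ρ (d j))))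
      (isClosed_eq (by fun_prop) (by fun_prop)) (fun _ f => ?_) w
    rw [sum_inner, ← Finset.sum_neg_distrib]
    refine Finset.sum_congr rfl fun j _ => ?_
    rw [inner_partial_schwartz hρ (h.bdd j) (hρa j)]
    ring
  -- Multiplication by a real weight is symmetric, so the Dirichlet term weighted by ρ and the
  -- divergence term are real and drop out after the factor i.
  have hreal : ∀ (m : Plane → ℝ) (_ : BddWeight m) (f : L2), (inner ℂ f (mulR m f)).im = 0 := by
    intro m hm f
    have := congrArg Complex.im (inner_conj_symm (𝕜 := ℂ) f (mulR m f))
    rw [hm.inner_mulR_left, Complex.conj_im] at this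
    linarith
  have hsw : ∀ k, (inner ℂ (resolvent w) (mulR (a k) (derivOp k w))).im =
      -(inner ℂ (derivOp k w) (mulR (a k) (resolvent w))).im := by
    intro k
    have := congrArg Complex.im (inner_conj_symm (𝕜 := ℂ) (derivOp k w) (mulR (a k) (resolvent w)))
    rw [(h.bdd k).inner_mulR_left, Complex.conj_im] at this
    linarith
  have hd := hreal dv h.bdd_div (resolvent w)
  have e0 := hreal ρ hρ (derivOp 0 w)
  have e1 := hreal ρ hρ (derivOp 1 w)
  simp only [transport_apply, Fin.sum_univ_two, inner_smul_left, inner_smul_right,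
    inner_add_right, key, Complex.conj_I]
  simp [hsw, hd, e0, e1]
  ring

/-- The algebraic core of the virial identity, with `D` and `DD` in the role of first and second
derivatives and `e`, `e2` the integrations by parts. Second derivatives occur only through a · ∇ of
|D j|²; these terms give half the divergence and cancel against the divergence part of the transport
operator. -/
theorem AdmissibleField.re_inner_sum_transport (h : AdmissibleField a ja dv gd) {F : L2}
    {D : Fin 2 → L2} {DD : Fin 2 → Fin 2 → L2} (hDD : ∀ j k, DD j k = DD k j)
    (e : ∀ i j k l, inner ℂ (DD i j) (mulR (a k) (D l)) =
      -inner ℂ (D j) (mulR (ja i k) (D l)) - inner ℂ (D j) (mulR (a k) (DD i l)))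
    (e2 : ∀ j, inner ℂ (DD j j) (mulR dv F) =
      -inner ℂ (D j) (mulR (gd j) F) - inner ℂ (D j) (mulR dv (D j))) :
    -(inner ℂ (∑ j, DD j j) (∑ k, mulR (a k) (D k) + (1 / 2 : ℂ) • mulR dv F)).re =
      ∑ j, ∑ k, (inner ℂ (D j) (mulR (ja j k) (D k))).re +
        1 / 2 * ∑ j, (inner ℂ (D j) (mulR (gd j) F)).re := by
  -- With the outer index equal to the index of the field, `e` expresses a pairing by minus its own
  -- conjugate, which determines the real part.
  have e3 : ∀ j k, 2 * (inner ℂ (D j) (mulR (a k) (DD j k))).re =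
      -(inner ℂ (D j) (mulR (ja k k) (D j))).re := by
    intro j k
    have e := e k j k j
    rw [← (h.bdd k).inner_mulR_left, ← inner_conj_symm] at e
    rw [hDD j k]
    have := congrArg Complex.re e
    rw [Complex.conj_re, Complex.sub_re, Complex.neg_re] at this
    linarith
  have e4 : ∀ j, (inner ℂ (D j) (mulR dv (D j))).re =
      (inner ℂ (D j) (mulR (ja 0 0) (D j))).re + (inner ℂ (D j) (mulR (ja 1 1) (D j))).re := by
    intro j
    rw [h.mulR_div, inner_add_right, Complex.add_re]
  have half : (1 / 2 : ℂ) = ((1 / 2 : ℝ) : ℂ) := by norm_num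
  simp only [Fin.sum_univ_two, inner_add_left, inner_add_right, inner_smul_right, half, e, e2,
    Complex.add_re, Complex.sub_re, Complex.neg_re, Complex.re_ofReal_mul]
  linarith [e3 0 0, e3 0 1, e3 1 0, e3 1 1, e4 0, e4 1]

theorem AdmissibleField.re_inner_laplacian_schwartz (h : AdmissibleField a ja dv gd)
    (f : 𝓢(Plane, ℂ)) {F l : L2} {D : Fin 2 → L2} (hF : F = f.toLp 2)
    (hD : ∀ j, D j = (∂_{basisVec j} f : 𝓢(Plane, ℂ)).toLp 2)
    (hl : l = ∑ j, (∂_{basisVec j} (∂_{basisVec j} f) : 𝓢(Plane, ℂ)).toLp 2) :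
    -(inner ℂ l (∑ k, mulR (a k) (D k) + (1 / 2 : ℂ) • mulR dv F)).re =
      ∑ j, ∑ k, (inner ℂ (D j) (mulR (ja j k) (D k))).re +
        1 / 2 * ∑ j, (inner ℂ (D j) (mulR (gd j) F)).re := by
  obtain ⟨DD, hDD⟩ : ∃ DD : Fin 2 → Fin 2 → L2, ∀ j k,
      DD j k = (∂_{basisVec j} (∂_{basisVec k} f) : 𝓢(Plane, ℂ)).toLp 2 := ⟨_, fun _ _ => rfl⟩
  have hl' : l = ∑ j, DD j j := by simp only [hl, hDD]
  rw [hl']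
  refine h.re_inner_sum_transport (fun j k => ?_) (fun i j k l => ?_) (fun j => ?_)
  · rw [hDD, hDD, lineDeriv_comm_schwartz f (basisVec j) (basisVec k)]
  · rw [hDD, hDD, hD, hD]
    exact inner_partial_schwartz (h.bdd k) (h.bdd_jac i k) (h.partial_field i k) _ _
  · rw [hDD, hD, hF]
    exact inner_partial_schwartz h.bdd_div (h.bdd_grad j) (h.partial_div j) _ _

/-- The virial identity for the free flow. -/
theorem AdmissibleField.inner_laplacian_transport (h : AdmissibleField a ja dv gd) (w : L2) :
    (inner ℂ (Complex.I • laplacianOp w) (transport a dv w)).re =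
      ∑ j, ∑ k, (inner ℂ (derivOp j w) (mulR (ja j k) (derivOp k w))).re +
        1 / 2 * ∑ j, (inner ℂ (derivOp j w) (mulR (gd j) (resolvent w))).re := by
  have key : -(inner ℂ (laplacianOp w) (∑ k, mulR (a k) (derivOp k w) +
      (1 / 2 : ℂ) • mulR dv (resolvent w))).re =
      ∑ j, ∑ k, (inner ℂ (derivOp j w) (mulR (ja j k) (derivOp k w))).re +
        1 / 2 * ∑ j, (inner ℂ (derivOp j w) (mulR (gd j) (resolvent w))).re :=
    schwartz_induction (p := fun _ f d l => -(inner ℂ l (∑ k, mulR (a k) (d k) +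
      (1 / 2 : ℂ) • mulR dv f)).re = ∑ j, ∑ k, (inner ℂ (d j) (mulR (ja j k) (d k))).re +
        1 / 2 * ∑ j, (inner ℂ (d j) (mulR (gd j) f)).re)
      (isClosed_eq
        (Complex.continuous_re.comp (Continuous.inner (by fun_prop) (by fun_prop))).neg
        (by fun_prop)) (fun _ f => h.re_inner_laplacian_schwartz f rfl (fun _ => rfl) rfl) w
  rw [← key, transport_apply, inner_smul_left, inner_smul_right, Complex.conj_I]
  rw [← mul_assoc, neg_mul_neg, Complex.I_mul_I, neg_one_mul, Complex.neg_re]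

end

section

/-! ### Gaussian weights -/

theorem coord_add_smul_basisVec (x : Plane) (j k : Fin 2) (s : ℝ) :
    (x + s • basisVec j) k = x k + s * (if j = k then 1 else 0) := by
  simp [basisVec, eq_comm]

theorem hasPartial_coord (j k : Fin 2) :
    HasPartial j (fun x => x k) (fun _ => if j = k then 1 else 0) := by
  intro x
  simp only [coord_add_smul_basisVec]
  simpa using ((hasDerivAt_id (0 : ℝ)).mul_const (if j = k then (1 : ℝ) else 0)).const_add (x k)

theorem norm_sq_plane (x : Plane) : ‖x‖ ^ 2 = x 0 ^ 2 + x 1 ^ 2 := by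
  simp [EuclideanSpace.norm_sq_eq, Fin.sum_univ_two]

theorem hasPartial_norm_sq (j : Fin 2) : HasPartial j (fun x => ‖x‖ ^ 2) (fun x => 2 * x j) := by
  intro x
  simp only [norm_sq_plane]
  have h0 := (hasPartial_coord j 0 x).pow 2
  have h1 := (hasPartial_coord j 1 x).pow 2
  refine (h0.add h1).congr_deriv ?_
  fin_cases j <;> simp

/-- The Gaussian `e^{-ε|x|²}`. -/
def gauss (ε : ℝ) (x : Plane) : ℝ := Real.exp (-(ε * ‖x‖ ^ 2))

theorem hasPartial_gauss (ε : ℝ) (j : Fin 2) :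
    HasPartial j (gauss ε) (fun x => -(2 * ε * x j) * gauss ε x) := by
  intro x
  have h := (((hasPartial_norm_sq j x).const_mul ε).neg).exp
  refine h.congr_deriv ?_
  simp [gauss]
  ring

theorem gauss_pos (ε : ℝ) (x : Plane) : 0 < gauss ε x := Real.exp_pos _

theorem gauss_le_one {ε : ℝ} (hε : 0 ≤ ε) (x : Plane) : gauss ε x ≤ 1 := by
  rw [gauss, Real.exp_le_one_iff]
  have := mul_nonneg hε (sq_nonneg ‖x‖)
  linarith

theorem continuous_gauss (ε : ℝ) : Continuous (gauss ε) := by unfold gauss; fun_prop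

/-- This is sⁿ/n! ≤ eˢ at s = ε|x|². -/
theorem pow_mul_gauss_le {ε : ℝ} (hε : 0 < ε) (n : ℕ) (x : Plane) :
    ‖x‖ ^ (2 * n) * gauss ε x ≤ n.factorial / ε ^ n := by
  have h := Real.pow_div_factorial_le_exp (ε * ‖x‖ ^ 2) (by positivity) n
  have hf : (0 : ℝ) < n.factorial := by exact_mod_cast n.factorial_pos
  rw [div_le_iff₀ hf, mul_pow, ← pow_mul] at h
  rw [gauss, Real.exp_neg, ← div_eq_mul_inv, div_le_div_iff₀ (Real.exp_pos _) (by positivity)]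
  linarith

theorem bddWeight_mul_gauss {ε : ℝ} (hε : 0 < ε) {q : Plane → ℝ} (hq : Measurable q) (A : ℝ) (n : ℕ)
    (h : ∀ x, |q x| ≤ A * (1 + ‖x‖ ^ (2 * n))) : BddWeight fun x => q x * gauss ε x := by
  refine ⟨hq.mul (continuous_gauss ε).measurable, |A| * (1 + n.factorial / ε ^ n), fun x => ?_⟩
  rw [abs_mul, abs_of_pos (gauss_pos ε x)]
  have h1 := gauss_le_one hε.le x
  have h2 := pow_mul_gauss_le hε n x
  calc |q x| * gauss ε x ≤ |A| * (1 + ‖x‖ ^ (2 * n)) * gauss ε x := by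
        refine mul_le_mul_of_nonneg_right ((h x).trans ?_) (gauss_pos ε x).le
        exact mul_le_mul_of_nonneg_right (le_abs_self A) (by positivity)
    _ = |A| * (gauss ε x + ‖x‖ ^ (2 * n) * gauss ε x) := by ring
    _ ≤ _ := mul_le_mul_of_nonneg_left (add_le_add h1 h2) (abs_nonneg A)

/-- The truncation `(1 - e^{-ε|x|²}) / ε` of `|x|²`. -/
def rho (ε : ℝ) (x : Plane) : ℝ := (1 - gauss ε x) / ε

/-- The gradient of `rho`. -/
def fld (ε : ℝ) (k : Fin 2) (x : Plane) : ℝ := 2 * x k * gauss ε x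

/-- The Hessian of `rho`. -/
def jac (ε : ℝ) (j k : Fin 2) (x : Plane) : ℝ :=
  ((if j = k then 2 else 0) - 4 * ε * x j * x k) * gauss ε x

/-- The Laplacian of `rho`. -/
def dvg (ε : ℝ) (x : Plane) : ℝ := (4 - 4 * ε * ‖x‖ ^ 2) * gauss ε x

/-- The gradient of the Laplacian of `rho`. -/
def grd (ε : ℝ) (j : Fin 2) (x : Plane) : ℝ :=
  (-16 * ε * x j + 8 * ε ^ 2 * x j * ‖x‖ ^ 2) * gauss ε x

@[fun_prop]
theorem measurable_coord (k : Fin 2) : Measurable fun x : Plane => x k := by fun_prop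

theorem bddWeight_rho {ε : ℝ} (hε : 0 < ε) : BddWeight (rho ε) := by
  refine ⟨((continuous_const.sub (continuous_gauss ε)).div_const _).measurable, 1 / ε, fun x => ?_⟩
  have h1 := gauss_le_one hε.le x
  have h2 := gauss_pos ε x
  rw [rho, abs_of_nonneg (div_nonneg (by linarith) hε.le)]
  gcongr
  linarith

theorem bddWeight_fld {ε : ℝ} (hε : 0 < ε) (k : Fin 2) : BddWeight (fld ε k) := by
  refine bddWeight_mul_gauss hε (by fun_prop) 1 1 fun x => ?_
  rw [abs_mul, abs_two, mul_one]
  nlinarith [abs_coord_le x k, sq_nonneg (‖x‖ - 1)]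

theorem bddWeight_jac {ε : ℝ} (hε : 0 < ε) (j k : Fin 2) : BddWeight (jac ε j k) := by
  refine bddWeight_mul_gauss hε (by fun_prop) (2 + 4 * ε) 1 fun x => ?_
  have h : |x j * x k| ≤ ‖x‖ ^ 2 := by
    rw [abs_mul, sq]
    exact mul_le_mul (abs_coord_le x j) (abs_coord_le x k) (abs_nonneg _) (norm_nonneg _)
  have h1 : |(if j = k then (2 : ℝ) else 0)| ≤ 2 := by split_ifs <;> simp
  calc |(if j = k then (2 : ℝ) else 0) - 4 * ε * x j * x k|
      ≤ |(if j = k then (2 : ℝ) else 0)| + |4 * ε * x j * x k| := abs_sub _ _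
    _ = |(if j = k then (2 : ℝ) else 0)| + 4 * ε * |x j * x k| := by
        rw [mul_assoc, abs_mul, abs_of_pos (by positivity : (0 : ℝ) < 4 * ε)]
    _ ≤ 2 + 4 * ε * ‖x‖ ^ 2 := by gcongr
    _ ≤ _ := by rw [mul_one]; nlinarith [sq_nonneg ‖x‖]

theorem bddWeight_dvg {ε : ℝ} (hε : 0 < ε) : BddWeight (dvg ε) := by
  refine bddWeight_mul_gauss hε (by fun_prop) (4 + 4 * ε) 1 fun x => ?_
  rw [abs_le, mul_one]
  constructor <;> nlinarith [sq_nonneg ‖x‖, mul_nonneg hε.le (sq_nonneg ‖x‖)]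

theorem bddWeight_grd {ε : ℝ} (hε : 0 < ε) (j : Fin 2) : BddWeight (grd ε j) := by
  refine bddWeight_mul_gauss hε (by fun_prop) (16 * ε + 16 * ε ^ 2) 2 fun x => ?_
  have h := abs_coord_le x j
  have hn := norm_nonneg x
  have h1 : ‖x‖ ≤ 1 + ‖x‖ ^ 4 := by nlinarith [sq_nonneg (‖x‖ - 1), sq_nonneg (‖x‖ ^ 2 - 1)]
  have h2 : ‖x‖ * ‖x‖ ^ 2 ≤ 1 + ‖x‖ ^ 4 := by
    nlinarith [sq_nonneg (‖x‖ ^ 2 - ‖x‖), sq_nonneg (‖x‖ ^ 2 - 1), sq_nonneg (‖x‖ - 1)]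
  calc |-16 * ε * x j + 8 * ε ^ 2 * x j * ‖x‖ ^ 2|
      = |x j| * |-16 * ε + 8 * ε ^ 2 * ‖x‖ ^ 2| := by rw [← abs_mul]; congr 1; ring
    _ ≤ ‖x‖ * (16 * ε + 8 * ε ^ 2 * ‖x‖ ^ 2) := by
        refine mul_le_mul h ?_ (abs_nonneg _) hn
        rw [abs_le]
        constructor <;> nlinarith [mul_nonneg (sq_nonneg ε) (sq_nonneg ‖x‖)]
    _ = 16 * ε * ‖x‖ + 8 * ε ^ 2 * (‖x‖ * ‖x‖ ^ 2) := by ring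
    _ ≤ 16 * ε * (1 + ‖x‖ ^ 4) + 8 * ε ^ 2 * (1 + ‖x‖ ^ 4) := by gcongr
    _ ≤ (16 * ε + 16 * ε ^ 2) * (1 + ‖x‖ ^ (2 * 2)) := by
        norm_num
        nlinarith [mul_nonneg (sq_nonneg ε) (by positivity : 0 ≤ 1 + ‖x‖ ^ 4)]

theorem hasPartial_rho {ε : ℝ} (hε : 0 < ε) (k : Fin 2) : HasPartial k (rho ε) (fld ε k) := by
  intro x
  have h := ((hasPartial_gauss ε k x).const_sub 1).div_const ε
  refine h.congr_deriv ?_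
  rw [fld]
  field_simp

theorem hasPartial_fld (ε : ℝ) (j k : Fin 2) : HasPartial j (fld ε k) (jac ε j k) := by
  intro x
  have h := ((hasPartial_coord j k x).const_mul 2).mul (hasPartial_gauss ε j x)
  refine h.congr_deriv ?_
  simp only [jac, zero_smul, add_zero]
  split_ifs <;> ring

theorem hasPartial_dvg (ε : ℝ) (j : Fin 2) : HasPartial j (dvg ε) (grd ε j) := by
  intro x
  have h := (((hasPartial_norm_sq j x).const_mul (4 * ε)).const_sub 4).mul (hasPartial_gauss ε j x)
  refine h.congr_deriv ?_
  simp only [grd, zero_smul, add_zero]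
  ring

theorem admissibleField_gauss {ε : ℝ} (hε : 0 < ε) :
    AdmissibleField (fld ε) (jac ε) (dvg ε) (grd ε) where
  bdd := bddWeight_fld hε
  bdd_jac := bddWeight_jac hε
  bdd_div := bddWeight_dvg hε
  bdd_grad := bddWeight_grd hε
  partial_field := hasPartial_fld ε
  div_eq x := by
    simp only [dvg, jac, Fin.sum_univ_two, norm_sq_plane, if_true]
    ring
  partial_div := hasPartial_dvg ε

/-- The factor x_j gives a derivative at the origin for every b ≥ 0, even where |x|^b itself has
none: along the axis the function is s|s|^b, whose difference quotient is |s|^b. -/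
theorem hasPartial_coord_mul_rpow {b : ℝ} (hb : 0 ≤ b) (j : Fin 2) :
    HasPartial j (fun x => x j * ‖x‖ ^ b) (fun x => ‖x‖ ^ b + b * x j ^ 2 * ‖x‖ ^ (b - 2)) := by
  intro x
  rcases eq_or_ne x 0 with rfl | hx
  · have hn : ∀ s : ℝ, ‖s • basisVec j‖ = |s| := fun s => by
      rw [norm_smul, basisVec, (EuclideanSpace.basisFun (Fin 2) ℝ).norm_eq_one, mul_one,
        Real.norm_eq_abs]
    have hf : (fun s : ℝ => ((0 : Plane) + s • basisVec j) j * ‖(0 : Plane) + s • basisVec j‖ ^ b) =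
        fun s => s * |s| ^ b := by
      ext s
      rw [coord_add_smul_basisVec, zero_add, hn]
      simp
    rw [hf]
    rcases hb.eq_or_lt with rfl | hb
    · simpa using hasDerivAt_id' (0 : ℝ)
    · rw [hasDerivAt_iff_tendsto_slope_zero]
      have hc : Tendsto (fun s : ℝ => |s| ^ b) (𝓝[≠] 0) (𝓝 (|0| ^ b)) :=
        ((continuous_abs.rpow_const fun _ => Or.inr hb.le).tendsto 0).mono_left nhdsWithin_le_nhds
      simp only [abs_zero, Real.zero_rpow hb.ne'] at hc
      simp only [norm_zero, Real.zero_rpow hb.ne']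
      -- Whatever value 0^(b-2) takes, its factor x_j² is zero at the origin.
      have hz : (0 : ℝ) + b * (0 : Plane) j ^ 2 * 0 ^ (b - 2) = 0 := by simp
      rw [hz]
      refine hc.congr' ?_
      filter_upwards [self_mem_nhdsWithin] with s hs
      have hs : s ≠ 0 := hs
      simp [hs]
  · have hx' : 0 < ‖x‖ := norm_pos_iff.mpr hx
    have hr : ∀ (y : Plane) (c : ℝ), (‖y‖ ^ 2) ^ (c / 2) = ‖y‖ ^ c := fun y c => by
      rw [← Real.rpow_natCast, ← Real.rpow_mul (norm_nonneg y)]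
      congr 1; push_cast; ring
    have h1 := (hasPartial_norm_sq j x).rpow_const (p := b / 2)
      (Or.inl (by simpa using hx))
    have h := (hasPartial_coord j j x).mul h1
    refine (h.congr_deriv ?_).congr_of_eventuallyEq (Eventually.of_forall fun s => ?_)
    · have e := hr x (b - 2)
      rw [show (b - 2) / 2 = b / 2 - 1 by ring] at e
      simp only [zero_smul, add_zero, if_true, e, hr x b]
      ring
    · simp only [Pi.mul_apply, hr]

/-- The product of `rho`'s gradient and a power weight. -/
def fldPow (ε b : ℝ) (j : Fin 2) (x : Plane) : ℝ := 2 * (x j * ‖x‖ ^ b) * gauss ε x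

/-- The diagonal derivatives of `fldPow`. -/
def jacPow (ε b : ℝ) (j : Fin 2) (x : Plane) : ℝ :=
  2 * (‖x‖ ^ b + b * x j ^ 2 * ‖x‖ ^ (b - 2) - 2 * ε * x j ^ 2 * ‖x‖ ^ b) * gauss ε x

theorem hasPartial_fldPow {b : ℝ} (hb : 0 ≤ b) (ε : ℝ) (j : Fin 2) :
    HasPartial j (fldPow ε b j) (jacPow ε b j) := by
  intro x
  have h := ((hasPartial_coord_mul_rpow hb j x).const_mul 2).mul (hasPartial_gauss ε j x)
  refine h.congr_deriv ?_
  simp only [jacPow, zero_smul, add_zero]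
  ring

theorem rpow_le_one_add_pow {b : ℝ} (hb : 0 ≤ b) {n : ℕ} (hn : b ≤ n) {r : ℝ} (hr : 0 ≤ r) :
    r ^ b ≤ 1 + r ^ n := by
  rcases le_total r 1 with h | h
  · have := Real.rpow_le_one hr h hb
    have := pow_nonneg hr n
    linarith
  · have := Real.rpow_le_rpow_of_exponent_le h hn
    rw [Real.rpow_natCast] at this
    linarith

theorem sq_coord_le (x : Plane) (j : Fin 2) : x j ^ 2 ≤ ‖x‖ ^ 2 := by
  rw [← sq_abs (x j)]
  exact pow_le_pow_left₀ (abs_nonneg _) (abs_coord_le x j) 2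

theorem sq_mul_rpow_le {b : ℝ} (hb : 0 ≤ b) (x : Plane) (j : Fin 2) :
    b * x j ^ 2 * ‖x‖ ^ (b - 2) ≤ b * ‖x‖ ^ b := by
  rcases eq_or_ne x 0 with rfl | hx
  · simpa using mul_nonneg hb (Real.rpow_nonneg le_rfl b)
  · have hx' : 0 < ‖x‖ := norm_pos_iff.mpr hx
    have : ‖x‖ ^ b = ‖x‖ ^ 2 * ‖x‖ ^ (b - 2) := by
      rw [← Real.rpow_natCast, ← Real.rpow_add hx']
      congr 1; push_cast; ring
    rw [this, mul_assoc]
    exact mul_le_mul_of_nonneg_left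
      (mul_le_mul_of_nonneg_right (sq_coord_le x j) (by positivity)) hb

theorem bddWeight_pow_gauss {ε b : ℝ} (hε : 0 < ε) (hb : 0 ≤ b) {q : Plane → ℝ} (hq : Measurable q)
    (A : ℝ) (hA : 0 ≤ A) (h : ∀ x, |q x| ≤ A * ((1 + ‖x‖ ^ 2) * ‖x‖ ^ b)) :
    BddWeight fun x => q x * gauss ε x := by
  obtain ⟨n, hn⟩ := exists_nat_ge (b + 2)
  refine bddWeight_mul_gauss hε hq (2 * A) n fun x => (h x).trans ?_
  have hr := norm_nonneg x
  have hmul : ‖x‖ ^ 2 * ‖x‖ ^ b = ‖x‖ ^ (b + 2) := by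
    rw [Real.rpow_add_of_nonneg hr hb (by norm_num), mul_comm]; norm_num
  have hn' : b + 2 ≤ ((2 * n : ℕ) : ℝ) := by push_cast; linarith
  have h1 := rpow_le_one_add_pow hb (n := 2 * n) (by linarith) hr
  have h2 := rpow_le_one_add_pow (b := b + 2) (by linarith) (n := 2 * n) hn' hr
  rw [add_mul, one_mul, hmul]
  nlinarith

theorem bddWeight_fldPow {ε b : ℝ} (hε : 0 < ε) (hb : 0 ≤ b) (j : Fin 2) :
    BddWeight (fldPow ε b j) := by
  refine bddWeight_pow_gauss hε hb (by fun_prop) 2 (by norm_num) fun x => ?_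
  rw [abs_mul, abs_mul, abs_two, abs_of_nonneg (Real.rpow_nonneg (norm_nonneg x) b)]
  have : |x j| ≤ 1 + ‖x‖ ^ 2 := by nlinarith [abs_coord_le x j, sq_nonneg (‖x‖ - 1)]
  gcongr

theorem bddWeight_jacPow {ε b : ℝ} (hε : 0 < ε) (hb : 0 ≤ b) (j : Fin 2) :
    BddWeight (jacPow ε b j) := by
  refine bddWeight_pow_gauss hε hb (by fun_prop) (2 + 2 * b + 4 * ε) (by positivity) fun x => ?_
  have h0 := Real.rpow_nonneg (norm_nonneg x) b
  have h1 := sq_mul_rpow_le hb x j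
  have h1' : 0 ≤ b * x j ^ 2 * ‖x‖ ^ (b - 2) := by positivity
  have h2 : 2 * ε * x j ^ 2 * ‖x‖ ^ b ≤ 2 * ε * ‖x‖ ^ 2 * ‖x‖ ^ b := by
    exact mul_le_mul_of_nonneg_right
      (mul_le_mul_of_nonneg_left (sq_coord_le x j) (by positivity)) h0
  have h2' : 0 ≤ 2 * ε * x j ^ 2 * ‖x‖ ^ b := by positivity
  have h3 : 0 ≤ ‖x‖ ^ 2 * ‖x‖ ^ b := by positivity
  have h4 : 0 ≤ b * ‖x‖ ^ b := by positivity
  have h5 : 0 ≤ b * (‖x‖ ^ 2 * ‖x‖ ^ b) := by positivity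
  have h6 : 0 ≤ ε * ‖x‖ ^ b := by positivity
  have h7 : 0 ≤ ε * (‖x‖ ^ 2 * ‖x‖ ^ b) := by positivity
  rw [abs_le]
  constructor <;> nlinarith

/-- Euler's identity x · ∇|x|^b = b|x|^b absorbs the power b - 2. -/
theorem sum_jacPow {b : ℝ} (hb : 0 ≤ b) (ε : ℝ) (x : Plane) :
    jacPow ε b 0 x + jacPow ε b 1 x = 2 * (2 + b - 2 * ε * ‖x‖ ^ 2) * ‖x‖ ^ b * gauss ε x := by
  rcases eq_or_ne x 0 with rfl | hx
  · rcases hb.eq_or_lt with rfl | hb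
    · simp [jacPow]; ring
    · simp [jacPow, Real.zero_rpow hb.ne']
  · have hx' : 0 < ‖x‖ := norm_pos_iff.mpr hx
    have : ‖x‖ ^ b = ‖x‖ ^ 2 * ‖x‖ ^ (b - 2) := by
      rw [← Real.rpow_natCast, ← Real.rpow_add hx']
      congr 1; push_cast; ring
    simp only [jacPow, this, norm_sq_plane]
    ring

/-! ### Power nonlinearities of `H²` functions -/

/-- The function `|f|^{2p} f` for `f = resolvent w`. -/
def powOp (p : ℕ) (w : L2) : L2 := mulOp (fun x => ((‖resolvent w x‖ ^ (2 * p) : ℝ) : ℂ)) (resolvent w)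

theorem coeFn_powOp (p : ℕ) (w : L2) :
    ∀ᵐ x, powOp p w x = ((‖resolvent w x‖ ^ (2 * p) : ℝ) : ℂ) * resolvent w x := by
  obtain ⟨C, hC, hCw⟩ := exists_norm_resolvent_le
  refine coeFn_mulOp (memLp_top_of_bound ?_ ((C * ‖w‖) ^ (2 * p)) ?_) _
  · exact (Complex.continuous_ofReal.comp_aestronglyMeasurable
      ((Lp.aestronglyMeasurable (resolvent w)).norm.pow _))
  · filter_upwards [hCw w] with x hx
    rw [Complex.norm_real, Real.norm_of_nonneg (by positivity)]
    gcongr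

theorem norm_pow_mul_sub_le (p : ℕ) {a b : ℂ} {M : ℝ} (ha : ‖a‖ ≤ M) (hb : ‖b‖ ≤ M) :
    ‖((‖a‖ ^ (2 * p) : ℝ) : ℂ) * a - ((‖b‖ ^ (2 * p) : ℝ) : ℂ) * b‖ ≤
      (2 * p + 1) * M ^ (2 * p) * ‖a - b‖ := by
  have hM : 0 ≤ M := (norm_nonneg a).trans ha
  have e : ((‖a‖ ^ (2 * p) : ℝ) : ℂ) * a - ((‖b‖ ^ (2 * p) : ℝ) : ℂ) * b =
      ((‖a‖ ^ (2 * p) : ℝ) : ℂ) * (a - b) + ((‖a‖ ^ (2 * p) - ‖b‖ ^ (2 * p) : ℝ) : ℂ) * b := by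
    push_cast; ring
  have h1 : |‖a‖ ^ (2 * p) - ‖b‖ ^ (2 * p)| ≤ ‖a - b‖ * (2 * p) * M ^ (2 * p - 1) := by
    refine (abs_pow_sub_pow_le ‖a‖ ‖b‖ (2 * p)).trans ?_
    rw [abs_norm, abs_norm]
    push_cast
    gcongr
    · exact abs_norm_sub_norm_le a b
    · exact max_le ha hb
  rw [e]
  refine (norm_add_le _ _).trans ?_
  rw [norm_mul, norm_mul, Complex.norm_real, Complex.norm_real,
    Real.norm_of_nonneg (by positivity : 0 ≤ ‖a‖ ^ (2 * p)), Real.norm_eq_abs]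
  have h2 : ‖a‖ ^ (2 * p) * ‖a - b‖ ≤ M ^ (2 * p) * ‖a - b‖ := by gcongr
  have h3 : |‖a‖ ^ (2 * p) - ‖b‖ ^ (2 * p)| * ‖b‖ ≤ ‖a - b‖ * (2 * p) * M ^ (2 * p) := by
    rcases Nat.eq_zero_or_pos p with rfl | hp
    · simp
    · calc _ ≤ (‖a - b‖ * (2 * p) * M ^ (2 * p - 1)) * M :=
            mul_le_mul h1 hb (norm_nonneg _) (by positivity)
        _ = ‖a - b‖ * (2 * p) * (M ^ (2 * p - 1) * M) := by ring
        _ = _ := by rw [← pow_succ, Nat.sub_add_cancel (by omega)]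
  linarith

-- The power map is Lipschitz on bounded sets of w, since the Sobolev embedding bounds all but one
-- factor pointwise. This continuity lets nonlinear identities be extended by density.
@[fun_prop]
theorem continuous_powOp (p : ℕ) : Continuous (powOp p) := by
  obtain ⟨C, hC, hCw⟩ := exists_norm_resolvent_le
  rw [continuous_iff_continuousAt]
  intro w
  rw [ContinuousAt, tendsto_iff_norm_sub_tendsto_zero]
  have hlim : Tendsto (fun v => (2 * p + 1) * (C * (‖w‖ + 1)) ^ (2 * p) *
      ‖resolvent v - resolvent w‖) (𝓝 w) (𝓝 0) := by
    have : Continuous fun v : L2 => (2 * p + 1) * (C * (‖w‖ + 1)) ^ (2 * p) *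
      ‖resolvent v - resolvent w‖ := by fun_prop
    simpa using this.tendsto w
  refine squeeze_zero' (Eventually.of_forall fun _ => norm_nonneg _) ?_ hlim
  have hev : ∀ᶠ v : L2 in 𝓝 w, ‖v‖ < ‖w‖ + 1 :=
    continuous_norm.continuousAt.eventually_lt continuousAt_const (by simp)
  filter_upwards [hev] with v hv
  refine Lp.norm_le_mul_norm_of_ae_le_mul ?_
  filter_upwards [coeFn_powOp p v, coeFn_powOp p w, hCw v, hCw w,
    Lp.coeFn_sub (powOp p v) (powOp p w), Lp.coeFn_sub (resolvent v) (resolvent w)]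
    with x h1 h2 h3 h4 h5 h6
  rw [h5, h6, Pi.sub_apply, Pi.sub_apply, h1, h2]
  refine norm_pow_mul_sub_le p (h3.trans ?_) (h4.trans ?_) <;> gcongr
  linarith

theorem powOp_of_schwartz {w : L2} {g : 𝓢(Plane, ℂ)} (h : resolvent w = g.toLp 2) (p : ℕ) :
    ∀ᵐ x, powOp p w x = (g x * conj (g x)) ^ p * g x := by
  filter_upwards [coeFn_powOp p w, g.coeFn_toLp 2] with x h1 h2
  rw [h1, h, h2, Complex.mul_conj, Complex.normSq_eq_norm_sq]
  push_cast
  ring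

/-- The total derivative of m |g|^(2p+2) integrates to zero, and ∂|g|^(2p+2) = 2(p+1) |g|^(2p) Re(ḡ
∂g). Writing |g|² as g ḡ keeps everything polynomial, hence differentiable at the zeros of g. -/
theorem integral_partial_pow_schwartz {m m' : Plane → ℝ} {j : Fin 2} (hm : BddWeight m)
    (hm' : BddWeight m') (h : HasPartial j m m') (p : ℕ) (g : 𝓢(Plane, ℂ)) :
    2 * (p + 1) * (∫ x, conj ((g x * conj (g x)) ^ p * g x) *
      (m x * (∂_{basisVec j} g : 𝓢(Plane, ℂ)) x)).re =
    -(∫ x, conj ((g x * conj (g x)) ^ p * g x) * (m' x * g x)).re := by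
  have hcont : Continuous fun x => (g x * conj (g x)) ^ p :=
    (g.continuous.mul (Complex.continuous_conj.comp g.continuous)).pow p
  obtain ⟨K, hK⟩ : ∃ K, ∀ x, ‖(g x * conj (g x)) ^ p‖ ≤ K := by
    refine ⟨(SchwartzMap.seminorm ℝ 0 0 g * SchwartzMap.seminorm ℝ 0 0 g) ^ p, fun x => ?_⟩
    have := SchwartzMap.norm_le_seminorm ℝ g x
    rw [norm_pow, norm_mul, RCLike.norm_conj]
    gcongr
  have hint : ∀ (m : Plane → ℝ) (_ : BddWeight m) (f k : 𝓢(Plane, ℂ)),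
      Integrable fun x => conj (f x) * ((m x * (g x * conj (g x)) ^ p) * k x) := by
    intro m hm f k
    obtain ⟨C, hC⟩ := hm.bdd
    refine integrable_mul_schwartz (m := fun x => m x * (g x * conj (g x)) ^ p)
      ((Complex.measurable_ofReal.comp hm.meas).mul hcont.measurable) (C := C * K) (fun x => ?_) f k
    rw [norm_mul, Complex.norm_real, Real.norm_eq_abs]
    exact mul_le_mul (hC x) (hK x) (norm_nonneg _) ((abs_nonneg _).trans (hC x))
  set d : 𝓢(Plane, ℂ) := ∂_{basisVec j} g
  have i1 := hint m' hm' g g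
  have i2 := hint m hm g d
  have i3 := hint m hm d g
  have i23 : Integrable fun x => ((p + 1 : ℕ) : ℂ) *
      (conj (g x) * ((m x * (g x * conj (g x)) ^ p) * d x) +
        conj (d x) * ((m x * (g x * conj (g x)) ^ p) * g x)) := (i2.add i3).const_mul _
  have key := integral_partial_eq_zero j
    (F := fun x => conj (g x) * ((m x * (g x * conj (g x)) ^ p) * g x))
    (F' := fun x => conj (g x) * ((m' x * (g x * conj (g x)) ^ p) * g x) + ((p + 1 : ℕ) : ℂ) *
      (conj (g x) * ((m x * (g x * conj (g x)) ^ p) * d x) +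
        conj (d x) * ((m x * (g x * conj (g x)) ^ p) * g x)))
    (fun x => ?_) (hint m hm g g) (i1.add i23)
  · rw [integral_add i1 i23, integral_const_mul, integral_add i2 i3] at key
    have e3 : ∫ x, conj (d x) * ((m x * (g x * conj (g x)) ^ p) * g x) =
        conj (∫ x, conj (g x) * ((m x * (g x * conj (g x)) ^ p) * d x)) := by
      rw [← integral_conj]
      congr with x
      simp only [map_mul, map_pow, Complex.conj_conj, Complex.conj_ofReal]
      ring
    rw [e3, Complex.add_conj] at key
    have e1 : ∀ (m : Plane → ℝ) (k : 𝓢(Plane, ℂ)), ∫ x, conj ((g x * conj (g x)) ^ p * g x) *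
        (m x * k x) = ∫ x, conj (g x) * ((m x * (g x * conj (g x)) ^ p) * k x) := by
      intro m k
      congr with x
      simp only [map_mul, map_pow, Complex.conj_conj]
      ring
    rw [e1 m d, e1 m' g]
    have := congrArg Complex.re key
    rw [Complex.add_re, ← Complex.ofReal_natCast, ← Complex.ofReal_mul, Complex.ofReal_re] at this
    push_cast at this
    simp only [Complex.zero_re] at this
    linarith
  · have d3 : HasDerivAt (fun s : ℝ => g (x + s • basisVec j)) (d x) 0 :=
      hasDerivAt_schwartz g x (basisVec j)
    have d1 := d3.star
    have d2 := (h x).ofReal_comp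
    have hd := d2.mul ((d3.mul d1).pow (p + 1))
    have := hd.congr_of_eventuallyEq (f₁ := fun s : ℝ =>
      conj (g (x + s • basisVec j)) * ((m (x + s • basisVec j) *
        (g (x + s • basisVec j) * conj (g (x + s • basisVec j))) ^ p) * g (x + s • basisVec j)))
      (Eventually.of_forall fun s => by
        simp only [Pi.mul_apply, Pi.pow_apply, Complex.star_def]; ring)
    refine this.congr_deriv ?_
    simp only [zero_smul, add_zero, Complex.star_def, Pi.mul_apply, Pi.pow_apply, Nat.add_sub_cancel]
    ring

theorem inner_powOp_derivOp {m m' : Plane → ℝ} {j : Fin 2} (hm : BddWeight m)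
    (hm' : BddWeight m') (h : HasPartial j m m') (p : ℕ) (w : L2) :
    2 * (p + 1) * (inner ℂ (powOp p w) (mulR m (derivOp j w))).re =
      -(inner ℂ (powOp p w) (mulR m' (resolvent w))).re := by
  refine l2_induction (p := fun w => 2 * (p + 1) * (inner ℂ (powOp p w) (mulR m (derivOp j w))).re =
      -(inner ℂ (powOp p w) (mulR m' (resolvent w))).re)
      (isClosed_eq (by fun_prop) (by fun_prop)) (fun ψ => ?_) w
  obtain ⟨g, h0, h1, -⟩ := exists_schwartz_resolvent ψ
  have e : ∀ (m : Plane → ℝ) (_ : BddWeight m) (k : 𝓢(Plane, ℂ)),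
      inner ℂ (powOp p (ψ.toLp 2)) (mulR m (k.toLp 2)) =
        ∫ x, conj ((g x * conj (g x)) ^ p * g x) * (m x * k x) := by
    intro m hm k
    rw [inner_eq_integral]
    refine integral_congr_ae ?_
    filter_upwards [powOp_of_schwartz h0 p, hm.coeFn_mulR (k.toLp 2), k.coeFn_toLp 2]
      with x e1 e2 e3
    rw [e1, e2, e3]
  rw [h0, h1, e m hm, e m' hm']
  exact integral_partial_pow_schwartz hm hm' h p g

end

section

/-! ### Differentiation of quadratic and convex functionals along a curve -/

/-- `Lu` stands for a symmetric operator applied to u and need not be differentiable. Symmetry turns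
the difference quotient of the form into the pairing of the slope of u with Lu(s) + Lu(t), so
continuity of `Lu` suffices. -/
theorem hasDerivAt_re_inner_of_symm {u Lu : ℝ → L2} {u' : L2} {t : ℝ} (hu : HasDerivAt u u' t)
    (hL : ContinuousAt Lu t)
    (hs : ∀ s t, (inner ℂ (Lu s) (u t)).re = (inner ℂ (u s) (Lu t)).re) :
    HasDerivAt (fun t => (inner ℂ (u t) (Lu t)).re) (2 * (inner ℂ u' (Lu t)).re) t := by
  rw [hasDerivAt_iff_tendsto_slope] at hu ⊢
  have hlim : Tendsto (fun s => (inner ℂ (slope u t s) (Lu s + Lu t)).re) (𝓝[≠] t)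
      (𝓝 (inner ℂ u' (Lu t + Lu t)).re) :=
    (Complex.continuous_re.tendsto _).comp
      (hu.inner ((hL.tendsto.mono_left nhdsWithin_le_nhds).add_const _))
  have e : 2 * (inner ℂ u' (Lu t)).re = (inner ℂ u' (Lu t + Lu t)).re := by
    rw [inner_add_right, Complex.add_re]; ring
  rw [e]
  refine hlim.congr fun s => ?_
  have h1 := hs s t
  have h2 : (inner ℂ (u t) (Lu s)).re = (inner ℂ (Lu s) (u t)).re := by
    rw [← inner_conj_symm, Complex.conj_re]
  rw [slope_def_module, slope_def_field, RCLike.real_smul_eq_coe_smul (K := ℂ), inner_smul_left,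
    RCLike.conj_ofReal]
  erw [Complex.re_ofReal_mul]
  rw [inner_add_right, inner_sub_left, inner_sub_left]
  simp only [Complex.add_re, Complex.sub_re, Algebra.algebraMap_self, RingHom.id_apply]
  rw [h2, h1]
  ring

/-- The subgradient inequalities at s and at t confine G(s) - G(t) between two linear expressions,
which differ by at most ‖n(s) - n(t)‖ ‖u(s) - u(t)‖ = o(|s - t|). -/
theorem hasDerivAt_of_subgradient {u n : ℝ → L2} {u' : L2} {t : ℝ} {G : ℝ → ℝ}
    (hu : HasDerivAt u u' t) (hn : ContinuousAt n t)
    (hG : ∀ s t, (inner ℂ (n t) (u s - u t)).re ≤ G s - G t) :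
    HasDerivAt G (inner ℂ (n t) u').re t := by
  have h1 : HasDerivAt (fun s => (inner ℂ (n t) (u s)).re) (inner ℂ (n t) u').re t :=
    ((Complex.reCLM.comp ((innerSL ℂ (n t)).restrictScalars ℝ)).hasFDerivAt.comp_hasDerivAt t hu)
  have h2 : HasDerivAt (fun s => G s - (inner ℂ (n t) (u s)).re) 0 t := by
    rw [hasDerivAt_iff_tendsto_slope] at hu ⊢
    have hlim : Tendsto (fun s => ‖n s - n t‖ * ‖slope u t s‖) (𝓝[≠] t) (𝓝 0) := by
      have := ((hn.tendsto.mono_left nhdsWithin_le_nhds).sub_const (n t)).norm.mul hu.norm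
      simpa using this
    refine squeeze_zero_norm (fun s => ?_) hlim
    have lo := hG s t
    have up := hG t s
    have e1 : (inner ℂ (n s) (u t - u s)).re = -(inner ℂ (n s) (u s - u t)).re := by
      rw [← neg_sub (u s) (u t), inner_neg_right, Complex.neg_re]
    have e2 : (inner ℂ (n s) (u s - u t)).re = (inner ℂ (n t) (u s - u t)).re +
        (inner ℂ (n s - n t) (u s - u t)).re := by
      rw [inner_sub_left, Complex.sub_re]; ring
    have e3 := (Complex.abs_re_le_norm _).trans (norm_inner_le_norm (𝕜 := ℂ) (n s - n t) (u s - u t))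
    have e4 : (inner ℂ (n t) (u s - u t)).re = (inner ℂ (n t) (u s)).re -
        (inner ℂ (n t) (u t)).re := by rw [inner_sub_right, Complex.sub_re]
    have e5 := le_abs_self (inner ℂ (n s - n t) (u s - u t)).re
    rw [slope_def_module, slope_def_module, norm_smul, norm_smul, Real.norm_eq_abs, Real.norm_eq_abs,
      mul_left_comm]
    refine mul_le_mul_of_nonneg_left ?_ (abs_nonneg _)
    rw [abs_le]
    constructor <;> linarith
  have := h2.add h1
  refine (this.congr_deriv (zero_add _)).congr_of_eventuallyEq (Eventually.of_forall fun s => ?_)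
  simp

/-! ### The potential energy -/

/-- `n` is the force `(|x|^{b₁} |f|² + |x|^{b₂} |f|⁴) f`. -/
def IsForce (b₁ b₂ : ℝ) (f n : L2) : Prop :=
  ∀ᵐ x, n x = ((‖x‖ ^ b₁ * ‖f x‖ ^ 2 + ‖x‖ ^ b₂ * ‖f x‖ ^ 4 : ℝ) : ℂ) * f x

/-- The weighted power integral `∫ |x|^b |f|^k`. -/
def potential (b : ℝ) (k : ℕ) (f : L2) : ℝ := ∫ x, ‖x‖ ^ b * ‖f x‖ ^ k

/-- The potential energy. -/
def potentialEnergy (b₁ b₂ : ℝ) (f : L2) : ℝ :=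
  1 / 4 * potential b₁ 4 f + 1 / 6 * potential b₂ 6 f

theorem potential_nonneg (b : ℝ) (k : ℕ) (f : L2) : 0 ≤ potential b k f :=
  integral_nonneg fun x => by positivity

theorem potentialEnergy_nonneg (b₁ b₂ : ℝ) (f : L2) : 0 ≤ potentialEnergy b₁ b₂ f := by
  have := potential_nonneg b₁ 4 f
  have := potential_nonneg b₂ 6 f
  unfold potentialEnergy
  positivity

theorem aestronglyMeasurable_density (b : ℝ) (k : ℕ) (f : L2) :
    AEStronglyMeasurable (fun x : Plane => ‖x‖ ^ b * ‖f x‖ ^ k) volume :=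
  (by fun_prop : Measurable fun x : Plane => ‖x‖ ^ b).aestronglyMeasurable.mul
    ((Lp.aestronglyMeasurable f).norm.pow k)

variable {b₁ b₂ : ℝ}

theorem IsForce.norm_mul_norm {f n : L2} (h : IsForce b₁ b₂ f n) :
    ∀ᵐ x, ‖n x‖ * ‖f x‖ = ‖x‖ ^ b₁ * ‖f x‖ ^ 4 + ‖x‖ ^ b₂ * ‖f x‖ ^ 6 := by
  filter_upwards [h] with x hx
  rw [hx, norm_mul, Complex.norm_real, Real.norm_of_nonneg (by positivity)]
  ring

theorem integrable_norm_mul_norm (f g : L2) : Integrable fun x : Plane => ‖f x‖ * ‖g x‖ := by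
  refine (integrable_conj_mul f g).norm.congr (Eventually.of_forall fun x => ?_)
  simp

/-- Finite potential energy follows from the equation holding in L²: |n||f| is integrable as a
product of L² functions and is the sum of the two nonnegative densities. -/
theorem IsForce.integrable_four {f n : L2} (h : IsForce b₁ b₂ f n) :
    Integrable fun x : Plane => ‖x‖ ^ b₁ * ‖f x‖ ^ 4 := by
  refine (integrable_norm_mul_norm n f).mono (aestronglyMeasurable_density b₁ 4 f) ?_
  filter_upwards [h.norm_mul_norm] with x hx
  rw [hx, Real.norm_of_nonneg (by positivity), Real.norm_of_nonneg (by positivity)]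
  exact le_add_of_nonneg_right (by positivity)

theorem IsForce.integrable_six {f n : L2} (h : IsForce b₁ b₂ f n) :
    Integrable fun x : Plane => ‖x‖ ^ b₂ * ‖f x‖ ^ 6 := by
  refine (integrable_norm_mul_norm n f).mono (aestronglyMeasurable_density b₂ 6 f) ?_
  filter_upwards [h.norm_mul_norm] with x hx
  rw [hx, Real.norm_of_nonneg (by positivity), Real.norm_of_nonneg (by positivity)]
  exact le_add_of_nonneg_left (by positivity)

theorem re_conj_mul_sub_le (a b : ℂ) : (conj b * (a - b)).re ≤ ‖b‖ * ‖a‖ - ‖b‖ ^ 2 := by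
  rw [mul_sub, Complex.sub_re]
  have h1 : (conj b * a).re ≤ ‖b‖ * ‖a‖ := by
    refine (Complex.re_le_norm _).trans ?_
    rw [norm_mul, RCLike.norm_conj]
  have h2 : (conj b * b).re = ‖b‖ ^ 2 := by
    rw [mul_comm, Complex.mul_conj, Complex.ofReal_re, Complex.normSq_eq_norm_sq]
  linarith

/-- The force is a subgradient of the potential energy. -/
theorem IsForce.le_potentialEnergy_sub {f g n m : L2} (hf : IsForce b₁ b₂ f n)
    (hg : IsForce b₁ b₂ g m) : (inner ℂ m (f - g)).re ≤
      potentialEnergy b₁ b₂ f - potentialEnergy b₁ b₂ g := by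
  have e : potentialEnergy b₁ b₂ f - potentialEnergy b₁ b₂ g =
      ∫ x, ((1 / 4 * (‖x‖ ^ b₁ * ‖f x‖ ^ 4) + 1 / 6 * (‖x‖ ^ b₂ * ‖f x‖ ^ 6)) -
        (1 / 4 * (‖x‖ ^ b₁ * ‖g x‖ ^ 4) + 1 / 6 * (‖x‖ ^ b₂ * ‖g x‖ ^ 6))) := by
    have i1 := hf.integrable_four.const_mul (1 / 4)
    have i2 := hf.integrable_six.const_mul (1 / 6)
    have i3 := hg.integrable_four.const_mul (1 / 4)
    have i4 := hg.integrable_six.const_mul (1 / 6)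
    rw [integral_sub (by exact i1.add i2) (by exact i3.add i4), integral_add i1 i2,
      integral_add i3 i4]
    simp only [integral_const_mul]
    rfl
  have i1 := hf.integrable_four.const_mul (1 / 4)
  have i2 := hf.integrable_six.const_mul (1 / 6)
  have i3 := hg.integrable_four.const_mul (1 / 4)
  have i4 := hg.integrable_six.const_mul (1 / 6)
  have er : (inner ℂ m (f - g)).re = ∫ x, (conj (m x) * (f - g : L2) x).re := by
    rw [inner_eq_integral]
    exact (integral_re (integrable_conj_mul m (f - g))).symm
  rw [e, er]
  refine integral_mono_ae (integrable_conj_mul m (f - g)).re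
    (by exact (i1.add i2).sub (i3.add i4)) ?_
  filter_upwards [hg, Lp.coeFn_sub f g] with x hx hs
  rw [hs, Pi.sub_apply, hx, map_mul, Complex.conj_ofReal, mul_assoc, Complex.re_ofReal_mul]
  have hc := re_conj_mul_sub_le (f x) (g x)
  set A := ‖f x‖
  set B := ‖g x‖
  have hA : 0 ≤ A := norm_nonneg _
  have hB : 0 ≤ B := norm_nonneg _
  have hV : 0 ≤ ‖x‖ ^ b₁ := by positivity
  have hW : 0 ≤ ‖x‖ ^ b₂ := by positivity
  -- This and the next inequality say that the convex functions A⁴/4 and A⁶/6 lie above their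
  -- tangent lines at B.
  have k1 : B ^ 2 * (B * A - B ^ 2) ≤ 1 / 4 * A ^ 4 - 1 / 4 * B ^ 4 := by
    nlinarith [sq_nonneg (A ^ 2 - B ^ 2), sq_nonneg (B * (A - B)), sq_nonneg (A - B)]
  have k2 : B ^ 4 * (B * A - B ^ 2) ≤ 1 / 6 * A ^ 6 - 1 / 6 * B ^ 6 := by
    have : 1 / 6 * A ^ 6 - 1 / 6 * B ^ 6 - B ^ 4 * (B * A - B ^ 2) = 1 / 6 * (A - B) ^ 2 *
      (A ^ 4 + 2 * A ^ 3 * B + 3 * A ^ 2 * B ^ 2 + 4 * A * B ^ 3 + 5 * B ^ 4) := by ring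
    have h0 : 0 ≤ 1 / 6 * (A - B) ^ 2 *
      (A ^ 4 + 2 * A ^ 3 * B + 3 * A ^ 2 * B ^ 2 + 4 * A * B ^ 3 + 5 * B ^ 4) := by positivity
    linarith
  calc (‖x‖ ^ b₁ * B ^ 2 + ‖x‖ ^ b₂ * B ^ 4) * (conj (g x) * (f x - g x)).re
      ≤ (‖x‖ ^ b₁ * B ^ 2 + ‖x‖ ^ b₂ * B ^ 4) * (B * A - B ^ 2) := by gcongr
    _ = ‖x‖ ^ b₁ * (B ^ 2 * (B * A - B ^ 2)) + ‖x‖ ^ b₂ * (B ^ 4 * (B * A - B ^ 2)) := by ring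
    _ ≤ ‖x‖ ^ b₁ * (1 / 4 * A ^ 4 - 1 / 4 * B ^ 4) + ‖x‖ ^ b₂ * (1 / 6 * A ^ 6 - 1 / 6 * B ^ 6) := by
        gcongr
    _ = _ := by ring

/-! ### The virial identity for the nonlinearity -/

theorem IsForce.im_inner_mulR {f n : L2} (h : IsForce b₁ b₂ f n) {m : Plane → ℝ}
    (hm : BddWeight m) : (inner ℂ n (mulR m f)).im = 0 := by
  have : inner ℂ n (mulR m f) = ((∫ x, (‖x‖ ^ b₁ * ‖f x‖ ^ 2 + ‖x‖ ^ b₂ * ‖f x‖ ^ 4) * m x *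
      ‖f x‖ ^ 2 : ℝ) : ℂ) := by
    rw [inner_eq_integral, ← integral_complex_ofReal]
    refine integral_congr_ae ?_
    filter_upwards [h, hm.coeFn_mulR f] with x h1 h2
    rw [h1, h2, map_mul, Complex.conj_ofReal]
    have : conj (f x) * f x = ((‖f x‖ ^ 2 : ℝ) : ℂ) := by
      rw [mul_comm, Complex.mul_conj, Complex.normSq_eq_norm_sq]
    push_cast at this ⊢
    linear_combination ((‖x‖ ^ b₁ : ℝ) * ‖f x‖ ^ 2 + (‖x‖ ^ b₂ : ℝ) * ‖f x‖ ^ 4) * m x * this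
  rw [this, Complex.ofReal_im]

/-- The growing powers |x|^b are moved from the force onto the weight `m`, which in the applications
carries a Gaussian and keeps the products bounded. -/
theorem IsForce.inner_mulR {w n : L2} (h : IsForce b₁ b₂ (resolvent w) n) {m m₁ m₂ : Plane → ℝ}
    (hm : BddWeight m) (h₁ : BddWeight m₁) (h₂ : BddWeight m₂)
    (e₁ : ∀ x, ‖x‖ ^ b₁ * m x = m₁ x) (e₂ : ∀ x, ‖x‖ ^ b₂ * m x = m₂ x) (f : L2) :
    inner ℂ n (mulR m f) = inner ℂ (powOp 1 w) (mulR m₁ f) + inner ℂ (powOp 2 w) (mulR m₂ f) := by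
  rw [inner_eq_integral, inner_eq_integral, inner_eq_integral,
    ← integral_add (integrable_conj_mul _ _) (integrable_conj_mul _ _)]
  refine integral_congr_ae ?_
  filter_upwards [h, coeFn_powOp 1 w, coeFn_powOp 2 w, hm.coeFn_mulR f, h₁.coeFn_mulR f,
    h₂.coeFn_mulR f] with x h1 h2 h3 h4 h5 h6
  rw [h1, h2, h3, h4, h5, h6, ← e₁, ← e₂]
  simp only [map_mul, Complex.conj_ofReal]
  push_cast
  ring

/-- The product of the divergence of the Gaussian field with a power weight. -/
def dvgPow (ε b : ℝ) (x : Plane) : ℝ := (4 - 4 * ε * ‖x‖ ^ 2) * ‖x‖ ^ b * gauss ε x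

theorem bddWeight_dvgPow {ε b : ℝ} (hε : 0 < ε) (hb : 0 ≤ b) : BddWeight (dvgPow ε b) := by
  refine bddWeight_pow_gauss hε hb (by fun_prop) (4 + 4 * ε) (by positivity) fun x => ?_
  have h0 := Real.rpow_nonneg (norm_nonneg x) b
  rw [abs_mul, abs_of_nonneg h0, ← mul_assoc]
  refine mul_le_mul_of_nonneg_right ?_ h0
  rw [abs_le]
  constructor <;> nlinarith [sq_nonneg ‖x‖, mul_nonneg hε.le (sq_nonneg ‖x‖)]

theorem bddWeight_jacPow_sum {ε b : ℝ} (hε : 0 < ε) (hb : 0 ≤ b) :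
    BddWeight fun x => jacPow ε b 0 x + jacPow ε b 1 x := by
  obtain ⟨C, hC⟩ := (bddWeight_jacPow hε hb 0).bdd
  obtain ⟨D, hD⟩ := (bddWeight_jacPow hε hb 1).bdd
  exact ⟨(bddWeight_jacPow hε hb 0).meas.add (bddWeight_jacPow hε hb 1).meas, C + D,
    fun x => (abs_add_le _ _).trans (add_le_add (hC x) (hD x))⟩

theorem re_inner_powOp_mulR {m : Plane → ℝ} (hm : BddWeight m) (p : ℕ) (w : L2) :
    (inner ℂ (powOp p w) (mulR m (resolvent w))).re =
      ∫ x, m x * ‖resolvent w x‖ ^ (2 * p + 2) := by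
  have : inner ℂ (powOp p w) (mulR m (resolvent w)) =
      ((∫ x, m x * ‖resolvent w x‖ ^ (2 * p + 2) : ℝ) : ℂ) := by
    rw [inner_eq_integral, ← integral_complex_ofReal]
    refine integral_congr_ae ?_
    filter_upwards [coeFn_powOp p w, hm.coeFn_mulR (resolvent w)] with x h1 h2
    rw [h1, h2, map_mul, Complex.conj_ofReal]
    have : conj (resolvent w x) * resolvent w x = ((‖resolvent w x‖ ^ 2 : ℝ) : ℂ) := by
      rw [mul_comm, Complex.mul_conj, Complex.normSq_eq_norm_sq]
    push_cast at this ⊢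
    linear_combination ((‖resolvent w x‖ : ℂ) ^ (2 * p)) * m x * this
  rw [this, Complex.ofReal_re]

/-- Integrating the gradient term by parts leaves the divergence of the weighted field with the
factor -1/(2(p+1)); no derivative of u remains. -/
theorem re_inner_powOp_virial {ε b : ℝ} (hε : 0 < ε) (hb : 0 ≤ b) (p : ℕ) (w : L2) :
    4 * (∑ k, (inner ℂ (powOp p w) (mulR (fldPow ε b k) (derivOp k w))).re +
      1 / 2 * (inner ℂ (powOp p w) (mulR (dvgPow ε b) (resolvent w))).re) =
      2 * (∫ x, dvgPow ε b x * ‖resolvent w x‖ ^ (2 * p + 2)) - 2 / (p + 1) *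
        (∫ x, (jacPow ε b 0 x + jacPow ε b 1 x) * ‖resolvent w x‖ ^ (2 * p + 2)) := by
  have h0 := inner_powOp_derivOp (bddWeight_fldPow hε hb 0) (bddWeight_jacPow hε hb 0)
    (hasPartial_fldPow hb ε 0) p w
  have h1 := inner_powOp_derivOp (bddWeight_fldPow hε hb 1) (bddWeight_jacPow hε hb 1)
    (hasPartial_fldPow hb ε 1) p w
  have hs : mulR (fun x => jacPow ε b 0 x + jacPow ε b 1 x) (resolvent w) =
      mulR (jacPow ε b 0) (resolvent w) + mulR (jacPow ε b 1) (resolvent w) := by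
    refine Lp.ext ?_
    filter_upwards [(bddWeight_jacPow_sum hε hb).coeFn_mulR (resolvent w),
      (bddWeight_jacPow hε hb 0).coeFn_mulR (resolvent w),
      (bddWeight_jacPow hε hb 1).coeFn_mulR (resolvent w),
      Lp.coeFn_add (mulR (jacPow ε b 0) (resolvent w)) (mulR (jacPow ε b 1) (resolvent w))]
      with x e1 e2 e3 e4
    rw [e1, e4, Pi.add_apply, e2, e3]
    push_cast
    ring
  rw [← re_inner_powOp_mulR (bddWeight_dvgPow hε hb), ← re_inner_powOp_mulR
    (bddWeight_jacPow_sum hε hb), hs, inner_add_right, Complex.add_re, Fin.sum_univ_two]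
  have hp : (0 : ℝ) < p + 1 := by positivity
  field_simp
  linarith

end

section

variable {b₁ b₂ : ℝ}

/-! ### Flows and their conservation laws -/

/-- The curve `u = resolvent w` solves `u_t = i (Δu - n)`, where `n` is the force. -/
structure IsFlow (b₁ b₂ : ℝ) (w n : ℝ → L2) : Prop where
  continuous_w : Continuous w
  continuous_n : Continuous n
  isForce : ∀ t, IsForce b₁ b₂ (resolvent (w t)) (n t)
  hasDerivAt : ∀ t, HasDerivAt (fun t => resolvent (w t))
    (Complex.I • (laplacianOp (w t) - n t)) t

/-- The force is read off from the equation as i u_t + Δu, which makes it a continuous L² curve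
without any estimate on the unbounded weights. -/
theorem IsGlobalSmoothSolution.exists_isFlow {φ : L2} {u : ℝ → L2}
    (hu : IsGlobalSmoothSolution (powerCoeff b₁) (powerCoeff b₂) φ u) :
    ∃ w n : ℝ → L2, IsFlow b₁ b₂ w n ∧ ∀ t, u t = resolvent (w t) := by
  obtain ⟨w, hw, huw⟩ := hu.continuous_sobolev
  have hr : ∀ t, u t = resolvent (w t) := fun t => eq_resolvent_of_sobolev (huw t)
  have hd : Continuous (deriv u) := hu.contDiff.continuous_deriv le_rfl
  have key : ∀ t, HasDerivAt u (deriv u t) t ∧ IsForce b₁ b₂ (u t)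
      (Complex.I • deriv u t + laplacianOp (w t)) := by
    intro t
    obtain ⟨u', lap, h1, h2, h3⟩ := hu.solves t
    have e : lap = laplacianOp (w t) := by
      apply coe_injective
      rw [h2, coe_laplacianOp, hr]
    rw [h1.deriv]
    refine ⟨h1, ?_⟩
    rw [← e]
    filter_upwards [h3, Lp.coeFn_add (Complex.I • u') lap, Lp.coeFn_smul Complex.I u']
      with x e1 e2 e3
    rw [e2, Pi.add_apply, e3, Pi.smul_apply, smul_eq_mul, e1, powerCoeff, powerCoeff]
    push_cast
    ring
  refine ⟨w, fun t => Complex.I • deriv u t + laplacianOp (w t),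
    ⟨hw, by fun_prop, fun t => hr t ▸ (key t).2, fun t => ?_⟩, hr⟩
  have e : (fun t => resolvent (w t)) = u := funext fun t => (hr t).symm
  rw [e]
  refine (key t).1.congr_deriv ?_
  rw [sub_add_cancel_right, smul_neg, smul_smul, Complex.I_mul_I]
  simp

theorem re_inner_I_smul_left (f g : L2) :
    (inner ℂ (Complex.I • f) g).re = (inner ℂ f g).im := by
  rw [inner_smul_left]; simp

theorem im_inner_laplacianOp (w : L2) : (inner ℂ (laplacianOp w) (resolvent w)).im = 0 := by
  have h := congrArg Complex.im (inner_laplacianOp_resolvent w w)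
  rw [← inner_conj_symm (resolvent w), Complex.conj_im] at h
  linarith

variable {w n : ℝ → L2}

theorem IsFlow.continuous_velocity (h : IsFlow b₁ b₂ w n) :
    Continuous fun t => Complex.I • (laplacianOp (w t) - n t) := by
  have := h.continuous_w
  have := h.continuous_n
  fun_prop

/-- Conservation of mass: both ⟨Δu, u⟩ and ⟨n, u⟩ are real, and the factor i in the velocity removes
them from the derivative. -/
theorem IsFlow.norm_eq (h : IsFlow b₁ b₂ w n) (s t : ℝ) :
    ‖resolvent (w s)‖ = ‖resolvent (w t)‖ := by
  have hd : ∀ t, HasDerivAt (fun t => (inner ℂ (resolvent (w t)) (resolvent (w t))).re) 0 t := by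
    intro t
    refine (hasDerivAt_re_inner_of_symm (h.hasDerivAt t)
      (h.hasDerivAt t).continuousAt fun _ _ => rfl).congr_deriv ?_
    rw [re_inner_I_smul_left, inner_sub_left, Complex.sub_im, im_inner_laplacianOp]
    have := (h.isForce t).im_inner_mulR (bddWeight_const 1)
    rw [mulR_one] at this
    rw [this]; simp
  have hc := is_const_of_deriv_eq_zero (fun t => (hd t).differentiableAt) (fun t => (hd t).deriv) s t
  have e : ∀ f : L2, (inner ℂ f f).re = ‖f‖ ^ 2 := fun f => inner_self_eq_norm_sq (𝕜 := ℂ) f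
  rw [e, e] at hc
  exact (sq_eq_sq₀ (norm_nonneg _) (norm_nonneg _)).mp hc

/-- The total energy. -/
def energy (b₁ b₂ : ℝ) (w : L2) : ℝ :=
  1 / 2 * ∑ j, ‖derivOp j w‖ ^ 2 + potentialEnergy b₁ b₂ (resolvent w)

theorem IsFlow.hasDerivAt_potentialEnergy (h : IsFlow b₁ b₂ w n) (t : ℝ) :
    HasDerivAt (fun t => potentialEnergy b₁ b₂ (resolvent (w t)))
      (inner ℂ (n t) (Complex.I • (laplacianOp (w t) - n t))).re t :=
  hasDerivAt_of_subgradient (h.hasDerivAt t) h.continuous_n.continuousAt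
    fun s t => (h.isForce s).le_potentialEnergy_sub (h.isForce t)

theorem IsFlow.energy_eq (h : IsFlow b₁ b₂ w n) (s t : ℝ) :
    energy b₁ b₂ (w s) = energy b₁ b₂ (w t) := by
  have hd : ∀ t, HasDerivAt (fun t => energy b₁ b₂ (w t)) 0 t := by
    intro t
    have h1 := hasDerivAt_re_inner_of_symm (h.hasDerivAt t)
      (laplacianOp.continuous.comp h.continuous_w).continuousAt
      fun s t => congrArg Complex.re (inner_laplacianOp_resolvent (w s) (w t))
    have h2 := (h1.const_mul (-1 / 2)).add (h.hasDerivAt_potentialEnergy t)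
    have e : (fun t => energy b₁ b₂ (w t)) = (fun t => -1 / 2 * (inner ℂ (resolvent (w t))
        ((laplacianOp ∘ w) t)).re) + fun t => potentialEnergy b₁ b₂ (resolvent (w t)) := by
      funext t
      rw [Pi.add_apply, Function.comp_apply, re_inner_resolvent_laplacianOp, energy]
      ring
    rw [e]
    refine h2.congr_deriv ?_
    have e1 : (inner ℂ (n t) (Complex.I • (laplacianOp (w t) - n t))).re =
        (inner ℂ (Complex.I • (laplacianOp (w t) - n t)) (n t)).re := by
      rw [← inner_conj_symm, Complex.conj_re]
    -- The velocity is i times H = Δu - n, and the energy derivative is minus the real part of ⟨iH,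
    -- H⟩, which vanishes.
    have e2 : (inner ℂ (Complex.I • (laplacianOp (w t) - n t)) (laplacianOp (w t) - n t)).re = 0 := by
      rw [re_inner_I_smul_left]
      exact inner_self_im (𝕜 := ℂ) _
    rw [inner_sub_right, Complex.sub_re] at e2
    rw [e1, Function.comp_apply]
    linarith
  exact is_const_of_deriv_eq_zero (fun t => (hd t).differentiableAt) (fun t => (hd t).deriv) s t

/-! ### The regularized second moment -/

/-- The regularized second moment. -/
def moment (ε : ℝ) (f : L2) : ℝ := (inner ℂ f (mulR (rho ε) f)).re

/-- The regularized generator of dilations. -/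
def dilationOp (ε : ℝ) : L2 →L[ℂ] L2 := transport (fld ε) (dvg ε)

/-- The force does not contribute because ⟨n, ρu⟩ is real. -/
theorem IsFlow.hasDerivAt_moment (h : IsFlow b₁ b₂ w n) {ε : ℝ} (hε : 0 < ε) (t : ℝ) :
    HasDerivAt (fun t => moment ε (resolvent (w t)))
      (2 * (inner ℂ (resolvent (w t)) (dilationOp ε (w t))).re) t := by
  have hc : Continuous fun t => mulR (rho ε) (resolvent (w t)) := by
    have := h.continuous_w
    fun_prop
  refine (hasDerivAt_re_inner_of_symm (h.hasDerivAt t) hc.continuousAt fun s t =>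
    congrArg Complex.re ((bddWeight_rho hε).inner_mulR_left _ _)).congr_deriv ?_
  rw [smul_sub, inner_sub_left, Complex.sub_re, (admissibleField_gauss hε).inner_laplacian_weight
    (bddWeight_rho hε) (hasPartial_rho hε), re_inner_I_smul_left,
    (h.isForce t).im_inner_mulR (bddWeight_rho hε), sub_zero, dilationOp]

theorem IsFlow.hasDerivAt_inner_dilationOp (h : IsFlow b₁ b₂ w n) {ε : ℝ} (hε : 0 < ε) (t : ℝ) :
    HasDerivAt (fun t => (inner ℂ (resolvent (w t)) (dilationOp ε (w t))).re)
      (2 * (inner ℂ (Complex.I • (laplacianOp (w t) - n t)) (dilationOp ε (w t))).re) t := by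
  have hc : Continuous fun t => dilationOp ε (w t) := by
    have := h.continuous_w
    fun_prop
  exact hasDerivAt_re_inner_of_symm (h.hasDerivAt t) hc.continuousAt fun s t =>
    congrArg Complex.re ((admissibleField_gauss hε).inner_transport _ _)

/-- The defect between `1` and the Gaussian cutoff, including its scaling derivative. -/
def defect (ε : ℝ) (x : Plane) : ℝ := 1 - gauss ε x + ε * ‖x‖ ^ 2 * gauss ε x

theorem mul_sq_mul_gauss_le (ε : ℝ) (x : Plane) : ε * ‖x‖ ^ 2 * gauss ε x ≤ 1 := by
  have h := Real.add_one_le_exp (ε * ‖x‖ ^ 2)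
  rw [gauss, Real.exp_neg, ← div_eq_mul_inv, div_le_one (Real.exp_pos _)]
  linarith

theorem defect_nonneg {ε : ℝ} (hε : 0 ≤ ε) (x : Plane) : 0 ≤ defect ε x := by
  have := gauss_le_one hε x
  have := (gauss_pos ε x).le
  have : 0 ≤ ε * ‖x‖ ^ 2 * gauss ε x := by positivity
  unfold defect; linarith

theorem defect_le (ε : ℝ) (x : Plane) : defect ε x ≤ 2 := by
  have := mul_sq_mul_gauss_le ε x
  have := gauss_pos ε x
  unfold defect; linarith

theorem continuous_defect (ε : ℝ) : Continuous (defect ε) := by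
  have := continuous_gauss ε
  unfold defect; fun_prop

theorem tendsto_defect (x : Plane) : Tendsto (fun ε => defect ε x) (𝓝 0) (𝓝 0) := by
  have : Continuous fun ε => defect ε x := by unfold defect gauss; fun_prop
  simpa [defect, gauss] using this.tendsto 0

/-- In the scaled variable s = √ε |x| the weight is √ε times a bounded function, so the lower-order
virial term vanishes as ε tends to 0. -/
theorem abs_grd_le {ε : ℝ} (hε : 0 < ε) (j : Fin 2) (x : Plane) : |grd ε j x| ≤ 24 * √ε := by
  have h := abs_coord_le x j
  have hg := gauss_pos ε x
  have hn := norm_nonneg x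
  set s := √ε * ‖x‖ with hs
  have hs0 : 0 ≤ s := by positivity
  have hsq : ε = √ε ^ 2 := (Real.sq_sqrt hε.le).symm
  have hs2 : ε * ‖x‖ ^ 2 = s ^ 2 := by rw [hs, mul_pow, ← hsq]
  have he := Real.quadratic_le_exp_of_nonneg (sq_nonneg s)
  have hg' : gauss ε x * Real.exp (s ^ 2) = 1 := by
    rw [gauss, hs2, ← Real.exp_add]; simp
  have k1 : s * gauss ε x ≤ 1 := by
    rw [← hg', mul_comm]
    exact mul_le_mul_of_nonneg_left (by nlinarith [sq_nonneg (s - 1), sq_nonneg (s ^ 2)]) hg.le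
  have k2 : s ^ 3 * gauss ε x ≤ 1 := by
    rw [← hg', mul_comm]
    exact mul_le_mul_of_nonneg_left (by nlinarith [sq_nonneg (s * (s - 1))]) hg.le
  rw [grd, abs_mul, abs_of_pos hg]
  have e1 : |(-16 * ε * x j + 8 * ε ^ 2 * x j * ‖x‖ ^ 2)| ≤
      16 * ε * ‖x‖ + 8 * ε ^ 2 * ‖x‖ * ‖x‖ ^ 2 := by
    refine (abs_add_le _ _).trans (add_le_add ?_ ?_)
    · rw [abs_mul, abs_mul, abs_neg, abs_of_pos hε]; norm_num; gcongr
    · rw [abs_mul, abs_mul, abs_of_nonneg (sq_nonneg ‖x‖), abs_of_nonneg (by positivity)]; gcongr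
  have e2 : 16 * ε * ‖x‖ + 8 * ε ^ 2 * ‖x‖ * ‖x‖ ^ 2 = √ε * (16 * s + 8 * s ^ 3) := by
    rw [hs]
    nth_rewrite 1 [hsq]
    nth_rewrite 2 [hsq]
    ring
  calc |(-16 * ε * x j + 8 * ε ^ 2 * x j * ‖x‖ ^ 2)| * gauss ε x
      ≤ (√ε * (16 * s + 8 * s ^ 3)) * gauss ε x := by rw [← e2]; gcongr
    _ = √ε * (16 * (s * gauss ε x) + 8 * (s ^ 3 * gauss ε x)) := by ring
    _ ≤ √ε * (16 * 1 + 8 * 1) := by gcongr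
    _ = _ := by ring

end

/-! ### The regularized virial inequality. -/

section

variable {b₁ b₂ : ℝ}

theorem BddWeight.integrable_mul {q F : Plane → ℝ} (hq : BddWeight q) (hF : Integrable F) :
    Integrable fun x => q x * F x := by
  obtain ⟨C, hC⟩ := hq.bdd
  exact hF.bdd_mul (c := C) hq.meas.aestronglyMeasurable (Eventually.of_forall hC)

theorem BddWeight.re_inner_mulR {m : Plane → ℝ} (hm : BddWeight m) (f g : L2) :
    (inner ℂ f (mulR m g)).re = ∫ x, m x * (conj (f x) * g x).re := by
  rw [inner_eq_integral]
  refine (integral_re (integrable_conj_mul f (mulR m g))).symm.trans (integral_congr_ae ?_)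
  filter_upwards [hm.coeFn_mulR g] with x hx
  rw [hx, mul_left_comm]
  exact Complex.re_ofReal_mul _ _

theorem integrable_re_conj_mul (f g : L2) : Integrable fun x : Plane => (conj (f x) * g x).re :=
  (integrable_conj_mul f g).re

theorem integrable_norm_sq (f : L2) : Integrable fun x : Plane => ‖f x‖ ^ 2 := by
  simpa [sq] using integrable_norm_mul_norm f f

theorem norm_sq_eq_integral (f : L2) : ‖f‖ ^ 2 = ∫ x, ‖f x‖ ^ 2 := by
  have h := (bddWeight_const 1).re_inner_mulR f f
  rw [mulR_one] at h
  rw [← inner_self_eq_norm_sq (𝕜 := ℂ) f]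
  refine h.trans (integral_congr_ae (Eventually.of_forall fun x => ?_))
  simp only
  rw [one_mul, mul_comm, Complex.mul_conj, Complex.ofReal_re, Complex.normSq_eq_norm_sq]

theorem bddWeight_gauss {ε : ℝ} (hε : 0 ≤ ε) : BddWeight (gauss ε) :=
  ⟨(continuous_gauss ε).measurable, 1, fun x => by
    rw [abs_of_pos (gauss_pos ε x)]; exact gauss_le_one hε x⟩

theorem bddWeight_defect {ε : ℝ} (hε : 0 ≤ ε) : BddWeight (defect ε) :=
  ⟨(continuous_defect ε).measurable, 2, fun x => by
    rw [abs_of_nonneg (defect_nonneg hε x)]; exact defect_le ε x⟩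

/-- The Hessian of the truncated weight is twice the identity minus 4ε x xᵀ, times the Gaussian.
Cauchy–Schwarz bounds the rank-one part by 4ε|x|², and `k1` is the Lagrange identity for the gap. -/
theorem sum_jac_mul_ge {ε : ℝ} (hε : 0 ≤ ε) (x : Plane) (d : Fin 2 → ℂ) :
    (2 - 4 * defect ε x) * ∑ j, ‖d j‖ ^ 2 ≤ ∑ j, ∑ k, jac ε j k x * (conj (d j) * d k).re := by
  have hg := (gauss_pos ε x).le
  have h1 := gauss_le_one hε x
  simp only [Fin.sum_univ_two, jac, defect, norm_sq_plane x, ← Complex.normSq_eq_norm_sq,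
    Complex.normSq_apply, Complex.mul_re, Complex.conj_re, Complex.conj_im]
  simp only [if_true, show (1 : Fin 2) ≠ 0 from by decide, show (0 : Fin 2) ≠ 1 from by decide, if_false]
  set g := gauss ε x
  have k1 : 0 ≤ ε * g * ((x 1 * (d 0).re - x 0 * (d 1).re) ^ 2 +
    (x 1 * (d 0).im - x 0 * (d 1).im) ^ 2) := by positivity
  have k2 : 0 ≤ (1 - g) * ((d 0).re ^ 2 + (d 0).im ^ 2 + (d 1).re ^ 2 + (d 1).im ^ 2) :=
    mul_nonneg (by linarith) (by positivity)
  nlinarith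

theorem sum_re_inner_jac_ge {ε : ℝ} (hε : 0 < ε) (D : Fin 2 → L2) :
    2 * ∑ j, ‖D j‖ ^ 2 - 4 * ∫ x, defect ε x * ∑ j, ‖D j x‖ ^ 2 ≤
      ∑ j, ∑ k, (inner ℂ (D j) (mulR (jac ε j k) (D k))).re := by
  have i1 : Integrable fun x => ∑ j, ‖D j x‖ ^ 2 :=
    integrable_finsetSum _ fun j _ => integrable_norm_sq (D j)
  have i2 := (bddWeight_defect hε.le).integrable_mul i1
  have i3 : ∀ j k, Integrable fun x => jac ε j k x * (conj (D j x) * D k x).re :=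
    fun j k => (bddWeight_jac hε j k).integrable_mul (integrable_re_conj_mul _ _)
  simp only [norm_sq_eq_integral, (bddWeight_jac hε _ _).re_inner_mulR]
  rw [← integral_finsetSum _ fun j _ => integrable_norm_sq (D j), ← integral_const_mul,
    ← integral_const_mul, ← integral_sub (i1.const_mul _) (i2.const_mul _)]
  have e : ∑ j, ∑ k, ∫ x, jac ε j k x * (conj (D j x) * D k x).re =
      ∫ x, ∑ j, ∑ k, jac ε j k x * (conj (D j x) * D k x).re := by
    rw [integral_finsetSum _ fun j _ => integrable_finsetSum _ fun k _ => i3 j k]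
    exact Finset.sum_congr rfl fun j _ => (integral_finsetSum _ fun k _ => i3 j k).symm
  rw [e]
  refine integral_mono ((i1.const_mul _).sub (i2.const_mul _))
    (integrable_finsetSum _ fun j _ => integrable_finsetSum _ fun k _ => i3 j k) fun x => ?_
  have := sum_jac_mul_ge hε.le x fun j => D j x
  simp only
  linarith

theorem norm_mulR_le {m : Plane → ℝ} (hm : BddWeight m) {C : ℝ} (hC : ∀ x, |m x| ≤ C) (f : L2) :
    ‖mulR m f‖ ≤ C * ‖f‖ := by
  refine Lp.norm_le_mul_norm_of_ae_le_mul ?_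
  filter_upwards [hm.coeFn_mulR f] with x hx
  rw [hx, norm_mul, Complex.norm_real]
  exact mul_le_mul_of_nonneg_right (hC x) (norm_nonneg _)

/-- At ε = 0 the weight is (8 - 2c(2 + b)) |x|^b: 8 from twice the divergence of 2x, and 2(2 +
b)|x|^b from the divergence of 2x|x|^b. The constant 16 in the error is generous. -/
theorem virial_weight_ge {ε b c : ℝ} (hε : 0 < ε) (hb : 0 ≤ b) (hc : 0 ≤ c) {k : ℕ} {f : L2}
    (hf : Integrable fun x : Plane => ‖x‖ ^ b * ‖f x‖ ^ k) :
    (8 - 2 * c * (2 + b)) * potential b k f - 16 * ∫ x, defect ε x * (‖x‖ ^ b * ‖f x‖ ^ k) ≤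
      2 * (∫ x, dvgPow ε b x * ‖f x‖ ^ k) -
        c * ∫ x, (jacPow ε b 0 x + jacPow ε b 1 x) * ‖f x‖ ^ k := by
  have e1 : (fun x => dvgPow ε b x * ‖f x‖ ^ k) = fun x => dvg ε x * (‖x‖ ^ b * ‖f x‖ ^ k) := by
    funext x; rw [dvgPow, dvg]; ring
  have e2 : (fun x => (jacPow ε b 0 x + jacPow ε b 1 x) * ‖f x‖ ^ k) =
      fun x => (dvg ε x * (‖x‖ ^ b * ‖f x‖ ^ k) +
        2 * b * (gauss ε x * (‖x‖ ^ b * ‖f x‖ ^ k))) := by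
    funext x; rw [sum_jacPow hb, dvg]; ring
  have i1 := (bddWeight_dvg hε).integrable_mul hf
  have i2 := (bddWeight_gauss hε.le).integrable_mul hf
  have i3 := (bddWeight_defect hε.le).integrable_mul hf
  have i4 : Integrable fun x => dvg ε x * (‖x‖ ^ b * ‖f x‖ ^ k) +
      2 * b * (gauss ε x * (‖x‖ ^ b * ‖f x‖ ^ k)) := i1.add (i2.const_mul (2 * b))
  rw [e1, e2, potential, ← integral_const_mul, ← integral_const_mul, ← integral_const_mul,
    ← integral_const_mul,
    ← integral_sub (hf.const_mul _) (i3.const_mul _), ← integral_sub (i1.const_mul _) (i4.const_mul _)]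
  refine integral_mono ((hf.const_mul _).sub (i3.const_mul _))
    ((i1.const_mul _).sub (i4.const_mul _)) fun x => ?_
  have hg := (gauss_pos ε x).le
  have h1 := gauss_le_one hε.le x
  have hF : 0 ≤ ‖x‖ ^ b * ‖f x‖ ^ k := by positivity
  simp only [dvg, defect, ← mul_assoc, ← sub_mul, ← add_mul]
  simp only [mul_assoc _ (‖x‖ ^ b)]
  refine mul_le_mul_of_nonneg_right ?_ hF
  have k1 : 0 ≤ c * (2 + b) * (1 - gauss ε x) := mul_nonneg (by positivity) (by linarith)
  have k2 : 0 ≤ (1 + c) * (ε * ‖x‖ ^ 2 * gauss ε x) := by positivity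
  nlinarith

/-- The sum of the kinetic density and the potential densities. -/
def density (b₁ b₂ : ℝ) (w : L2) (x : Plane) : ℝ :=
  ∑ j, ‖derivOp j w x‖ ^ 2 + (‖x‖ ^ b₁ * ‖resolvent w x‖ ^ 4 + ‖x‖ ^ b₂ * ‖resolvent w x‖ ^ 6)

theorem density_nonneg (b₁ b₂ : ℝ) (w : L2) (x : Plane) : 0 ≤ density b₁ b₂ w x := by
  unfold density; positivity

theorem IsForce.integrable_density {w n : L2} (h : IsForce b₁ b₂ (resolvent w) n) :
    Integrable (density b₁ b₂ w) :=
  (integrable_finsetSum _ fun j _ => integrable_norm_sq (derivOp j w)).add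
    (h.integrable_four.add h.integrable_six)

theorem IsForce.integral_density {w n : L2} (h : IsForce b₁ b₂ (resolvent w) n) :
    ∫ x, density b₁ b₂ w x = ∑ j, ‖derivOp j w‖ ^ 2 +
      (potential b₁ 4 (resolvent w) + potential b₂ 6 (resolvent w)) := by
  have i1 := integrable_finsetSum Finset.univ fun j _ => integrable_norm_sq (derivOp j w)
  simp only [density]
  rw [integral_add i1 (by exact h.integrable_four.add h.integrable_six),
    integral_add h.integrable_four h.integrable_six,
    integral_finsetSum _ fun j _ => integrable_norm_sq (derivOp j w)]
  simp only [norm_sq_eq_integral, potential]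

theorem re_inner_dilationOp (ε : ℝ) (n w : L2) :
    (inner ℂ (-(Complex.I • n)) (dilationOp ε w)).re =
      ∑ k, (inner ℂ n (mulR (fld ε k) (derivOp k w))).re +
        1 / 2 * (inner ℂ n (mulR (dvg ε) (resolvent w))).re := by
  rw [dilationOp, transport_apply, inner_neg_left, inner_smul_left, inner_smul_right,
    Complex.conj_I, ← mul_assoc]
  have : -Complex.I * -Complex.I = -1 := by simp
  rw [this, neg_one_mul, neg_neg, inner_add_right, inner_sum, inner_smul_right, Complex.add_re,
    Complex.re_sum]
  have h2 : (1 / 2 : ℂ) = ((1 / 2 : ℝ) : ℂ) := by push_cast; rfl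
  rw [h2, Complex.re_ofReal_mul]

theorem IsForce.re_inner_dilationOp_ge {w n : L2} (h : IsForce b₁ b₂ (resolvent w) n)
    (hb₁ : 0 ≤ b₁) (hb₂ : 0 ≤ b₂) {ε : ℝ} (hε : 0 < ε) :
    (4 - 2 * b₁) * potential b₁ 4 (resolvent w) +
      (16 - 4 * b₂) / 3 * potential b₂ 6 (resolvent w) -
      16 * ∫ x, defect ε x * (‖x‖ ^ b₁ * ‖resolvent w x‖ ^ 4 + ‖x‖ ^ b₂ * ‖resolvent w x‖ ^ 6) ≤
      4 * (inner ℂ (-(Complex.I • n)) (dilationOp ε w)).re := by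
  have hf : ∀ k, inner ℂ n (mulR (fld ε k) (derivOp k w)) =
      inner ℂ (powOp 1 w) (mulR (fldPow ε b₁ k) (derivOp k w)) +
        inner ℂ (powOp 2 w) (mulR (fldPow ε b₂ k) (derivOp k w)) := fun k =>
    h.inner_mulR (bddWeight_fld hε k) (bddWeight_fldPow hε hb₁ k) (bddWeight_fldPow hε hb₂ k)
      (fun x => by rw [fld, fldPow]; ring) (fun x => by rw [fld, fldPow]; ring) _
  have hd := h.inner_mulR (bddWeight_dvg hε) (bddWeight_dvgPow hε hb₁) (bddWeight_dvgPow hε hb₂)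
    (fun x => by rw [dvg, dvgPow]; ring) (fun x => by rw [dvg, dvgPow]; ring) (resolvent w)
  have v1 := re_inner_powOp_virial hε hb₁ 1 w
  have v2 := re_inner_powOp_virial hε hb₂ 2 w
  -- Here c = 2/(p+1), with p = 1 for the cubic and p = 2 for the quintic term.
  have g1 := virial_weight_ge (c := 1) hε hb₁ zero_le_one h.integrable_four
  have g2 := virial_weight_ge (c := 2 / 3) hε hb₂ (by norm_num) h.integrable_six
  have e : ∫ x, defect ε x * (‖x‖ ^ b₁ * ‖resolvent w x‖ ^ 4 + ‖x‖ ^ b₂ * ‖resolvent w x‖ ^ 6) =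
      (∫ x, defect ε x * (‖x‖ ^ b₁ * ‖resolvent w x‖ ^ 4)) +
        ∫ x, defect ε x * (‖x‖ ^ b₂ * ‖resolvent w x‖ ^ 6) := by
    simp only [mul_add]
    exact integral_add ((bddWeight_defect hε.le).integrable_mul h.integrable_four)
      ((bddWeight_defect hε.le).integrable_mul h.integrable_six)
  rw [re_inner_dilationOp, e]
  simp only [hf, hd, Complex.add_re, Fin.sum_univ_two] at v1 v2 ⊢
  norm_num at v1 v2 g1 g2
  linarith

/-- The kinetic parts cancel, 8‖∇u‖² on each side. For the potentials, 16P minus the virial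
contribution is 2b₁ ∫|x|^b₁|u|⁴ + (4b₂ - 8)/3 ∫|x|^b₂|u|⁶, to be compared with 8 b₁ P. -/
theorem IsForce.virial_le {w n : L2} (h : IsForce b₁ b₂ (resolvent w) n)
    (hb₁ : 0 ≤ b₁) (hb₂ : 0 ≤ b₂) (hb : b₂ ≤ 2 + b₁) {ε : ℝ} (hε : 0 < ε) :
    16 * energy b₁ b₂ w -
      4 * (inner ℂ (Complex.I • (laplacianOp w - n)) (dilationOp ε w)).re ≤
      8 * b₁ * potentialEnergy b₁ b₂ (resolvent w) + (16 * (∫ x, defect ε x * density b₁ b₂ w x) +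
        48 * √ε * ∑ j, ‖derivOp j w‖ * ‖resolvent w‖) := by
  have h1 := h.re_inner_dilationOp_ge hb₁ hb₂ hε
  have h2 := (admissibleField_gauss hε).inner_laplacian_transport w
  have h3 := sum_re_inner_jac_ge hε fun j => derivOp j w
  have h4 : ∀ j, -(24 * √ε * (‖derivOp j w‖ * ‖resolvent w‖)) ≤
      (inner ℂ (derivOp j w) (mulR (grd ε j) (resolvent w))).re := by
    intro j
    have := (abs_le.mp ((Complex.abs_re_le_norm _).trans
      (norm_inner_le_norm (𝕜 := ℂ) (derivOp j w) (mulR (grd ε j) (resolvent w))))).1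
    refine le_trans (neg_le_neg ?_) this
    have hn := norm_mulR_le (bddWeight_grd hε j) (abs_grd_le hε j) (resolvent w)
    calc _ ≤ ‖derivOp j w‖ * (24 * √ε * ‖resolvent w‖) := by gcongr
      _ = _ := by ring
  have h5 := Finset.sum_le_sum fun j (_ : j ∈ Finset.univ) => h4 j
  rw [Finset.sum_neg_distrib, ← Finset.mul_sum] at h5
  have i1 := integrable_finsetSum Finset.univ fun j _ => integrable_norm_sq (derivOp j w)
  have e : ∫ x, defect ε x * density b₁ b₂ w x =
      (∫ x, defect ε x * ∑ j, ‖derivOp j w x‖ ^ 2) + ∫ x, defect ε x *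
        (‖x‖ ^ b₁ * ‖resolvent w x‖ ^ 4 + ‖x‖ ^ b₂ * ‖resolvent w x‖ ^ 6) := by
    simp only [density, mul_add]
    rw [← integral_add]
    · exact (bddWeight_defect hε.le).integrable_mul i1
    · have := (bddWeight_defect hε.le).integrable_mul (h.integrable_four.add h.integrable_six)
      simpa only [Pi.add_apply, mul_add] using this
  rw [smul_sub, sub_eq_add_neg (Complex.I • laplacianOp w), inner_add_left, Complex.add_re, e, energy, potentialEnergy]
  -- The only excess over 8 b₁ P is in the sextic integral, and it is nonpositive exactly when b₂ ≤
  -- 2 + b₁.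
  have h6 : (4 * (b₂ - (2 + b₁)) / 3) * potential b₂ 6 (resolvent w) ≤ 0 :=
    mul_nonpos_of_nonpos_of_nonneg (by linarith) (potential_nonneg _ _ _)
  rw [← dilationOp] at h2
  rw [h2]
  nlinarith

end

/-! ### Finite second moments and removal of the truncation. -/

section

variable {b₁ b₂ : ℝ} {w n : ℝ → L2}

/-- `ξ j` is the product of `f` with the `j`-th coordinate. -/
def IsPosition (f : L2) (ξ : Fin 2 → L2) : Prop := ∀ j, ∀ᵐ x : Plane, ξ j x = ((x j : ℝ) : ℂ) * f x

theorem IsPosition.sum_norm_sq {f : L2} {ξ : Fin 2 → L2} (h : IsPosition f ξ) :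
    ∀ᵐ x : Plane, ∑ j, ‖ξ j x‖ ^ 2 = ‖x‖ ^ 2 * ‖f x‖ ^ 2 := by
  filter_upwards [h 0, h 1] with x h0 h1
  rw [Fin.sum_univ_two, h0, h1, norm_mul, norm_mul, norm_sq_plane, Complex.norm_real,
    Complex.norm_real, mul_pow, mul_pow, Real.norm_eq_abs, Real.norm_eq_abs, sq_abs, sq_abs]
  ring

theorem IsPosition.integrable {f : L2} {ξ : Fin 2 → L2} (h : IsPosition f ξ) :
    Integrable fun x : Plane => ‖x‖ ^ 2 * ‖f x‖ ^ 2 :=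
  (integrable_finsetSum Finset.univ fun j _ => integrable_norm_sq (ξ j)).congr h.sum_norm_sq

theorem IsPosition.integral_eq {f : L2} {ξ : Fin 2 → L2} (h : IsPosition f ξ) :
    ∫ x : Plane, ‖x‖ ^ 2 * ‖f x‖ ^ 2 = ∑ j, ‖ξ j‖ ^ 2 := by
  rw [← integral_congr_ae h.sum_norm_sq, integral_finsetSum _ fun j _ => integrable_norm_sq (ξ j)]
  simp only [norm_sq_eq_integral]

theorem moment_eq {ε : ℝ} (hε : 0 < ε) (f : L2) : moment ε f = ∫ x, rho ε x * ‖f x‖ ^ 2 := by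
  rw [moment, (bddWeight_rho hε).re_inner_mulR]
  refine integral_congr_ae (Eventually.of_forall fun x => ?_)
  simp only
  rw [mul_comm (conj _), Complex.mul_conj, Complex.ofReal_re, Complex.normSq_eq_norm_sq]

theorem rho_nonneg {ε : ℝ} (hε : 0 < ε) (x : Plane) : 0 ≤ rho ε x :=
  div_nonneg (by linarith [gauss_le_one hε.le x]) hε.le

theorem rho_le {ε : ℝ} (hε : 0 < ε) (x : Plane) : rho ε x ≤ ‖x‖ ^ 2 := by
  rw [rho, div_le_iff₀ hε, gauss]
  linarith [Real.one_sub_le_exp_neg (ε * ‖x‖ ^ 2)]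

/-- The quotient is the slope at 0 of the function ε ↦ -e^{-ε|x|²}. -/
theorem tendsto_rho (x : Plane) : Tendsto (fun ε => rho ε x) (𝓝[≠] 0) (𝓝 (‖x‖ ^ 2)) := by
  have h : HasDerivAt (fun ε : ℝ => -Real.exp (-(ε * ‖x‖ ^ 2))) (‖x‖ ^ 2) 0 := by
    have := (((hasDerivAt_id (0 : ℝ)).mul_const (‖x‖ ^ 2)).neg.exp).neg
    refine (this.congr_deriv (by simp)).congr_of_eventuallyEq (Eventually.of_forall fun ε => ?_)
    simp
  refine (hasDerivAt_iff_tendsto_slope.mp h).congr fun ε => ?_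
  rw [slope_def_field, rho, gauss]
  simp only [zero_mul, neg_zero, Real.exp_zero, sub_zero]
  congr 1
  ring

theorem IsPosition.moment_le {f : L2} {ξ : Fin 2 → L2} (h : IsPosition f ξ) {ε : ℝ} (hε : 0 < ε) :
    moment ε f ≤ ∑ j, ‖ξ j‖ ^ 2 := by
  rw [moment_eq hε, ← h.integral_eq]
  refine integral_mono ((bddWeight_rho hε).integrable_mul (integrable_norm_sq f)) h.integrable
    fun x => ?_
  exact mul_le_mul_of_nonneg_right (rho_le hε x) (sq_nonneg _)

theorem IsPosition.tendsto_moment {f : L2} {ξ : Fin 2 → L2} (h : IsPosition f ξ) {ε : ℕ → ℝ}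
    (hε : ∀ k, 0 < ε k) (hlim : Tendsto ε atTop (𝓝 0)) :
    Tendsto (fun k => moment (ε k) f) atTop (𝓝 (∑ j, ‖ξ j‖ ^ 2)) := by
  rw [← h.integral_eq]
  simp only [fun k => moment_eq (hε k) f]
  refine tendsto_integral_of_dominated_convergence _ (fun k => ((bddWeight_rho (hε k)).integrable_mul
    (integrable_norm_sq f)).aestronglyMeasurable) h.integrable (fun k => Eventually.of_forall
      fun x => ?_) (Eventually.of_forall fun x => ?_)
  · rw [Real.norm_of_nonneg (mul_nonneg (rho_nonneg (hε k) x) (sq_nonneg _))]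
    exact mul_le_mul_of_nonneg_right (rho_le (hε k) x) (sq_nonneg _)
  · exact ((tendsto_rho x).comp (tendsto_nhdsWithin_iff.mpr
      ⟨hlim, Eventually.of_forall fun k => (hε k).ne'⟩)).mul_const _

/-- The coordinate in the field 2x e^{-ε|x|²} is given to u, which makes the bound uniform in ε; the
divergence part is real and is removed by the factor -i. -/
theorem IsPosition.abs_re_inner_dilationOp_le {w : L2} {ξ : Fin 2 → L2}
    (h : IsPosition (resolvent w) ξ) {ε : ℝ} (hε : 0 < ε) :
    |2 * (inner ℂ (resolvent w) (dilationOp ε w)).re| ≤ 4 * ∑ j, ‖ξ j‖ * ‖derivOp j w‖ := by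
  have e1 : ∀ j, inner ℂ (resolvent w) (mulR (fld ε j) (derivOp j w)) =
      2 * inner ℂ (ξ j) (mulR (gauss ε) (derivOp j w)) := by
    intro j
    rw [inner_eq_integral, inner_eq_integral, ← integral_const_mul]
    refine integral_congr_ae ?_
    filter_upwards [h j, (bddWeight_fld hε j).coeFn_mulR (derivOp j w),
      (bddWeight_gauss hε.le).coeFn_mulR (derivOp j w)] with x h1 h2 h3
    rw [h1, h2, h3, fld, map_mul, Complex.conj_ofReal]
    push_cast
    ring
  have e2 : (inner ℂ (resolvent w) (mulR (dvg ε) (resolvent w))).im = 0 := by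
    have h1 := congrArg Complex.im ((bddWeight_dvg hε).inner_mulR_left (resolvent w) (resolvent w))
    rw [← inner_conj_symm (resolvent w) (mulR (dvg ε) (resolvent w)), Complex.conj_im] at h1 ⊢
    linarith
  have e3 : (inner ℂ (resolvent w) (dilationOp ε w)).re =
      ∑ j, 2 * (inner ℂ (ξ j) (mulR (gauss ε) (derivOp j w))).im := by
    rw [dilationOp, transport_apply, inner_smul_right, inner_add_right, inner_sum, inner_smul_right]
    simp only [e1]
    have h2 : (1 / 2 : ℂ) = ((1 / 2 : ℝ) : ℂ) := by push_cast; rfl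
    rw [neg_mul, Complex.neg_re, Complex.I_mul_re, neg_neg, Complex.add_im, h2,
      Complex.im_ofReal_mul, e2, mul_zero, add_zero, Complex.im_sum]
    exact Finset.sum_congr rfl fun j _ => by simp
  rw [e3, Finset.mul_sum, Finset.mul_sum]
  refine (Finset.abs_sum_le_sum_abs _ _).trans (Finset.sum_le_sum fun j _ => ?_)
  have hn := norm_mulR_le (bddWeight_gauss hε.le) (C := 1) (fun x => by
    rw [abs_of_pos (gauss_pos ε x)]; exact gauss_le_one hε.le x) (derivOp j w)
  have h4 := (Complex.abs_im_le_norm _).trans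
    (norm_inner_le_norm (𝕜 := ℂ) (ξ j) (mulR (gauss ε) (derivOp j w)))
  rw [abs_mul, abs_mul, abs_two]
  nlinarith [mul_le_mul_of_nonneg_left hn (norm_nonneg (ξ j))]

/-! ### Decay of the potential energy -/

/-- The error of the regularized virial inequality. -/
def virialError (b₁ b₂ ε : ℝ) (w : L2) : ℝ :=
  16 * (∫ x, defect ε x * density b₁ b₂ w x) + 48 * √ε * ∑ j, ‖derivOp j w‖ * ‖resolvent w‖

theorem virialError_nonneg {ε : ℝ} (hε : 0 < ε) (w : L2) : 0 ≤ virialError b₁ b₂ ε w := by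
  have : 0 ≤ ∫ x, defect ε x * density b₁ b₂ w x := integral_nonneg fun x =>
    mul_nonneg (defect_nonneg hε.le x) (density_nonneg _ _ _ _)
  unfold virialError
  positivity

theorem energy_nonneg (b₁ b₂ : ℝ) (w : L2) : 0 ≤ energy b₁ b₂ w := by
  have := potentialEnergy_nonneg b₁ b₂ (resolvent w)
  unfold energy
  positivity

/-- The right side is conserved along a flow and independent of ε, so it gives a majorant for
dominated convergence in time. The constants are not sharp. -/
theorem IsForce.virialError_le {w n : L2} (h : IsForce b₁ b₂ (resolvent w) n) {ε : ℝ} (hε : 0 < ε)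
    (hε1 : ε ≤ 1) : virialError b₁ b₂ ε w ≤ 432 * energy b₁ b₂ w + 48 * ‖resolvent w‖ ^ 2 := by
  have h1 : ∫ x, defect ε x * density b₁ b₂ w x ≤ 2 * ∫ x, density b₁ b₂ w x := by
    rw [← integral_const_mul]
    refine integral_mono ((bddWeight_defect hε.le).integrable_mul h.integrable_density)
      (h.integrable_density.const_mul 2) fun x => ?_
    exact mul_le_mul_of_nonneg_right (defect_le ε x) (density_nonneg _ _ _ _)
  rw [h.integral_density] at h1
  have h2 : √ε ≤ 1 := Real.sqrt_le_one.mpr hε1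
  have h3 : √ε * ∑ j, ‖derivOp j w‖ * ‖resolvent w‖ ≤ 1 * ∑ j, ‖derivOp j w‖ * ‖resolvent w‖ := by
    gcongr
  have h4 := potential_nonneg b₁ 4 (resolvent w)
  have h5 := potential_nonneg b₂ 6 (resolvent w)
  rw [virialError, energy, potentialEnergy]
  simp only [Fin.sum_univ_two] at *
  nlinarith [sq_nonneg (‖derivOp 0 w‖ - ‖resolvent w‖), sq_nonneg (‖derivOp 1 w‖ - ‖resolvent w‖),
    sq_nonneg ‖derivOp 0 w‖, sq_nonneg ‖derivOp 1 w‖]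

theorem IsForce.tendsto_virialError {w n : L2} (h : IsForce b₁ b₂ (resolvent w) n) {ε : ℕ → ℝ}
    (hε : ∀ k, 0 < ε k) (hlim : Tendsto ε atTop (𝓝 0)) :
    Tendsto (fun k => virialError b₁ b₂ (ε k) w) atTop (𝓝 0) := by
  have h1 : Tendsto (fun k => ∫ x, defect (ε k) x * density b₁ b₂ w x) atTop
      (𝓝 (∫ x, 0 * density b₁ b₂ w x)) := by
    refine tendsto_integral_of_dominated_convergence _ (fun k => ((bddWeight_defect
      (hε k).le).integrable_mul h.integrable_density).aestronglyMeasurable)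
      (h.integrable_density.const_mul 2) (fun k => Eventually.of_forall fun x => ?_)
      (Eventually.of_forall fun x => ?_)
    · rw [Real.norm_of_nonneg (mul_nonneg (defect_nonneg (hε k).le x) (density_nonneg _ _ _ _))]
      exact mul_le_mul_of_nonneg_right (defect_le (ε k) x) (density_nonneg _ _ _ _)
    · exact ((tendsto_defect x).comp hlim).mul_const _
  have h2 := (h1.const_mul 16).add ((((Real.continuous_sqrt.tendsto 0).comp hlim).const_mul 48).mul_const
    (∑ j, ‖derivOp j w‖ * ‖resolvent w‖))
  simpa [virialError] using h2

/-- The positive part of the error of the virial inequality along a flow. -/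
def virialDefect (b₁ b₂ ε : ℝ) (w n : ℝ → L2) (t : ℝ) : ℝ :=
  max 0 (16 * energy b₁ b₂ (w t) -
    4 * (inner ℂ (Complex.I • (laplacianOp (w t) - n t)) (dilationOp ε (w t))).re -
    8 * b₁ * potentialEnergy b₁ b₂ (resolvent (w t)))

theorem IsFlow.continuous_potentialEnergy (h : IsFlow b₁ b₂ w n) :
    Continuous fun t => potentialEnergy b₁ b₂ (resolvent (w t)) :=
  continuous_iff_continuousAt.mpr fun t => (h.hasDerivAt_potentialEnergy t).continuousAt

theorem IsFlow.continuous_energy (h : IsFlow b₁ b₂ w n) :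
    Continuous fun t => energy b₁ b₂ (w t) := by
  have : (fun t => energy b₁ b₂ (w t)) = fun _ => energy b₁ b₂ (w 0) :=
    funext fun t => h.energy_eq t 0
  rw [this]; exact continuous_const

theorem IsFlow.continuous_inner_velocity (h : IsFlow b₁ b₂ w n) (ε : ℝ) : Continuous fun t =>
    (inner ℂ (Complex.I • (laplacianOp (w t) - n t)) (dilationOp ε (w t))).re := by
  have h1 := h.continuous_velocity
  have h2 : Continuous fun t => dilationOp ε (w t) := (dilationOp ε).continuous.comp h.continuous_w
  exact Complex.continuous_re.comp (h1.inner h2)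

theorem IsFlow.continuous_virialDefect (h : IsFlow b₁ b₂ w n) (ε : ℝ) :
    Continuous (virialDefect b₁ b₂ ε w n) := by
  have h1 := h.continuous_potentialEnergy
  have h2 := h.continuous_energy
  have h3 := h.continuous_inner_velocity ε
  exact continuous_const.max (((h2.const_mul 16).sub (h3.const_mul 4)).sub (h1.const_mul (8 * b₁)))

theorem virialDefect_nonneg (b₁ b₂ ε : ℝ) (w n : ℝ → L2) (t : ℝ) :
    0 ≤ virialDefect b₁ b₂ ε w n t := le_max_left _ _

/-- The defect, built from inner products and energies, is continuous in time and can be integrated;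
the error bounds it at each time and tends to 0 with ε. -/
theorem IsFlow.virialDefect_le (h : IsFlow b₁ b₂ w n) (hb₁ : 0 ≤ b₁) (hb₂ : 0 ≤ b₂)
    (hb : b₂ ≤ 2 + b₁) {ε : ℝ} (hε : 0 < ε) (t : ℝ) :
    virialDefect b₁ b₂ ε w n t ≤ virialError b₁ b₂ ε (w t) := by
  refine max_le (virialError_nonneg hε _) ?_
  have := (h.isForce t).virial_le hb₁ hb₂ hb hε
  rw [virialError]
  linarith

theorem IsFlow.tendsto_integral_virialDefect (h : IsFlow b₁ b₂ w n) (hb₁ : 0 ≤ b₁) (hb₂ : 0 ≤ b₂)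
    (hb : b₂ ≤ 2 + b₁) {ε : ℕ → ℝ} (hε : ∀ k, 0 < ε k) (hε1 : ∀ k, ε k ≤ 1)
    (hlim : Tendsto ε atTop (𝓝 0)) (t : ℝ) :
    Tendsto (fun k => ∫ s in (1 : ℝ)..t, s * virialDefect b₁ b₂ (ε k) w n s) atTop (𝓝 0) := by
  have key : Tendsto (fun k => ∫ s in (1 : ℝ)..t, s * virialDefect b₁ b₂ (ε k) w n s) atTop
      (𝓝 (∫ s in (1 : ℝ)..t, s * 0)) := by
    refine intervalIntegral.tendsto_integral_filter_of_dominated_convergence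
      (fun s => |s| * (432 * energy b₁ b₂ (w 0) + 48 * ‖resolvent (w 0)‖ ^ 2)) ?_ ?_ ?_ ?_
    · exact Eventually.of_forall fun k =>
        (continuous_id.mul (h.continuous_virialDefect (ε k))).aestronglyMeasurable
    · refine Eventually.of_forall fun k => Eventually.of_forall fun s _ => ?_
      rw [norm_mul, Real.norm_eq_abs, Real.norm_of_nonneg (virialDefect_nonneg _ _ _ _ _ _)]
      have := (h.isForce s).virialError_le (hε k) (hε1 k)
      rw [h.energy_eq s 0, h.norm_eq s 0] at this
      exact mul_le_mul_of_nonneg_left ((h.virialDefect_le hb₁ hb₂ hb (hε k) s).trans this)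
        (abs_nonneg s)
    · exact (by fun_prop : Continuous fun s : ℝ => |s| * (432 * energy b₁ b₂ (w 0) +
        48 * ‖resolvent (w 0)‖ ^ 2)).intervalIntegrable _ _
    · refine Eventually.of_forall fun s _ => (squeeze_zero (fun k => virialDefect_nonneg _ _ _ _ _ _)
        (fun k => h.virialDefect_le hb₁ hb₂ hb (hε k) s)
        ((h.isForce s).tendsto_virialError hε hlim)).const_mul s
  simpa using key

/-- The pseudoconformal law integrated from 1 to t. Only the second moment at time t is truncated
from the wrong side, which leaves the difference of moments as an error term. -/
theorem IsFlow.regularized_bound (h : IsFlow b₁ b₂ w n) {ξ ξ₁ : Fin 2 → L2} {t : ℝ} (ht : 1 ≤ t)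
    (hξ : IsPosition (resolvent (w t)) ξ) (hξ₁ : IsPosition (resolvent (w 1)) ξ₁) {ε : ℝ}
    (hε : 0 < ε) :
    8 * t ^ 2 * potentialEnergy b₁ b₂ (resolvent (w t)) ≤
      (∑ j, ‖ξ₁ j‖ ^ 2 + 4 * ∑ j, ‖ξ₁ j‖ * ‖derivOp j (w 1)‖ + 8 * energy b₁ b₂ (w 1)) +
      (∑ j, ‖ξ j‖ ^ 2 - moment ε (resolvent (w t))) +
      (∫ s in (1 : ℝ)..t, 8 * b₁ * (s * potentialEnergy b₁ b₂ (resolvent (w s)))) +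
      ∫ s in (1 : ℝ)..t, s * virialDefect b₁ b₂ ε w n s := by
  set E := energy b₁ b₂ (w 1) with hE
  set y := fun s => moment ε (resolvent (w s)) with hy
  set q := fun s => (inner ℂ (resolvent (w s)) (dilationOp ε (w s))).re with hq
  set v := fun s => (inner ℂ (Complex.I • (laplacianOp (w s) - n s)) (dilationOp ε (w s))).re with hv
  have hvc : Continuous v := h.continuous_inner_velocity ε
  -- For the untruncated weight this functional is ‖(x + 2is∇)u‖² + 8s²P.
  have hd : ∀ s, HasDerivAt (fun s => y s - 2 * (s * q s) + 8 * s ^ 2 * E)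
      (s * (16 * E - 4 * v s)) s := by
    intro s
    have h1 := h.hasDerivAt_moment hε s
    have h2 := ((hasDerivAt_id s).mul (h.hasDerivAt_inner_dilationOp hε s)).const_mul 2
    have h3 := ((hasDerivAt_pow 2 s).const_mul 8).mul_const E
    refine ((h1.sub h2).add h3).congr_deriv ?_
    simp only [hv, id]
    norm_num
    ring
  have hint := intervalIntegral.integral_eq_sub_of_hasDerivAt (fun s _ => hd s)
    ((by fun_prop : Continuous fun s => s * (16 * E - 4 * v s)).intervalIntegrable 1 t)
  have c1 : Continuous fun s => 8 * b₁ * (s * potentialEnergy b₁ b₂ (resolvent (w s))) := by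
    have := h.continuous_potentialEnergy
    fun_prop
  have c2 : Continuous fun s => s * virialDefect b₁ b₂ ε w n s :=
    continuous_id.mul (h.continuous_virialDefect ε)
  have hmono : ∫ s in (1 : ℝ)..t, s * (16 * E - 4 * v s) ≤
      ∫ s in (1 : ℝ)..t, (8 * b₁ * (s * potentialEnergy b₁ b₂ (resolvent (w s))) +
        s * virialDefect b₁ b₂ ε w n s) := by
    refine intervalIntegral.integral_mono_on ht ((by fun_prop : Continuous fun s =>
      s * (16 * E - 4 * v s)).intervalIntegrable 1 t) ((c1.add c2).intervalIntegrable 1 t)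
      fun s hs => ?_
    have h1 : 16 * E - 4 * v s - 8 * b₁ * potentialEnergy b₁ b₂ (resolvent (w s)) ≤
        virialDefect b₁ b₂ ε w n s := by
      rw [hE, h.energy_eq 1 s]
      exact le_max_right _ _
    nlinarith [hs.1]
  rw [intervalIntegral.integral_add (c1.intervalIntegrable 1 t) (c2.intervalIntegrable 1 t),
    hint] at hmono
  have b1 := (abs_le.mp (hξ₁.abs_re_inner_dilationOp_le hε)).1
  have b2 := (abs_le.mp (hξ.abs_re_inner_dilationOp_le hε)).2
  have b3 := hξ₁.moment_le hε
  -- Young's inequality, which replaces the nonnegativity of the square ‖(x + 2it∇)u‖².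
  have b4 : t * (4 * ∑ j, ‖ξ j‖ * ‖derivOp j (w t)‖) ≤
      ∑ j, ‖ξ j‖ ^ 2 + 4 * t ^ 2 * ∑ j, ‖derivOp j (w t)‖ ^ 2 := by
    rw [Finset.mul_sum, Finset.mul_sum, Finset.mul_sum, ← Finset.sum_add_distrib]
    refine Finset.sum_le_sum fun j _ => ?_
    nlinarith [sq_nonneg (‖ξ j‖ - 2 * t * ‖derivOp j (w t)‖)]
  have b5 : E = 1 / 2 * ∑ j, ‖derivOp j (w t)‖ ^ 2 + potentialEnergy b₁ b₂ (resolvent (w t)) := by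
    rw [hE, h.energy_eq 1 t, energy]
  have b6 := mul_le_mul_of_nonneg_left b2 (by linarith : 0 ≤ t)
  simp only [hy, hq] at hmono
  simp only [one_mul, one_pow, mul_one] at hmono
  have b7 : 8 * t ^ 2 * E = 4 * t ^ 2 * ∑ j, ‖derivOp j (w t)‖ ^ 2 +
      8 * t ^ 2 * potentialEnergy b₁ b₂ (resolvent (w t)) := by rw [b5]; ring
  linarith

/-- For fixed t, letting ε = 1/(k+1) tend to 0 removes the moment difference and the defect
integral. What remains depends on the data at time 1 only. -/
theorem IsFlow.integral_bound (h : IsFlow b₁ b₂ w n) (hb₁ : 0 ≤ b₁) (hb₂ : 0 ≤ b₂)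
    (hb : b₂ ≤ 2 + b₁) (hξ : ∀ t, ∃ ξ, IsPosition (resolvent (w t)) ξ) :
    ∃ C, 0 ≤ C ∧ ∀ t, 1 ≤ t → t ^ 2 * potentialEnergy b₁ b₂ (resolvent (w t)) ≤
      C + b₁ * ∫ s in (1 : ℝ)..t, s * potentialEnergy b₁ b₂ (resolvent (w s)) := by
  obtain ⟨ξ₁, hξ₁⟩ := hξ 1
  refine ⟨(∑ j, ‖ξ₁ j‖ ^ 2 + 4 * ∑ j, ‖ξ₁ j‖ * ‖derivOp j (w 1)‖ + 8 * energy b₁ b₂ (w 1)) / 8,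
    by have := energy_nonneg b₁ b₂ (w 1); positivity, fun t ht => ?_⟩
  obtain ⟨ξ, hξ⟩ := hξ t
  set ε : ℕ → ℝ := fun k => 1 / ((k : ℝ) + 1) with hεdef
  have hε : ∀ k, 0 < ε k := fun k => Nat.one_div_pos_of_nat
  have hε1 : ∀ k, ε k ≤ 1 := fun k => by
    rw [hεdef]; simp only
    rw [div_le_one (by positivity)]
    linarith [(Nat.cast_nonneg k : (0 : ℝ) ≤ k)]
  have hlim : Tendsto ε atTop (𝓝 0) := tendsto_one_div_add_atTop_nhds_zero_nat
  have hbound := fun k => h.regularized_bound ht hξ hξ₁ (hε k)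
  have h1 := ((((hξ.tendsto_moment hε hlim).const_sub (∑ j, ‖ξ j‖ ^ 2)).const_add
    (∑ j, ‖ξ₁ j‖ ^ 2 + 4 * ∑ j, ‖ξ₁ j‖ * ‖derivOp j (w 1)‖ + 8 * energy b₁ b₂ (w 1))).add_const
    (∫ s in (1 : ℝ)..t, 8 * b₁ * (s * potentialEnergy b₁ b₂ (resolvent (w s))))).add
    (h.tendsto_integral_virialDefect hb₁ hb₂ hb hε hε1 hlim t)
  have h2 := ge_of_tendsto' h1 hbound
  rw [intervalIntegral.integral_const_mul] at h2
  linarith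

/-- Grönwall's inequality in logarithmic time. -/
theorem le_mul_rpow_of_le_integral {g : ℝ → ℝ} (hg : Continuous g) {b C : ℝ} (hb : 0 ≤ b)
    (h : ∀ t, 1 ≤ t → t ^ 2 * g t ≤ C + b * ∫ s in (1 : ℝ)..t, s * g s) (t : ℝ) (ht : 1 ≤ t) :
    t ^ 2 * g t ≤ C * t ^ b := by
  set H := fun t : ℝ => C + b * ∫ s in (1 : ℝ)..t, s * g s with hH
  have hHd : ∀ t, HasDerivAt H (b * (t * g t)) t := fun t =>
    ((intervalIntegral.integral_hasDerivAt_right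
      ((continuous_id.mul hg).intervalIntegrable _ _)
      (continuous_id.mul hg).aestronglyMeasurable.stronglyMeasurableAtFilter
      (continuous_id.mul hg).continuousAt).const_mul b).const_add C
  -- The hypothesis gives t H' ≤ b H, hence H(t) t^(-b) is nonincreasing on [1, ∞).
  have hP : ∀ t, 1 ≤ t → HasDerivAt (fun t => H t * t ^ (-b))
      (b * (t * g t) * t ^ (-b) + H t * (-b * t ^ (-b - 1))) t := fun t ht =>
    (hHd t).mul (Real.hasDerivAt_rpow_const (Or.inl (by linarith)))
  have hanti : AntitoneOn (fun t => H t * t ^ (-b)) (Set.Ici 1) := by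
    refine antitoneOn_of_deriv_nonpos (convex_Ici 1)
      (fun t ht => (hP t ht).continuousAt.continuousWithinAt)
      (fun t ht => ?_) fun t ht => ?_
    · rw [interior_Ici] at ht
      exact (hP t (le_of_lt ht)).differentiableAt.differentiableWithinAt
    · rw [interior_Ici] at ht
      have ht1 : 1 ≤ t := le_of_lt ht
      have ht0 : 0 < t := by linarith
      rw [(hP t ht1).deriv]
      have e : t ^ (-b) = t ^ (-b - 1) * t := by
        rw [← Real.rpow_add_one ht0.ne']; congr 1; ring
      have h0 := Real.rpow_nonneg ht0.le (-b - 1)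
      rw [e]
      have : b * t ^ (-b - 1) * (t ^ 2 * g t - H t) ≤ 0 :=
        mul_nonpos_of_nonneg_of_nonpos (by positivity) (by linarith [h t ht1])
      linarith
  have h1 := hanti (Set.mem_Ici.mpr le_rfl) (Set.mem_Ici.mpr ht) ht
  have h2 : H 1 = C := by simp [hH]
  simp only [h2, Real.one_rpow, mul_one] at h1
  have ht0 : 0 < t := by linarith
  have h3 : H t ≤ C * t ^ b := by
    have := mul_le_mul_of_nonneg_right h1 (Real.rpow_nonneg ht0.le b)
    rwa [mul_assoc, ← Real.rpow_add ht0, neg_add_cancel, Real.rpow_zero, mul_one] at this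
  exact (h t ht).trans h3

theorem IsFlow.exists_potentialEnergy_le (h : IsFlow b₁ b₂ w n) (hb₁ : 0 ≤ b₁) (hb₂ : 0 ≤ b₂)
    (hb : b₂ ≤ 2 + b₁) (hξ : ∀ t, ∃ ξ, IsPosition (resolvent (w t)) ξ) :
    ∃ C, 0 ≤ C ∧ ∀ t, 1 ≤ t → potentialEnergy b₁ b₂ (resolvent (w t)) ≤ C * t ^ (b₁ - 2) := by
  obtain ⟨C, hC, hbd⟩ := h.integral_bound hb₁ hb₂ hb hξ
  refine ⟨C, hC, fun t ht => ?_⟩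
  have ht0 : 0 < t := by linarith
  have h1 := le_mul_rpow_of_le_integral h.continuous_potentialEnergy hb₁ hbd t ht
  rw [Real.rpow_sub ht0, Real.rpow_two, mul_div_assoc', le_div_iff₀ (by positivity)]
  linarith

end

section

/-! ### Quadratic phases -/

/-- The quadratic phase `e^{i s |x|²}`. -/
def chirp (s : ℝ) (x : Plane) : ℂ := Complex.exp (((s * ‖x‖ ^ 2 : ℝ) : ℂ) * Complex.I)

theorem norm_chirp (s : ℝ) (x : Plane) : ‖chirp s x‖ = 1 := Complex.norm_exp_ofReal_mul_I _

@[fun_prop]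
theorem continuous_chirp (s : ℝ) : Continuous (chirp s) := by unfold chirp; fun_prop

theorem chirp_mul_chirp_neg (s : ℝ) (x : Plane) : chirp s x * chirp (-s) x = 1 := by
  rw [chirp, chirp, ← Complex.exp_add, ← add_mul, ← Complex.ofReal_add]
  simp

theorem propagatorSymbol_eq_chirp (t : ℝ) :
    propagatorSymbol t = chirp (-(t * (2 * Real.pi) ^ 2)) := by
  funext x
  rw [propagatorSymbol, chirp]
  congr 1
  push_cast
  ring

theorem hasTemperateGrowth_exp_mul_I :
    Function.HasTemperateGrowth fun s : ℝ => Complex.exp ((s : ℂ) * Complex.I) := by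
  have hd : ∀ n, iteratedDeriv n (fun s : ℝ => Complex.exp ((s : ℂ) * Complex.I)) =
      fun s : ℝ => Complex.I ^ n * Complex.exp ((s : ℂ) * Complex.I) := by
    intro n
    induction n with
    | zero => simp
    | succ n ih =>
      rw [iteratedDeriv_succ, ih]
      funext s
      have := (((Complex.ofRealCLM.hasDerivAt (x := s)).mul_const Complex.I).cexp).const_mul
        (Complex.I ^ n)
      refine this.deriv.trans ?_
      simp only [Complex.ofRealCLM_apply, Complex.ofReal_one, one_mul]
      ring
  refine ⟨(Complex.ofRealCLM.contDiff.mul contDiff_const).cexp, fun n => ⟨0, 1, fun s => ?_⟩⟩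
  rw [norm_iteratedFDeriv_eq_norm_iteratedDeriv, hd]
  simp [Complex.norm_exp_ofReal_mul_I]

theorem hasTemperateGrowth_chirp (s : ℝ) : (chirp s).HasTemperateGrowth := by
  have h : (fun x : Plane => s * ‖x‖ ^ 2).HasTemperateGrowth := by fun_prop
  exact hasTemperateGrowth_exp_mul_I.comp h

theorem memLp_chirp (s : ℝ) : MemLp (chirp s) ∞ (volume : Measure Plane) :=
  memLp_top_of_temperate (hasTemperateGrowth_chirp s) 1 fun x => (norm_chirp s x).le

theorem norm_mulOp_chirp (s : ℝ) (f : L2) : ‖mulOp (chirp s) f‖ = ‖f‖ := by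
  refine le_antisymm (Lp.norm_le_norm_of_ae_le ?_) (Lp.norm_le_norm_of_ae_le ?_) <;>
  · filter_upwards [coeFn_mulOp (memLp_chirp s) f] with x hx
    rw [hx, norm_mul, norm_chirp, one_mul]

theorem mulOp_toLp {m : Plane → ℂ} (h : MemLp m ∞ (volume : Measure Plane))
    (hm : m.HasTemperateGrowth) (ψ : 𝓢(Plane, ℂ)) :
    mulOp m (ψ.toLp 2) = (SchwartzMap.smulLeftCLM ℂ m ψ).toLp 2 := by
  refine Lp.ext ?_
  filter_upwards [coeFn_mulOp h (ψ.toLp 2), ψ.coeFn_toLp 2,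
    (SchwartzMap.smulLeftCLM ℂ m ψ).coeFn_toLp 2] with x h1 h2 h3
  rw [h1, h2, h3, SchwartzMap.smulLeftCLM_apply_apply hm, smul_eq_mul]

theorem continuous_mulOp_chirp (f : L2) : Continuous fun s => mulOp (chirp s) f := by
  refine continuous_iff_continuousAt.mpr fun r => tendsto_iff_norm_sub_tendsto_zero.mpr ?_
  have key : Tendsto (fun s => ∫ x, ‖chirp s x - chirp r x‖ ^ 2 * ‖f x‖ ^ 2) (𝓝 r)
      (𝓝 (∫ x : Plane, (0 : ℝ))) := by
    refine tendsto_integral_filter_of_dominated_convergence (fun x => 4 * ‖f x‖ ^ 2) ?_ ?_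
      ((integrable_norm_sq f).const_mul 4) ?_
    · exact Eventually.of_forall fun s =>
        ((by fun_prop : Continuous fun x => ‖chirp s x - chirp r x‖ ^ 2).aestronglyMeasurable).mul
          ((Lp.aestronglyMeasurable f).norm.pow 2)
    · refine Eventually.of_forall fun s => Eventually.of_forall fun x => ?_
      rw [Real.norm_of_nonneg (by positivity)]
      have h := norm_sub_le (chirp s x) (chirp r x)
      rw [norm_chirp, norm_chirp] at h
      have h2 : ‖chirp s x - chirp r x‖ ^ 2 ≤ 4 := by
        nlinarith [norm_nonneg (chirp s x - chirp r x)]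
      gcongr
    · refine Eventually.of_forall fun x => ?_
      have hc : Continuous fun s => ‖chirp s x - chirp r x‖ ^ 2 * ‖f x‖ ^ 2 := by
        unfold chirp; fun_prop
      simpa using hc.tendsto r
  have h2 := (Real.continuous_sqrt.tendsto _).comp key
  simp only [integral_zero, Real.sqrt_zero] at h2
  refine h2.congr fun s => ?_
  rw [Function.comp_apply, ← Real.sqrt_sq (norm_nonneg (mulOp (chirp s) f - mulOp (chirp r) f)),
    norm_sq_eq_integral]
  congr 1
  refine integral_congr_ae ?_
  filter_upwards [coeFn_mulOp (memLp_chirp s) f, coeFn_mulOp (memLp_chirp r) f,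
    Lp.coeFn_sub (mulOp (chirp s) f) (mulOp (chirp r) f)] with x h1 h2 h3
  rw [h3, Pi.sub_apply, h1, h2, ← mul_pow, ← norm_mul, sub_mul]

theorem mulOp_chirp_zero (f : L2) : mulOp (chirp 0) f = f := by
  refine Lp.ext ?_
  filter_upwards [coeFn_mulOp (memLp_chirp 0) f] with x hx
  rw [hx]
  simp [chirp]

theorem mulOp_chirp_mulOp_chirp_neg (s : ℝ) (f : L2) :
    mulOp (chirp s) (mulOp (chirp (-s)) f) = f := by
  refine Lp.ext ?_
  filter_upwards [coeFn_mulOp (memLp_chirp s) (mulOp (chirp (-s)) f),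
    coeFn_mulOp (memLp_chirp (-s)) f] with x h1 h2
  rw [h1, h2, ← mul_assoc, chirp_mul_chirp_neg, one_mul]

/-- Since |e^{iθ} - 1| ≤ |θ|, the difference quotients are bounded by |x|²|f|, which is |g|;
dominated convergence then gives the derivative in L². -/
theorem hasDerivAt_mulOp_chirp {f g : L2}
    (hg : ∀ᵐ x : Plane, g x = Complex.I * ((‖x‖ ^ 2 : ℝ) : ℂ) * f x) (r : ℝ) :
    HasDerivAt (fun s => mulOp (chirp s) f) (mulOp (chirp r) g) r := by
  rw [hasDerivAt_iff_tendsto_slope, tendsto_iff_norm_sub_tendsto_zero]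
  have hd : ∀ x : Plane, HasDerivAt (fun s => chirp s x)
      (chirp r x * (Complex.I * ((‖x‖ ^ 2 : ℝ) : ℂ))) r := by
    intro x
    have h1 : HasDerivAt (fun s : ℝ => ((s * ‖x‖ ^ 2 : ℝ) : ℂ)) ((1 * ‖x‖ ^ 2 : ℝ) : ℂ) r :=
      ((hasDerivAt_id r).mul_const (‖x‖ ^ 2)).ofReal_comp
    refine (h1.mul_const Complex.I).cexp.congr_deriv ?_
    rw [chirp, one_mul]
    ring
  have key : Tendsto (fun s => ∫ x, ‖(slope (fun s => chirp s x) r s -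
      chirp r x * (Complex.I * ((‖x‖ ^ 2 : ℝ) : ℂ))) * f x‖ ^ 2) (𝓝[≠] r)
      (𝓝 (∫ x : Plane, (0 : ℝ))) := by
    refine tendsto_integral_filter_of_dominated_convergence (fun x => 4 * ‖g x‖ ^ 2) ?_ ?_
      ((integrable_norm_sq g).const_mul 4) ?_
    · refine Eventually.of_forall fun s => AEStronglyMeasurable.pow (AEStronglyMeasurable.norm
        (AEStronglyMeasurable.mul ?_ (Lp.aestronglyMeasurable f))) 2
      simp only [slope_def_module]
      exact (by fun_prop : Continuous fun x => (s - r)⁻¹ • (chirp s x - chirp r x) -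
        chirp r x * (Complex.I * ((‖x‖ ^ 2 : ℝ) : ℂ))).aestronglyMeasurable
    · filter_upwards [self_mem_nhdsWithin] with s hs
      filter_upwards [hg] with x hx
      rw [Real.norm_of_nonneg (by positivity), hx, norm_mul, norm_mul _ (f x), mul_pow, mul_pow]
      have hmul : ∀ A B c : ℝ, A ≤ 4 * B → A * c ^ 2 ≤ 4 * (B * c ^ 2) :=
        fun A B c h => by nlinarith [sq_nonneg c]
      refine hmul _ _ _ ?_
      have hn : ‖Complex.I * ((‖x‖ ^ 2 : ℝ) : ℂ)‖ = ‖x‖ ^ 2 := by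
        rw [norm_mul, Complex.norm_I, one_mul, Complex.norm_real, Real.norm_of_nonneg (sq_nonneg _)]
      have hs0 : 0 < |s - r| := abs_pos.mpr (sub_ne_zero.mpr hs)
      have h1 : ‖slope (fun s => chirp s x) r s‖ ≤ ‖x‖ ^ 2 := by
        rw [slope_def_module, norm_smul, norm_inv, Real.norm_eq_abs, inv_mul_le_iff₀ hs0]
        have e : chirp s x - chirp r x =
            chirp r x * (Complex.exp (Complex.I * (((s - r) * ‖x‖ ^ 2 : ℝ) : ℂ)) - 1) := by
          rw [mul_sub, mul_one, chirp, chirp, ← Complex.exp_add]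
          congr 2
          push_cast
          ring
        rw [e, norm_mul, norm_chirp, one_mul]
        refine (Real.norm_exp_I_mul_ofReal_sub_one_le (x := (s - r) * ‖x‖ ^ 2)).trans ?_
        rw [Real.norm_eq_abs, abs_mul, abs_of_nonneg (sq_nonneg ‖x‖)]
      have h2 := norm_sub_le (slope (fun s => chirp s x) r s)
        (chirp r x * (Complex.I * ((‖x‖ ^ 2 : ℝ) : ℂ)))
      rw [norm_mul, norm_chirp, one_mul, hn] at h2
      rw [hn]
      nlinarith [norm_nonneg (slope (fun s => chirp s x) r s -
        chirp r x * (Complex.I * ((‖x‖ ^ 2 : ℝ) : ℂ)))]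
    · refine Eventually.of_forall fun x => ?_
      have h1 := (hasDerivAt_iff_tendsto_slope.mp (hd x)).sub_const
        (chirp r x * (Complex.I * ((‖x‖ ^ 2 : ℝ) : ℂ)))
      have h2 := ((h1.mul_const (f x)).norm).pow 2
      simpa using h2
  have h2 := (Real.continuous_sqrt.tendsto _).comp key
  simp only [integral_zero, Real.sqrt_zero] at h2
  refine h2.congr fun s => ?_
  rw [Function.comp_apply, ← Real.sqrt_sq (norm_nonneg (slope (fun s => mulOp (chirp s) f) r s -
    mulOp (chirp r) g)), norm_sq_eq_integral]
  congr 1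
  refine integral_congr_ae ?_
  simp only [slope_def_module]
  filter_upwards [coeFn_mulOp (memLp_chirp s) f, coeFn_mulOp (memLp_chirp r) f,
    coeFn_mulOp (memLp_chirp r) g, hg, Lp.coeFn_sub (mulOp (chirp s) f) (mulOp (chirp r) f),
    Lp.coeFn_smul (s - r)⁻¹ (mulOp (chirp s) f - mulOp (chirp r) f),
    Lp.coeFn_sub ((s - r)⁻¹ • (mulOp (chirp s) f - mulOp (chirp r) f)) (mulOp (chirp r) g)]
    with x h1 h2 h3 h4 h5 h6 h7
  rw [h7, Pi.sub_apply, h6, Pi.smul_apply, h5, Pi.sub_apply, h1, h2, h3, h4, ← sub_mul, sub_mul,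
    smul_mul_assoc, mul_assoc (chirp r x)]

/-! ### Dilations -/

theorem quasiMeasurePreserving_smul_plane {r : ℝ} (hr : r ≠ 0) :
    Measure.QuasiMeasurePreserving (fun x : Plane => r • x) volume volume :=
  Measure.quasiMeasurePreserving_smul volume hr

theorem memLp_dil {r : ℝ} (hr : 0 < r) (f : L2) :
    MemLp (fun y : Plane => (r : ℂ) * f (r • y)) 2 volume := by
  refine MemLp.const_mul ?_ _
  have h1 : MemLp f 2 (Measure.map (fun x : Plane => r • x) volume) := by
    rw [Measure.map_addHaar_smul _ hr.ne']
    exact (Lp.memLp f).smul_measure ENNReal.ofReal_ne_top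
  exact (memLp_map_measure_iff h1.1 (quasiMeasurePreserving_smul_plane hr.ne').aemeasurable).mp h1

theorem norm_toLp_dil {r : ℝ} (hr : 0 < r) (f : L2) : ‖(MemLp.toLp _ (memLp_dil hr f) : L2)‖ = ‖f‖ := by
  have h : ‖(MemLp.toLp _ (memLp_dil hr f) : L2)‖ ^ 2 = ‖f‖ ^ 2 := by
    rw [norm_sq_eq_integral, norm_sq_eq_integral]
    have e : ∫ x, ‖(MemLp.toLp _ (memLp_dil hr f) : L2) x‖ ^ 2 = ∫ x : Plane, r ^ 2 * ‖f (r • x)‖ ^ 2 := by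
      refine integral_congr_ae ?_
      filter_upwards [MemLp.coeFn_toLp (memLp_dil hr f)] with x hx
      rw [hx, norm_mul, Complex.norm_real, Real.norm_of_nonneg hr.le, mul_pow]
    rw [e, integral_const_mul, Measure.integral_comp_smul volume (fun x => ‖f x‖ ^ 2) r]
    simp only [finrank_euclideanSpace, Fintype.card_fin, smul_eq_mul]
    rw [abs_of_pos (by positivity), ← mul_assoc, mul_inv_cancel₀ (by positivity), one_mul]
  exact (sq_eq_sq₀ (norm_nonneg _) (norm_nonneg _)).mp h

open Classical in
/-- The unitary dilation `f ↦ r f(r ·)` of `L²(ℝ²)`, for `r > 0`. -/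
def dil (r : ℝ) : L2 →L[ℂ] L2 :=
  if hr : 0 < r then
    LinearMap.mkContinuous
      { toFun := fun f => MemLp.toLp _ (memLp_dil hr f)
        map_add' := fun f g => by
          refine Lp.ext ?_
          filter_upwards [(memLp_dil hr (f + g)).coeFn_toLp, MemLp.coeFn_toLp (memLp_dil hr f),
            (memLp_dil hr g).coeFn_toLp, Lp.coeFn_add (MemLp.toLp _ (memLp_dil hr f)) (MemLp.toLp _ (memLp_dil hr g)),
            (quasiMeasurePreserving_smul_plane hr.ne').ae (Lp.coeFn_add f g)] with x h1 h2 h3 h4 h5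
          rw [h1, h4, Pi.add_apply, h2, h3, h5, Pi.add_apply, mul_add]
        map_smul' := fun c f => by
          refine Lp.ext ?_
          filter_upwards [(memLp_dil hr (c • f)).coeFn_toLp, MemLp.coeFn_toLp (memLp_dil hr f),
            Lp.coeFn_smul c (MemLp.toLp _ (memLp_dil hr f)),
            (quasiMeasurePreserving_smul_plane hr.ne').ae (Lp.coeFn_smul c f)] with x h1 h2 h3 h4
          rw [h1, RingHom.id_apply, h3, Pi.smul_apply, h2, h4, Pi.smul_apply, smul_eq_mul,
            smul_eq_mul]
          ring } 1
      fun f => by rw [one_mul]; exact (norm_toLp_dil hr f).le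
  else 0

theorem coeFn_dil {r : ℝ} (hr : 0 < r) (f : L2) : ∀ᵐ y : Plane, dil r f y = r * f (r • y) := by
  rw [dil, dif_pos hr]
  exact MemLp.coeFn_toLp (memLp_dil hr f)

theorem norm_dil {r : ℝ} (hr : 0 < r) (f : L2) : ‖dil r f‖ = ‖f‖ := by
  rw [dil, dif_pos hr]
  exact norm_toLp_dil hr f

/-! ### The integral kernel of the free propagator -/

/-- The Fourier transform is moved from ψ onto the Gaussian. The prefactor is (π/b)^(d/2) with d =
2. -/
theorem integral_gaussian_mul_fourier {b : ℂ} (hb : 0 < b.re) (x : Plane) (ψ : 𝓢(Plane, ℂ)) :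
    ∫ ξ, Complex.exp (-b * ‖ξ‖ ^ 2 + 2 * Real.pi * Complex.I * inner ℝ x ξ) * (𝓕 ψ : 𝓢(Plane, ℂ)) ξ =
      Real.pi / b * ∫ z, Complex.exp (-Real.pi ^ 2 * ‖x - z‖ ^ 2 / b) * ψ z := by
  have J : Integrable fun ξ : Plane =>
      Complex.exp (-b * ‖ξ‖ ^ 2 + 2 * Real.pi * Complex.I * inner ℝ x ξ) :=
    GaussianFourier.integrable_cexp_neg_mul_sq_norm_add hb _ _
  have h := (VectorFourier.integral_fourierIntegral_smul_eq_flip (L := innerₗ Plane)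
      Real.continuous_fourierChar continuous_inner J (ψ.integrable (μ := volume))).symm
  rw [← integral_const_mul]
  simp only [smul_eq_mul] at h
  refine Eq.trans ?_ (h.trans ?_)
  · refine integral_congr_ae (Eventually.of_forall fun ξ => ?_)
    simp only [SchwartzMap.fourier_coe, flip_innerₗ]
    rfl
  · refine integral_congr_ae (Eventually.of_forall fun z => ?_)
    have e : 𝓕 (fun ξ : Plane => Complex.exp (-b * ‖ξ‖ ^ 2 + 2 * Real.pi * Complex.I * inner ℝ x ξ)) z =
        Real.pi / b * Complex.exp (-Real.pi ^ 2 * ‖x - z‖ ^ 2 / b) := by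
      rw [fourier_gaussian_innerProductSpace' hb x z]
      congr 1
      simp
    simp only
    rw [← mul_assoc, ← e]
    rfl

/-- The oscillatory symbol is the boundary value of Gaussians with parameter ε + 4π²it as ε
decreases to 0. Both integrals converge because the integrands are dominated by |𝓕ψ| and |ψ|. -/
theorem integral_propagatorSymbol_mul_fourier {t : ℝ} (ht : 0 < t) (x : Plane) (ψ : 𝓢(Plane, ℂ)) :
    ∫ ξ, Complex.exp (2 * Real.pi * Complex.I * inner ℝ x ξ) *
      (propagatorSymbol t ξ * (𝓕 ψ : 𝓢(Plane, ℂ)) ξ) =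
      1 / (4 * Real.pi * Complex.I * t) * ∫ z, chirp (1 / (4 * t)) (x - z) * ψ z := by
  set b : ℝ → ℂ := fun ε => ε + 4 * Real.pi ^ 2 * t * Complex.I with hb
  have hre : ∀ ε, (b ε).re = ε := fun ε => by simp [hb, ← Complex.ofReal_pow]
  have hb0 : b 0 ≠ 0 := by
    simp [hb, Real.pi_ne_zero, ht.ne']
  have hbc : Continuous b := by fun_prop
  have h1 : Tendsto (fun ε => ∫ ξ, Complex.exp (-(b ε) * ‖ξ‖ ^ 2 +
      2 * Real.pi * Complex.I * inner ℝ x ξ) * (𝓕 ψ : 𝓢(Plane, ℂ)) ξ) (𝓝[>] 0)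
      (𝓝 (∫ ξ, Complex.exp (-(b 0) * ‖ξ‖ ^ 2 +
      2 * Real.pi * Complex.I * inner ℝ x ξ) * (𝓕 ψ : 𝓢(Plane, ℂ)) ξ)) := by
    refine tendsto_integral_filter_of_dominated_convergence (fun ξ => ‖(𝓕 ψ : 𝓢(Plane, ℂ)) ξ‖)
      (Eventually.of_forall fun ε => (by fun_prop : Continuous _).aestronglyMeasurable) ?_
      (𝓕 ψ : 𝓢(Plane, ℂ)).integrable.norm (Eventually.of_forall fun ξ => ?_)
    · filter_upwards [self_mem_nhdsWithin] with ε hε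
      refine Eventually.of_forall fun ξ => ?_
      rw [norm_mul, Complex.norm_exp]
      refine mul_le_of_le_one_left (norm_nonneg _) (Real.exp_le_one_iff.mpr ?_)
      have e : (-(b ε) * ‖ξ‖ ^ 2 + 2 * Real.pi * Complex.I * inner ℝ x ξ : ℂ).re =
          -(ε * ‖ξ‖ ^ 2) := by
        rw [← Complex.ofReal_pow, Complex.add_re, Complex.re_mul_ofReal, Complex.neg_re, hre]
        simp
      rw [e]
      have := mul_nonneg (le_of_lt hε) (sq_nonneg ‖ξ‖)
      linarith
    · exact ((by fun_prop : Continuous fun ε => Complex.exp (-(b ε) * ‖ξ‖ ^ 2 +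
        2 * Real.pi * Complex.I * inner ℝ x ξ) * (𝓕 ψ : 𝓢(Plane, ℂ)) ξ).tendsto 0).mono_left
          nhdsWithin_le_nhds
  have h2 : Tendsto (fun ε => Real.pi / b ε * ∫ z, Complex.exp (-Real.pi ^ 2 * ‖x - z‖ ^ 2 / b ε) *
      ψ z) (𝓝[>] 0) (𝓝 (Real.pi / b 0 * ∫ z, Complex.exp (-Real.pi ^ 2 * ‖x - z‖ ^ 2 / b 0) *
      ψ z)) := by
    refine Tendsto.mul ((tendsto_const_nhds.div (hbc.tendsto 0) hb0).mono_left nhdsWithin_le_nhds) ?_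
    refine tendsto_integral_filter_of_dominated_convergence (fun ξ => ‖ψ ξ‖)
      (Eventually.of_forall fun ε => (by fun_prop : Continuous _).aestronglyMeasurable) ?_
      ψ.integrable.norm (Eventually.of_forall fun z => ?_)
    · filter_upwards [self_mem_nhdsWithin] with ε hε
      refine Eventually.of_forall fun z => ?_
      rw [norm_mul, Complex.norm_exp]
      refine mul_le_of_le_one_left (norm_nonneg _) (Real.exp_le_one_iff.mpr ?_)
      have e : (-Real.pi ^ 2 * ‖x - z‖ ^ 2 / b ε : ℂ) =
          ((-(Real.pi ^ 2 * ‖x - z‖ ^ 2) : ℝ) : ℂ) * (b ε)⁻¹ := by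
        push_cast; ring
      rw [e, Complex.re_ofReal_mul, Complex.inv_re, hre]
      have : 0 ≤ Real.pi ^ 2 * ‖x - z‖ ^ 2 * (ε / Complex.normSq (b ε)) := by
        have := Complex.normSq_nonneg (b ε)
        have := le_of_lt (Set.mem_Ioi.mp hε)
        positivity
      linarith
    · refine Tendsto.mul_const _ ((Complex.continuous_exp.tendsto _).comp ?_)
      exact (tendsto_const_nhds.div (hbc.tendsto 0) hb0).mono_left nhdsWithin_le_nhds
  have h3 := tendsto_nhds_unique h1 (h2.congr' (by
    filter_upwards [self_mem_nhdsWithin] with ε hε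
    exact (integral_gaussian_mul_fourier (by rw [hre]; exact hε) x ψ).symm))
  have eb : b 0 = 4 * Real.pi ^ 2 * t * Complex.I := by simp [hb]
  have hpi : (Real.pi : ℂ) ≠ 0 := by exact_mod_cast Real.pi_ne_zero
  have htc : (t : ℂ) ≠ 0 := by exact_mod_cast ht.ne'
  refine Eq.trans ?_ (h3.trans ?_)
  · refine integral_congr_ae (Eventually.of_forall fun ξ => ?_)
    simp only
    rw [← mul_assoc, propagatorSymbol, ← Complex.exp_add, eb]
    congr 2
    push_cast
    ring
  · congr 1
    · rw [eb]; field_simp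
    · refine integral_congr_ae (Eventually.of_forall fun z => ?_)
      simp only
      rw [chirp, eb]
      congr 2
      push_cast
      field_simp
      rw [Complex.I_sq]
      ring

/-! ### The lens transform -/

theorem propagator_eq_multiplier (t : ℝ) (f : L2) :
    propagator t f = multiplier (propagatorSymbol t) f := by
  rw [multiplier_apply, mulOp_eq (memLp_propagatorSymbol t)]
  rfl

theorem norm_propagator (t : ℝ) (f : L2) : ‖propagator t f‖ = ‖f‖ := by
  rw [propagator_eq_multiplier, multiplier_apply, propagatorSymbol_eq_chirp]
  have h : ∀ g : L2, ‖𝓕⁻ g‖ = ‖g‖ := (Lp.fourierTransformₗᵢ Plane ℂ).symm.norm_map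
  rw [h, norm_mulOp_chirp, Lp.norm_fourier_eq]

theorem propagator_toLp (t : ℝ) (ψ : 𝓢(Plane, ℂ)) :
    propagator t (ψ.toLp 2) = (SchwartzMap.fourierMultiplierCLM ℂ (propagatorSymbol t) ψ).toLp 2 := by
  have hr : (propagatorSymbol t).HasTemperateGrowth := by
    rw [propagatorSymbol_eq_chirp]; exact hasTemperateGrowth_chirp _
  apply coe_injective
  rw [propagator_eq_multiplier, coe_multiplier (memLp_propagatorSymbol t) hr,
    Lp.toTemperedDistribution_toLp_eq,
    TemperedDistribution.fourierMultiplierCLM_toTemperedDistributionCLM_eq hr,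
    Lp.toTemperedDistribution_toLp_eq]

theorem propagator_schwartz_apply {t : ℝ} (ht : 0 < t) (ψ : 𝓢(Plane, ℂ)) (x : Plane) :
    SchwartzMap.fourierMultiplierCLM ℂ (propagatorSymbol t) ψ x =
      1 / (4 * Real.pi * Complex.I * t) * ∫ z, chirp (1 / (4 * t)) (x - z) * ψ z := by
  have hr : (propagatorSymbol t).HasTemperateGrowth := by
    rw [propagatorSymbol_eq_chirp]; exact hasTemperateGrowth_chirp _
  rw [← integral_propagatorSymbol_mul_fourier ht, SchwartzMap.fourierMultiplierCLM_apply,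
    SchwartzMap.fourierInv_coe, Real.fourierInv_eq']
  refine integral_congr_ae (Eventually.of_forall fun ξ => ?_)
  simp only
  rw [SchwartzMap.smulLeftCLM_apply_apply hr, smul_eq_mul, smul_eq_mul, real_inner_comm]
  congr 2
  push_cast
  ring

/-- The lens transform: a quadratic phase followed by a dilation. -/
def lens (t : ℝ) : L2 →L[ℂ] L2 := dil t ∘L mulOp (chirp (-(1 / (4 * t))))

theorem coeFn_lens {t : ℝ} (ht : 0 < t) (f : L2) :
    ∀ᵐ y : Plane, lens t f y = t * (chirp (-(t / 4)) y * f (t • y)) := by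
  filter_upwards [coeFn_dil ht (mulOp (chirp (-(1 / (4 * t)))) f),
    (quasiMeasurePreserving_smul_plane ht.ne').ae (coeFn_mulOp (memLp_chirp (-(1 / (4 * t)))) f)]
    with y h1 h2
  rw [lens, ContinuousLinearMap.comp_apply, h1, h2, chirp, chirp, norm_smul, mul_pow,
    Real.norm_eq_abs, sq_abs]
  have e : -(1 / (4 * t)) * (t ^ 2 * ‖y‖ ^ 2) = -(t / 4) * ‖y‖ ^ 2 := by field_simp
  rw [e]

theorem norm_lens {t : ℝ} (ht : 0 < t) (f : L2) : ‖lens t f‖ = ‖f‖ := by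
  rw [lens, ContinuousLinearMap.comp_apply, norm_dil ht, norm_mulOp_chirp]

/-- Expand |ty - z|²/(4t) = t|y|²/4 - y·z/2 + |z|²/(4t). The lens phase cancels the first term, the
second is the Fourier kernel at y/(4π), and the third is the phase put on ψ. -/
theorem lens_propagator_apply {t : ℝ} (ht : 0 < t) (ψ : 𝓢(Plane, ℂ)) (y : Plane) :
    t * (chirp (-(t / 4)) y * SchwartzMap.fourierMultiplierCLM ℂ (propagatorSymbol t) ψ (t • y)) =
      -Complex.I * ((1 / (4 * Real.pi) : ℝ) *
        (𝓕 (SchwartzMap.smulLeftCLM ℂ (chirp (1 / (4 * t))) ψ) : 𝓢(Plane, ℂ))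
          ((1 / (4 * Real.pi)) • y)) := by
  have htc : (t : ℂ) ≠ 0 := by exact_mod_cast ht.ne'
  have hpi : (Real.pi : ℂ) ≠ 0 := by exact_mod_cast Real.pi_ne_zero
  rw [propagator_schwartz_apply ht, SchwartzMap.fourier_coe, Real.fourier_eq']
  have e : (∫ z, chirp (1 / (4 * t)) (t • y - z) * ψ z) = chirp (t / 4) y *
      ∫ z, Complex.exp (((-2 * Real.pi * inner ℝ z ((1 / (4 * Real.pi)) • y) : ℝ) : ℂ) * Complex.I) •
        SchwartzMap.smulLeftCLM ℂ (chirp (1 / (4 * t))) ψ z := by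
    rw [← integral_const_mul]
    refine integral_congr_ae (Eventually.of_forall fun z => ?_)
    simp only
    rw [SchwartzMap.smulLeftCLM_apply_apply (hasTemperateGrowth_chirp _), smul_eq_mul, smul_eq_mul,
      ← mul_assoc, ← mul_assoc]
    congr 1
    rw [chirp, chirp, chirp, ← Complex.exp_add, ← Complex.exp_add, ← add_mul, ← add_mul,
      ← Complex.ofReal_add, ← Complex.ofReal_add]
    congr 3
    rw [norm_sub_sq_real, norm_smul, inner_smul_left, inner_smul_right, real_inner_comm, mul_pow,
      Real.norm_eq_abs, sq_abs]
    simp only [conj_trivial]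
    have := Real.pi_ne_zero
    field_simp
    ring
  rw [e]
  have hc := chirp_mul_chirp_neg (t / 4) y
  set A := ∫ z, Complex.exp (((-2 * Real.pi * inner ℝ z ((1 / (4 * Real.pi)) • y) : ℝ) : ℂ) *
    Complex.I) • SchwartzMap.smulLeftCLM ℂ (chirp (1 / (4 * t))) ψ z
  have h2 : (t : ℂ) * (chirp (-(t / 4)) y * (1 / (4 * Real.pi * Complex.I * t) *
      (chirp (t / 4) y * A))) = (chirp (t / 4) y * chirp (-(t / 4)) y) *
        ((t : ℂ) * (1 / (4 * Real.pi * Complex.I * t)) * A) := by ring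
  rw [h2, hc, one_mul]
  clear_value A
  have h3 : (t : ℂ) * (1 / (4 * Real.pi * Complex.I * t)) = -Complex.I * (1 / (4 * Real.pi)) := by
    field_simp
    rw [Complex.I_sq, neg_neg]
  rw [h3]
  push_cast
  ring

/-- In lens variables the free flow is a fixed unitary map applied to e^{i|x|²/4t} f, and that phase
tends strongly to 1. This is why scattering becomes convergence of `lens t (u t)`. -/
theorem lens_propagator {t : ℝ} (ht : 0 < t) (f : L2) : lens t (propagator t f) =
    (-Complex.I) • dil (1 / (4 * Real.pi)) (𝓕 (mulOp (chirp (1 / (4 * t))) f)) := by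
  have hpi : 0 < 1 / (4 * Real.pi) := by positivity
  have hF : Continuous fun f : L2 => 𝓕 f := (Lp.fourierTransformₗᵢ Plane ℂ).continuous
  have hm : Continuous (multiplier (propagatorSymbol t)) := (multiplier _).continuous
  refine l2_induction (p := fun f => lens t (propagator t f) =
    (-Complex.I) • dil (1 / (4 * Real.pi)) (𝓕 (mulOp (chirp (1 / (4 * t))) f))) ?_ (fun ψ => ?_) f
  · simp only [propagator_eq_multiplier]
    exact isClosed_eq (by fun_prop) (by fun_prop)
  · rw [propagator_toLp, mulOp_toLp (memLp_chirp _) (hasTemperateGrowth_chirp _),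
      SchwartzMap.toLp_fourier_eq]
    refine Lp.ext ?_
    filter_upwards [coeFn_lens ht ((SchwartzMap.fourierMultiplierCLM ℂ (propagatorSymbol t) ψ).toLp 2),
      (quasiMeasurePreserving_smul_plane ht.ne').ae
        ((SchwartzMap.fourierMultiplierCLM ℂ (propagatorSymbol t) ψ).coeFn_toLp 2 volume),
      Lp.coeFn_smul (-Complex.I) (dil (1 / (4 * Real.pi)) ((𝓕 (SchwartzMap.smulLeftCLM ℂ
        (chirp (1 / (4 * t))) ψ) : 𝓢(Plane, ℂ)).toLp 2)),
      coeFn_dil hpi ((𝓕 (SchwartzMap.smulLeftCLM ℂ (chirp (1 / (4 * t))) ψ) : 𝓢(Plane, ℂ)).toLp 2),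
      (quasiMeasurePreserving_smul_plane hpi.ne').ae
        ((𝓕 (SchwartzMap.smulLeftCLM ℂ (chirp (1 / (4 * t))) ψ) : 𝓢(Plane, ℂ)).coeFn_toLp 2 volume)]
      with y h1 h2 h3 h4 h5
    rw [h1, h2, h3, Pi.smul_apply, h4, h5, smul_eq_mul]
    exact lens_propagator_apply ht ψ y

/-- The lens transform of a solution that scatters has a limit, with the norm of the asymptotic
state. -/
theorem ScattersTo.exists_tendsto_lens {u : ℝ → L2} {φp φm : L2} (h : ScattersTo u φp φm) :
    ∃ W : L2, ‖W‖ = ‖φp‖ ∧ Tendsto (fun t => lens t (u t)) atTop (𝓝 W) := by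
  have hpi : 0 < 1 / (4 * Real.pi) := by positivity
  have hF : Continuous fun f : L2 => 𝓕 f := (Lp.fourierTransformₗᵢ Plane ℂ).continuous
  refine ⟨(-Complex.I) • dil (1 / (4 * Real.pi)) (𝓕 φp), ?_, ?_⟩
  · rw [norm_smul, norm_dil hpi, Lp.norm_fourier_eq]; simp
  have h1 : Tendsto (fun t : ℝ => 1 / (4 * t)) atTop (𝓝 0) := by
    have := (tendsto_inv_atTop_zero (𝕜 := ℝ)).const_mul (1 / 4)
    simp only [mul_zero] at this
    refine this.congr fun t => ?_
    ring
  have hch : Tendsto (fun s => mulOp (chirp s) φp) (𝓝 0) (𝓝 φp) := by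
    simpa only [mulOp_chirp_zero] using (continuous_mulOp_chirp φp).tendsto 0
  have h2 : Tendsto (fun t : ℝ => (-Complex.I) • dil (1 / (4 * Real.pi))
      (𝓕 (mulOp (chirp (1 / (4 * t))) φp))) atTop
      (𝓝 ((-Complex.I) • dil (1 / (4 * Real.pi)) (𝓕 φp))) :=
    ((((by fun_prop : Continuous fun f : L2 => (-Complex.I) • dil (1 / (4 * Real.pi)) (𝓕 f)).tendsto
      φp)).comp hch).comp h1
  have h3 : Tendsto (fun t => lens t (u t) - lens t (propagator t φp)) atTop (𝓝 0) := by
    rw [tendsto_zero_iff_norm_tendsto_zero]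
    refine h.1.congr' ?_
    filter_upwards [eventually_gt_atTop 0] with t ht
    rw [← map_sub, norm_lens ht]
  have h4 := h3.add h2
  rw [zero_add] at h4
  refine h4.congr' ?_
  filter_upwards [eventually_gt_atTop 0] with t ht
  rw [lens_propagator ht, sub_add_cancel]

end

section

variable {b₁ b₂ : ℝ} {w n : ℝ → L2}

/-! ### The interaction picture -/

theorem inner_map_map_of_norm_map (A : L2 →L[ℂ] L2) (h : ∀ f, ‖A f‖ = ‖f‖) (f g : L2) :
    inner ℂ (A f) (A g) = inner ℂ f g :=
  (⟨A.toLinearMap, h⟩ : L2 →ₗᵢ[ℂ] L2).inner_map_map f g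

theorem inner_propagator (t : ℝ) (f g : L2) :
    inner ℂ (propagator t f) (propagator t g) = inner ℂ f g := by
  rw [propagator_eq_multiplier, propagator_eq_multiplier]
  exact inner_map_map_of_norm_map _
    (fun f => by rw [← propagator_eq_multiplier, norm_propagator]) f g

theorem propagator_propagator_neg (t : ℝ) (f : L2) : propagator t (propagator (-t) f) = f := by
  rw [propagator_eq_multiplier, propagator_eq_multiplier, multiplier_apply, multiplier_apply,
    FourierTransform.fourier_fourierInv_eq, propagatorSymbol_eq_chirp, propagatorSymbol_eq_chirp,
    neg_mul, mulOp_chirp_mulOp_chirp_neg, FourierTransform.fourierInv_fourier_eq]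

theorem propagator_neg_eq (t : ℝ) (f : L2) :
    propagator (-t) f = (Lp.fourierTransformₗᵢ Plane ℂ).symm
      (mulOp (chirp ((2 * Real.pi) ^ 2 * t)) (𝓕 f)) := by
  rw [propagator_eq_multiplier, multiplier_apply, propagatorSymbol_eq_chirp, neg_mul, neg_neg,
    mul_comm t]
  rfl

theorem continuous_propagator_neg (f : L2) : Continuous fun t => propagator (-t) f := by
  simp only [propagator_neg_eq]
  exact (Lp.fourierTransformₗᵢ Plane ℂ).symm.continuous.comp
    ((continuous_mulOp_chirp (𝓕 f)).comp (by fun_prop))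

theorem hasDerivAt_propagator_neg (w : L2) (t : ℝ) :
    HasDerivAt (fun t => propagator (-t) (resolvent w))
      (propagator (-t) ((-Complex.I) • laplacianOp w)) t := by
  have hpi : ((2 * Real.pi) ^ 2 : ℝ) ≠ 0 := by positivity
  have hg : ∀ᵐ ξ : Plane, ((((2 * Real.pi) ^ 2 : ℝ) : ℂ)⁻¹ • 𝓕 ((-Complex.I) • laplacianOp w) : L2) ξ =
      Complex.I * ((‖ξ‖ ^ 2 : ℝ) : ℂ) * (𝓕 (resolvent w) : L2) ξ := by
    have e1 : (𝓕 (resolvent w) : L2) = mulOp resolventSymbol (𝓕 w) := by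
      rw [resolvent, multiplier_apply, FourierTransform.fourier_fourierInv_eq]
    have e2 : (𝓕 ((-Complex.I) • laplacianOp w) : L2) =
        (-Complex.I) • mulOp laplacianSymbol (𝓕 w) := by
      rw [FourierTransform.fourier_smul, laplacianOp, multiplier_apply,
        FourierTransform.fourier_fourierInv_eq]
    rw [e1, e2]
    filter_upwards [coeFn_mulOp memLp_resolventSymbol (𝓕 w),
      coeFn_mulOp memLp_laplacianSymbol (𝓕 w),
      Lp.coeFn_smul (-Complex.I) (mulOp laplacianSymbol (𝓕 w)),
      Lp.coeFn_smul (((2 * Real.pi) ^ 2 : ℝ) : ℂ)⁻¹ ((-Complex.I) • mulOp laplacianSymbol (𝓕 w))]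
      with ξ h1 h2 h3 h4
    rw [h4, Pi.smul_apply, h3, Pi.smul_apply, h2, h1, laplacianSymbol, smul_eq_mul, smul_eq_mul]
    have : (((2 * Real.pi) ^ 2 : ℝ) : ℂ) ≠ 0 := by exact_mod_cast hpi
    rw [inv_mul_eq_iff_eq_mul₀ this]
    push_cast
    ring
  have h1 := hasDerivAt_mulOp_chirp hg ((2 * Real.pi) ^ 2 * t)
  have h2 : HasDerivAt (fun t : ℝ => (2 * Real.pi) ^ 2 * t) ((2 * Real.pi) ^ 2) t := by
    simpa using (hasDerivAt_id t).const_mul ((2 * Real.pi) ^ 2)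
  have h3 := h1.scomp t h2
  have h4 := (((Lp.fourierTransformₗᵢ Plane ℂ).symm : L2 →L[ℂ] L2).restrictScalars
    ℝ).hasFDerivAt.comp_hasDerivAt t h3
  simp only [propagator_neg_eq]
  refine h4.congr_deriv ?_
  have e : ((2 * Real.pi) ^ 2 : ℝ) • mulOp (chirp ((2 * Real.pi) ^ 2 * t))
      ((((2 * Real.pi) ^ 2 : ℝ) : ℂ)⁻¹ • 𝓕 ((-Complex.I) • laplacianOp w)) =
      mulOp (chirp ((2 * Real.pi) ^ 2 * t)) (𝓕 ((-Complex.I) • laplacianOp w)) := by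
    rw [map_smul, RCLike.real_smul_eq_coe_smul (K := ℂ), smul_smul]
    have : (((2 * Real.pi) ^ 2 : ℝ) : ℂ) ≠ 0 := by exact_mod_cast hpi
    erw [mul_inv_cancel₀ this]
    rw [one_smul]
  rw [e]
  rfl

/-- Split e^{-isΔ}u(s) into e^{-isΔ}(u(s) - u(t)) + e^{-isΔ}u(t). Isometry and strong continuity
give the first derivative, and the Laplacian cancels against the second, leaving the force. -/
theorem IsFlow.hasDerivAt_propagator_neg (h : IsFlow b₁ b₂ w n) (t : ℝ) :
    HasDerivAt (fun t => propagator (-t) (resolvent (w t)))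
      (propagator (-t) ((-Complex.I) • n t)) t := by
  have hP : ∀ t f g, propagator t (f - g) = propagator t f - propagator t g := fun t f g => by
    simp only [propagator_eq_multiplier, map_sub]
  have h1 : HasDerivAt (fun s => propagator (-s) (resolvent (w s)) - propagator (-s)
      (resolvent (w t))) (propagator (-t) (Complex.I • (laplacianOp (w t) - n t))) t := by
    rw [hasDerivAt_iff_tendsto_slope]
    have hu := hasDerivAt_iff_tendsto_slope.mp (h.hasDerivAt t)
    have h2 : Tendsto (fun s => propagator (-s) (slope (fun t => resolvent (w t)) t s -
        Complex.I • (laplacianOp (w t) - n t))) (𝓝[≠] t) (𝓝 0) := by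
      rw [tendsto_zero_iff_norm_tendsto_zero]
      simp only [norm_propagator]
      exact tendsto_iff_norm_sub_tendsto_zero.mp hu
    have h3 := h2.add (((continuous_propagator_neg (Complex.I • (laplacianOp (w t) - n t))).tendsto
      t).mono_left nhdsWithin_le_nhds)
    rw [zero_add] at h3
    refine h3.congr fun s => ?_
    rw [hP, sub_add_cancel, slope_def_module, slope_def_module, sub_self, sub_zero, ← hP,
      propagator_eq_multiplier, propagator_eq_multiplier]
    exact ((multiplier (propagatorSymbol (-s))).restrictScalars ℝ).map_smul _ _
  have h2 := h1.add (ICQNLS.hasDerivAt_propagator_neg (w t) t)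
  refine (h2.congr_deriv ?_).congr_of_eventuallyEq (Eventually.of_forall fun s => ?_)
  · simp only [propagator_eq_multiplier]
    rw [← map_add]
    congr 1
    rw [smul_sub, neg_smul, neg_smul]
    abel
  · simp

/-- The pairing of a flow with a free solution whose lens transform is constant. -/
def lensPairing (χ : L2) (w : ℝ → L2) (t : ℝ) : ℂ :=
  inner ℂ (mulOp (chirp (-(1 / (4 * t)))) χ) (propagator (-t) (resolvent (w t)))

theorem norm_lensPairing_le (χ : L2) (w : ℝ → L2) (t : ℝ) :
    ‖lensPairing χ w t‖ ≤ ‖χ‖ * ‖resolvent (w t)‖ := by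
  refine (norm_inner_le_norm _ _).trans ?_
  rw [norm_mulOp_chirp, norm_propagator]

/-- The propagator and the lens transform are isometric. The phase on χ is chosen to undo the one in
`lens_propagator`, so the test function on the right does not depend on t. -/
theorem inner_mulOp_chirp_propagator_neg {t : ℝ} (ht : 0 < t) (χ f : L2) :
    inner ℂ (mulOp (chirp (-(1 / (4 * t)))) χ) (propagator (-t) ((-Complex.I) • f)) =
      inner ℂ (dil (1 / (4 * Real.pi)) (𝓕 χ)) (lens t f) := by
  rw [← inner_propagator t, propagator_propagator_neg, ← inner_map_map_of_norm_map (lens t)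
    (norm_lens ht), lens_propagator ht, mulOp_chirp_mulOp_chirp_neg, map_smul, inner_smul_left,
    inner_smul_right]
  simp [← mul_assoc]

/-- The error `e` comes from differentiating the phase -1/(4t): its derivative 1/(4t²) is integrable
at infinity, and χ₂ supplies the factor |x|². -/
theorem IsFlow.hasDerivAt_lensPairing (h : IsFlow b₁ b₂ w n) {χ χ₂ : L2}
    (hχ : ∀ᵐ x : Plane, χ₂ x = Complex.I * ((‖x‖ ^ 2 : ℝ) : ℂ) * χ x) {t : ℝ} (ht : 0 < t) :
    ∃ e : ℂ, ‖e‖ ≤ ‖χ₂‖ * ‖resolvent (w 0)‖ / t ^ 2 ∧ HasDerivAt (lensPairing χ w)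
      (inner ℂ (dil (1 / (4 * Real.pi)) (𝓕 χ)) (lens t (n t)) + e) t := by
  have h1 : HasDerivAt (fun t : ℝ => -(1 / (4 * t))) (1 / (4 * t ^ 2)) t := by
    have := ((hasDerivAt_inv ht.ne').const_mul (1 / 4)).neg
    refine (this.congr_deriv ?_).congr_of_eventuallyEq (Eventually.of_forall fun s => ?_)
    · field_simp
    · simp only [Pi.neg_apply]; ring
  have h2 := (hasDerivAt_mulOp_chirp hχ (-(1 / (4 * t)))).scomp t h1
  have h3 := HasDerivAt.inner ℂ h2 (h.hasDerivAt_propagator_neg t)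
  refine ⟨_, ?_, (h3.congr_deriv (by rw [← inner_mulOp_chirp_propagator_neg ht]; rfl))⟩
  refine (norm_inner_le_norm _ _).trans ?_
  rw [norm_smul, norm_mulOp_chirp, norm_propagator, h.norm_eq t 0, Real.norm_of_nonneg (by positivity),
    mul_assoc, div_mul_eq_mul_div, one_mul]
  have : 0 ≤ ‖χ₂‖ * ‖resolvent (w 0)‖ := by positivity
  gcongr
  nlinarith [sq_nonneg t]

end

section

/-! ### Passing to the limit in power nonlinearities -/

/-- The power nonlinearity `|a|^{2p} a`. -/
def powFun (p : ℕ) (a : ℂ) : ℂ := ((‖a‖ ^ (2 * p) : ℝ) : ℂ) * a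

@[fun_prop]
theorem continuous_powFun (p : ℕ) : Continuous (powFun p) := by unfold powFun; fun_prop

/-- If d ≤ η r², the first term suffices. Otherwise η r² < d ≤ 2r forces r ≤ 2/η, and r² ≤ d/η gives
the second factor d. -/
theorem pow_mul_le_add {r d η : ℝ} (hd : 0 ≤ d) (hdr : d ≤ 2 * r) (hη : 0 < η) (k : ℕ) :
    r ^ (2 * (k + 1)) * d ≤ η * r ^ (2 * k + 4) + (2 / η) ^ (2 * k) / η * d ^ 2 := by
  have hr : 0 ≤ r := by linarith
  rcases le_or_gt d (η * r ^ 2) with h | h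
  · have h1 : r ^ (2 * (k + 1)) * d ≤ r ^ (2 * (k + 1)) * (η * r ^ 2) := by gcongr
    have h2 : r ^ (2 * (k + 1)) * (η * r ^ 2) = η * r ^ (2 * k + 4) := by ring
    have h3 : 0 ≤ (2 / η) ^ (2 * k) / η * d ^ 2 := by positivity
    linarith
  · have hr0 : 0 < r := by
      rcases hr.eq_or_lt with rfl | h0
      · norm_num at h hdr; linarith
      · exact h0
    have h1 : r ≤ 2 / η := by
      rw [le_div_iff₀ hη]
      have : r * (η * r) ≤ r * 2 := by nlinarith
      linarith [le_of_mul_le_mul_left this hr0]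
    have h2 : r ^ 2 ≤ d / η := by rw [le_div_iff₀ hη]; linarith
    calc r ^ (2 * (k + 1)) * d = r ^ (2 * k) * r ^ 2 * d := by ring
      _ ≤ (2 / η) ^ (2 * k) * (d / η) * d := by gcongr
      _ = (2 / η) ^ (2 * k) / η * d ^ 2 := by ring
      _ ≤ _ := le_add_of_nonneg_left (by positivity)

/-- Interpolates between a small multiple of the higher power, controlled by the energy, and a large
multiple of |a - b|², which vanishes under L² convergence. -/
theorem norm_powFun_sub_le (k : ℕ) (a b : ℂ) {η : ℝ} (hη : 0 < η) :
    ‖powFun (k + 1) a - powFun (k + 1) b‖ ≤ (2 * (k + 1 : ℕ) + 1) *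
      (η * (‖a‖ ^ (2 * k + 4) + ‖b‖ ^ (2 * k + 4)) + (2 / η) ^ (2 * k) / η * ‖a - b‖ ^ 2) := by
  set r := max ‖a‖ ‖b‖ with hr
  have h1 := norm_pow_mul_sub_le (k + 1) (le_max_left ‖a‖ ‖b‖) (le_max_right ‖a‖ ‖b‖)
  rw [← hr] at h1
  have h2 : ‖a - b‖ ≤ 2 * r := by
    have := norm_sub_le a b
    linarith [le_max_left ‖a‖ ‖b‖, le_max_right ‖a‖ ‖b‖]
  have h3 := pow_mul_le_add (norm_nonneg (a - b)) h2 hη k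
  have h4 : r ^ (2 * k + 4) ≤ ‖a‖ ^ (2 * k + 4) + ‖b‖ ^ (2 * k + 4) := by
    rcases max_choice ‖a‖ ‖b‖ with h | h <;> rw [hr, h]
    · exact le_add_of_nonneg_right (by positivity)
    · exact le_add_of_nonneg_left (by positivity)
  have h5 := mul_le_mul_of_nonneg_left h4 hη.le
  refine h1.trans ?_
  rw [mul_assoc]
  exact mul_le_mul_of_nonneg_left (by linarith) (by positivity)

theorem norm_powFun_le (k : ℕ) (a : ℂ) {η : ℝ} (hη : 0 < η) :
    ‖powFun (k + 1) a‖ ≤ (2 * (k + 1 : ℕ) + 1) *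
      (η * ‖a‖ ^ (2 * k + 4) + (2 / η) ^ (2 * k) / η * ‖a‖ ^ 2) := by
  have := norm_powFun_sub_le k a 0 hη
  simpa [powFun] using this

/-- A bounded function `V` for which `V m` is bounded as well. -/
structure IsCutoff (m V : Plane → ℝ) (M : ℝ) : Prop where
  meas_weight : Measurable m
  weight_nonneg : ∀ x, 0 ≤ m x
  meas : Measurable V
  abs_le : ∀ x, |V x| ≤ M
  abs_mul_le : ∀ x, |V x| * m x ≤ M

variable {m V : Plane → ℝ} {M : ℝ}

theorem IsCutoff.norm_mul_le (h : IsCutoff m V M) {c A B : ℝ} (x : Plane) {z : ℂ}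
    (hA : 0 ≤ A) (hB : 0 ≤ B) (hc : 0 ≤ c) (hz : ‖z‖ ≤ c * (A + B)) :
    ‖((V x * m x : ℝ) : ℂ) * z‖ ≤ c * M * (m x * A + B) := by
  have h0 := h.weight_nonneg x
  rw [norm_mul, Complex.norm_real, Real.norm_eq_abs, abs_mul, abs_of_nonneg h0]
  calc |V x| * m x * ‖z‖ ≤ |V x| * m x * (c * (A + B)) := by gcongr
    _ = c * (|V x| * (m x * A) + |V x| * m x * B) := by ring
    _ ≤ c * (M * (m x * A) + M * B) := by
        have := h.abs_le x
        have := h.abs_mul_le x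
        gcongr
    _ = _ := by ring

theorem IsCutoff.aestronglyMeasurable (h : IsCutoff m V M) (p : ℕ) (f : L2) :
    AEStronglyMeasurable (fun x => ((V x * m x : ℝ) : ℂ) * powFun p (f x)) volume :=
  (Complex.measurable_ofReal.comp (h.meas.mul h.meas_weight)).aestronglyMeasurable.mul
    ((continuous_powFun p).comp_aestronglyMeasurable (Lp.aestronglyMeasurable f))

theorem IsCutoff.integrable (h : IsCutoff m V M) {k : ℕ} {f : L2}
    (hf : Integrable fun x => m x * ‖f x‖ ^ (2 * k + 4)) :
    Integrable fun x => ((V x * m x : ℝ) : ℂ) * powFun (k + 1) (f x) := by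
  refine Integrable.mono' (g := fun x => (2 * (k + 1 : ℕ) + 1) * M * (m x * (1 * ‖f x‖ ^ (2 * k + 4)) +
    (2 / 1) ^ (2 * k) / 1 * ‖f x‖ ^ 2)) ?_ (h.aestronglyMeasurable _ f)
    (Eventually.of_forall fun x => ?_)
  · simp only [one_mul]
    exact (hf.add ((integrable_norm_sq f).const_mul _)).const_mul _
  · exact h.norm_mul_le x (by positivity) (by positivity) (by positivity)
      (norm_powFun_le k (f x) one_pos)

theorem IsCutoff.norm_integral_sub_le (h : IsCutoff m V M) {k : ℕ} {f g : L2}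
    (hf : Integrable fun x => m x * ‖f x‖ ^ (2 * k + 4))
    (hg : Integrable fun x => m x * ‖g x‖ ^ (2 * k + 4)) {η : ℝ} (hη : 0 < η) :
    ‖(∫ x, ((V x * m x : ℝ) : ℂ) * powFun (k + 1) (f x)) -
      ∫ x, ((V x * m x : ℝ) : ℂ) * powFun (k + 1) (g x)‖ ≤ (2 * (k + 1 : ℕ) + 1) * M *
        (η * ((∫ x, m x * ‖f x‖ ^ (2 * k + 4)) + ∫ x, m x * ‖g x‖ ^ (2 * k + 4)) +
          (2 / η) ^ (2 * k) / η * ‖f - g‖ ^ 2) := by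
  have hfg : Integrable fun x => m x * ‖f x‖ ^ (2 * k + 4) + m x * ‖g x‖ ^ (2 * k + 4) := hf.add hg
  rw [← integral_sub (h.integrable hf) (h.integrable hg), norm_sq_eq_integral,
    ← integral_add hf hg, ← integral_const_mul, ← integral_const_mul, ← integral_add
      (hfg.const_mul η) ((integrable_norm_sq (f - g)).const_mul _), ← integral_const_mul]
  refine norm_integral_le_of_norm_le (((hfg.const_mul η).add
    ((integrable_norm_sq (f - g)).const_mul _)).const_mul _) ?_
  filter_upwards [Lp.coeFn_sub f g] with x hx
  rw [hx, Pi.sub_apply, ← mul_sub]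
  refine (h.norm_mul_le x (by positivity) (by positivity) (by positivity)
    (norm_powFun_sub_le k (f x) (g x) hη)).trans (le_of_eq ?_)
  ring

theorem IsCutoff.norm_integral_le (h : IsCutoff m V M) {k : ℕ} {f : L2}
    (hf : Integrable fun x => m x * ‖f x‖ ^ (2 * k + 4)) {η : ℝ} (hη : 0 < η) :
    ‖∫ x, ((V x * m x : ℝ) : ℂ) * powFun (k + 1) (f x)‖ ≤ (2 * (k + 1 : ℕ) + 1) * M *
        (η * (∫ x, m x * ‖f x‖ ^ (2 * k + 4)) + (2 / η) ^ (2 * k) / η * ‖f‖ ^ 2) := by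
  rw [norm_sq_eq_integral, ← integral_const_mul, ← integral_const_mul, ← integral_add
      (hf.const_mul η) ((integrable_norm_sq f).const_mul _), ← integral_const_mul]
  refine norm_integral_le_of_norm_le (((hf.const_mul η).add
    ((integrable_norm_sq f).const_mul _)).const_mul _) (Eventually.of_forall fun x => ?_)
  refine (h.norm_mul_le x (by positivity) (by positivity) (by positivity)
    (norm_powFun_le k (f x) hη)).trans (le_of_eq ?_)
  ring

/-- Fatou's lemma for weighted powers along an `L²` convergent curve. -/
theorem integrable_of_tendsto_of_bounded (hm : Measurable m) (hm0 : ∀ x, 0 ≤ m x) {p : ℕ}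
    {f : ℝ → L2} {g : L2} (hf : Tendsto f atTop (𝓝 g)) {C : ℝ}
    (hC : ∀ᶠ t in atTop, Integrable (fun x => m x * ‖f t x‖ ^ p) ∧ ∫ x, m x * ‖f t x‖ ^ p ≤ C) :
    Integrable fun x => m x * ‖g x‖ ^ p := by
  obtain ⟨ns, hns, hlim⟩ := tendsto_ae_of_tendsto (hf.comp tendsto_natCast_atTop_atTop)
  have hmeas : ∀ f : L2, AEStronglyMeasurable (fun x => m x * ‖f x‖ ^ p) volume := fun f =>
    hm.aestronglyMeasurable.mul ((Lp.aestronglyMeasurable f).norm.pow p)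
  have hnn : ∀ (f : L2) x, 0 ≤ m x * ‖f x‖ ^ p := fun f x => mul_nonneg (hm0 x) (by positivity)
  set F : ℕ → Plane → ℝ≥0∞ := fun k x => ENNReal.ofReal (m x * ‖f (ns k : ℕ) x‖ ^ p) with hF
  have h1 : ∫⁻ x, liminf (fun k => F k x) atTop ≤ ENNReal.ofReal C := by
    refine (lintegral_liminf_le' fun k => (hmeas _).aemeasurable.ennreal_ofReal).trans
      (liminf_le_of_frequently_le' (Eventually.frequently ?_))
    have := (tendsto_natCast_atTop_atTop (R := ℝ)).comp hns.tendsto_atTop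
    filter_upwards [this.eventually hC] with k hk
    simp only [Function.comp_apply] at hk
    rw [← ofReal_integral_eq_lintegral_ofReal hk.1 (Eventually.of_forall (hnn _))]
    exact ENNReal.ofReal_le_ofReal hk.2
  refine ⟨hmeas g, ?_⟩
  rw [hasFiniteIntegral_iff_ofReal (Eventually.of_forall (hnn g))]
  refine lt_of_le_of_lt (le_of_eq_of_le (lintegral_congr_ae ?_) h1) ENNReal.ofReal_lt_top
  filter_upwards [hlim] with x hx
  have h2 : Tendsto (fun k => F k x) atTop (𝓝 (ENNReal.ofReal (m x * ‖g x‖ ^ p))) :=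
    (ENNReal.continuous_ofReal.tendsto _).comp ((hx.norm.pow p).const_mul (m x))
  exact h2.liminf_eq.symm

/-- First η is chosen so small that the bounded higher power contributes less than δ/2, then t so
large that the L² term does. -/
theorem IsCutoff.tendsto_integral (h : IsCutoff m V M) {k : ℕ} {f : ℝ → L2} {g : L2}
    (hf : Tendsto f atTop (𝓝 g)) {C : ℝ} (hC : ∀ᶠ t in atTop,
      Integrable (fun x => m x * ‖f t x‖ ^ (2 * k + 4)) ∧ ∫ x, m x * ‖f t x‖ ^ (2 * k + 4) ≤ C) :
    Tendsto (fun t => ∫ x, ((V x * m x : ℝ) : ℂ) * powFun (k + 1) (f t x)) atTop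
      (𝓝 (∫ x, ((V x * m x : ℝ) : ℂ) * powFun (k + 1) (g x))) := by
  have hg := integrable_of_tendsto_of_bounded h.meas_weight h.weight_nonneg hf hC
  have hM : 0 ≤ M := (abs_nonneg _).trans (h.abs_le 0)
  set D := |C| + ∫ x, m x * ‖g x‖ ^ (2 * k + 4) with hD
  have hD0 : 0 ≤ D := add_nonneg (abs_nonneg C)
    (integral_nonneg fun x => mul_nonneg (h.weight_nonneg x) (by positivity))
  set c : ℝ := (2 * (k + 1 : ℕ) + 1) * M with hc
  have hc0 : 0 ≤ c := by positivity
  rw [Metric.tendsto_nhds]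
  intro δ hδ
  set η := δ / (2 * (c * D + 1)) with hη
  have hη0 : 0 < η := by positivity
  have h1 : Tendsto (fun t => c * ((2 / η) ^ (2 * k) / η * ‖f t - g‖ ^ 2)) atTop (𝓝 0) := by
    have := (((tendsto_iff_norm_sub_tendsto_zero.mp hf).pow 2).const_mul
      ((2 / η) ^ (2 * k) / η)).const_mul c
    simpa using this
  filter_upwards [hC, h1.eventually (gt_mem_nhds (half_pos hδ))] with t h2 h3
  rw [dist_eq_norm]
  refine (h.norm_integral_sub_le h2.1 hg hη0).trans_lt ?_
  have h4 : c * (η * D) ≤ δ / 2 := by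
    rw [hη, mul_left_comm, div_mul_eq_mul_div, div_le_div_iff₀ (by positivity) (by positivity)]
    nlinarith
  have h5 : c * (η * ((∫ x, m x * ‖f t x‖ ^ (2 * k + 4)) + ∫ x, m x * ‖g x‖ ^ (2 * k + 4))) ≤
      c * (η * D) := by
    have := add_le_add_left (h2.2.trans (le_abs_self C)) (∫ x, m x * ‖g x‖ ^ (2 * k + 4))
    rw [hD]
    gcongr
  rw [mul_add]
  linarith

/-- Here the higher power is bounded only after multiplication by θ, which still suffices: η
controls that part, and θ → 0 controls the L² part. -/
theorem IsCutoff.tendsto_mul_integral (h : IsCutoff m V M) {k : ℕ} {f : ℝ → L2} {θ : ℝ → ℝ}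
    (hθ : Tendsto θ atTop (𝓝 0)) {B C : ℝ} (hB : ∀ᶠ t in atTop, ‖f t‖ ≤ B) (hC : ∀ᶠ t in atTop, 0 ≤ θ t ∧
      Integrable (fun x => m x * ‖f t x‖ ^ (2 * k + 4)) ∧
        θ t * ∫ x, m x * ‖f t x‖ ^ (2 * k + 4) ≤ C) :
    Tendsto (fun t => (θ t : ℂ) * ∫ x, ((V x * m x : ℝ) : ℂ) * powFun (k + 1) (f t x)) atTop
      (𝓝 0) := by
  have hM : 0 ≤ M := (abs_nonneg _).trans (h.abs_le 0)
  set c : ℝ := (2 * (k + 1 : ℕ) + 1) * M with hc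
  have hc0 : 0 ≤ c := by positivity
  rw [Metric.tendsto_nhds]
  intro δ hδ
  set η := δ / (2 * (c * |C| + 1)) with hη
  have hη0 : 0 < η := by positivity
  have h1 : Tendsto (fun t => c * (θ t * ((2 / η) ^ (2 * k) / η * B ^ 2))) atTop (𝓝 0) := by
    have := (hθ.mul_const ((2 / η) ^ (2 * k) / η * B ^ 2)).const_mul c
    simpa using this
  filter_upwards [hC, h1.eventually (gt_mem_nhds (half_pos hδ)), hB] with t h2 h3 h7
  rw [dist_zero_right, norm_mul, Complex.norm_real, Real.norm_of_nonneg h2.1]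
  have h4 : c * (η * |C|) ≤ δ / 2 := by
    rw [hη, mul_left_comm, div_mul_eq_mul_div, div_le_div_iff₀ (by positivity) (by positivity)]
    nlinarith
  have h5 := h.norm_integral_le h2.2.1 hη0
  have h6 : ‖f t‖ ^ 2 ≤ B ^ 2 := by gcongr
  calc _ ≤ θ t * (c * (η * (∫ x, m x * ‖f t x‖ ^ (2 * k + 4)) +
        (2 / η) ^ (2 * k) / η * ‖f t‖ ^ 2)) := mul_le_mul_of_nonneg_left h5 h2.1
    _ = c * (η * (θ t * ∫ x, m x * ‖f t x‖ ^ (2 * k + 4))) +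
        c * (θ t * ((2 / η) ^ (2 * k) / η * ‖f t‖ ^ 2)) := by ring
    _ ≤ c * (η * |C|) + c * (θ t * ((2 / η) ^ (2 * k) / η * B ^ 2)) := by
        have := h2.2.2.trans (le_abs_self C)
        have := h2.1
        gcongr
    _ < δ := by linarith

theorem isCutoff_of_hasCompactSupport {b : ℝ} (hb : 0 ≤ b) (hV : Continuous V)
    (hs : HasCompactSupport V) : ∃ M, IsCutoff (fun x => ‖x‖ ^ b) V M := by
  have hc : Continuous fun x : Plane => ‖x‖ ^ b := continuous_norm.rpow_const fun _ => Or.inr hb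
  obtain ⟨A, hA⟩ := hV.bounded_above_of_compact_support hs
  obtain ⟨B, hB⟩ := (hV.mul hc).bounded_above_of_compact_support hs.mul_right
  refine ⟨max A B, hc.measurable, fun x => by positivity, hV.measurable,
    fun x => (hA x).trans (le_max_left A B), fun x => ?_⟩
  refine le_trans (le_of_eq ?_) ((hB x).trans (le_max_right A B))
  rw [Pi.mul_apply, norm_mul, Real.norm_eq_abs, Real.norm_of_nonneg (by positivity)]

theorem locallyIntegrable_powFun {b : ℝ} (hb : 0 ≤ b) {k : ℕ} {f : L2}
    (hf : Integrable fun x : Plane => ‖x‖ ^ b * ‖f x‖ ^ (2 * k + 4)) :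
    LocallyIntegrable (fun x : Plane => ((‖x‖ ^ b : ℝ) : ℂ) * powFun (k + 1) (f x)) volume := by
  rw [locallyIntegrable_iff]
  intro K hK
  have hc : Continuous fun x : Plane => ‖x‖ ^ b := continuous_norm.rpow_const fun _ => Or.inr hb
  obtain ⟨B, hB⟩ := hK.exists_bound_of_continuousOn hc.continuousOn
  have hcut : IsCutoff (fun x => ‖x‖ ^ b) (K.indicator fun _ => (1 : ℝ)) (max 1 B) := by
    refine ⟨hc.measurable, fun x => by positivity, measurable_const.indicator hK.measurableSet,
      fun x => ?_, fun x => ?_⟩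
    · by_cases hx : x ∈ K <;> simp [hx]
    · by_cases hx : x ∈ K
      · have := hB x hx
        rw [Real.norm_of_nonneg (by positivity)] at this
        simp [hx, this]
      · simp [hx]
  rw [← integrable_indicator_iff hK.measurableSet]
  refine (hcut.integrable hf).congr (Eventually.of_forall fun x => ?_)
  by_cases hx : x ∈ K <;> simp [hx]

end

section

variable {b₁ b₂ : ℝ} {w n : ℝ → L2}

/-! ### The lens transform of the force -/

theorem norm_lens_apply {t : ℝ} (ht : 0 < t) (f : L2) :
    ∀ᵐ y : Plane, ‖lens t f y‖ = t * ‖f (t • y)‖ := by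
  filter_upwards [coeFn_lens ht f] with y hy
  rw [hy, norm_mul, norm_mul, norm_chirp, one_mul, Complex.norm_real, Real.norm_of_nonneg ht.le]

theorem density_lens {t : ℝ} (ht : 0 < t) (b : ℝ) (k : ℕ) (f : L2) :
    (fun y : Plane => ‖y‖ ^ b * ‖lens t f y‖ ^ k) =ᵐ[volume]
      fun y => t ^ k * t ^ (-b) * (‖t • y‖ ^ b * ‖f (t • y)‖ ^ k) := by
  filter_upwards [norm_lens_apply ht f] with y hy
  rw [hy, norm_smul, Real.norm_of_nonneg ht.le, Real.mul_rpow ht.le (norm_nonneg y),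
    Real.rpow_neg ht.le, mul_pow]
  have := (Real.rpow_pos_of_pos ht b).ne'
  field_simp

theorem integrable_lens {t : ℝ} (ht : 0 < t) {b : ℝ} {k : ℕ} {f : L2}
    (hf : Integrable fun x : Plane => ‖x‖ ^ b * ‖f x‖ ^ k) :
    Integrable fun y : Plane => ‖y‖ ^ b * ‖lens t f y‖ ^ k :=
  ((hf.comp_smul ht.ne').const_mul _).congr (density_lens ht b k f).symm

/-- The powers of t come from the amplitude, the weight and the plane Jacobian. For k = 4 and b = b₁
the exponent is 2 - b₁, matching the decay of the potential energy. -/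
theorem integral_lens {t : ℝ} (ht : 0 < t) (b : ℝ) (k : ℕ) (f : L2) :
    ∫ y : Plane, ‖y‖ ^ b * ‖lens t f y‖ ^ k = t ^ ((k : ℝ) - b - 2) * potential b k f := by
  rw [integral_congr_ae (density_lens ht b k f), integral_const_mul,
    Measure.integral_comp_smul volume (fun x : Plane => ‖x‖ ^ b * ‖f x‖ ^ k) t, potential]
  simp only [finrank_euclideanSpace, Fintype.card_fin, smul_eq_mul]
  rw [abs_of_pos (by positivity), ← mul_assoc, sub_eq_add_neg, sub_eq_add_neg, Real.rpow_add ht,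
    Real.rpow_add ht, Real.rpow_natCast, Real.rpow_neg ht.le 2, Real.rpow_two]

/-- The force is gauge invariant, so the quadratic phase passes through it and only the powers of t
are left. -/
theorem IsForce.lens_apply {f n : L2} (h : IsForce b₁ b₂ f n) {t : ℝ} (ht : 0 < t) :
    ∀ᵐ y : Plane, lens t n y = ((t ^ (b₁ - 2) : ℝ) : ℂ) * (((‖y‖ ^ b₁ : ℝ) : ℂ) *
      powFun 1 (lens t f y) + ((t ^ (b₂ - 2 - b₁) : ℝ) : ℂ) *
        (((‖y‖ ^ b₂ : ℝ) : ℂ) * powFun 2 (lens t f y))) := by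
  filter_upwards [coeFn_lens ht f, coeFn_lens ht n, norm_lens_apply ht f,
    (quasiMeasurePreserving_smul_plane ht.ne').ae h] with y h1 h2 h3 h4
  have e1 : t ^ (b₁ - 2) * t ^ 2 = t ^ b₁ := by
    rw [← Real.rpow_two, ← Real.rpow_add ht]; congr 1; ring
  have e2 : t ^ (b₁ - 2) * t ^ (b₂ - 2 - b₁) * t ^ 4 = t ^ b₂ := by
    rw [← Real.rpow_natCast, ← Real.rpow_add ht, ← Real.rpow_add ht]; congr 1; push_cast; ring
  rw [powFun, powFun, h3, h1, h2, h4, norm_smul, Real.norm_of_nonneg ht.le,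
    Real.mul_rpow ht.le (norm_nonneg y), Real.mul_rpow ht.le (norm_nonneg y), ← e1, ← e2]
  push_cast
  ring

theorem IsForce.inner_lens {f n v : L2} (h : IsForce b₁ b₂ f n) {t : ℝ} (ht : 0 < t)
    {V : Plane → ℝ} {M₁ M₂ : ℝ} (h₁ : IsCutoff (fun x => ‖x‖ ^ b₁) V M₁)
    (h₂ : IsCutoff (fun x => ‖x‖ ^ b₂) V M₂) (hv : ∀ᵐ y, v y = (V y : ℂ)) :
    ((t ^ (2 - b₁) : ℝ) : ℂ) * inner ℂ v (lens t n) =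
      (∫ y, ((V y * ‖y‖ ^ b₁ : ℝ) : ℂ) * powFun 1 (lens t f y)) +
        ((t ^ (b₂ - 2 - b₁) : ℝ) : ℂ) *
          ∫ y, ((V y * ‖y‖ ^ b₂ : ℝ) : ℂ) * powFun 2 (lens t f y) := by
  have i1 := h₁.integrable (k := 0) (integrable_lens ht h.integrable_four)
  have i2 := h₂.integrable (k := 1) (integrable_lens ht h.integrable_six)
  rw [inner_eq_integral, ← integral_const_mul, ← integral_const_mul, ← integral_add i1
    (i2.const_mul _)]
  refine integral_congr_ae ?_
  filter_upwards [hv, h.lens_apply ht] with y e1 e2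
  rw [e1, e2, Complex.conj_ofReal]
  have e3 : ((t ^ (2 - b₁) : ℝ) : ℂ) * ((t ^ (b₁ - 2) : ℝ) : ℂ) = 1 := by
    rw [← Complex.ofReal_mul, ← Real.rpow_add ht]
    simp
  push_cast at e3 ⊢
  linear_combination ((V y : ℂ) * (((‖y‖ ^ b₁ : ℝ) : ℂ) * powFun 1 (lens t f y) +
    ((t ^ (b₂ - 2 - b₁) : ℝ) : ℂ) * (((‖y‖ ^ b₂ : ℝ) : ℂ) * powFun 2 (lens t f y)))) * e3

/-! ### The asymptotic force -/

theorem eq_zero_of_rpow_mul_powFun {b : ℝ} {p : ℕ} {y : Plane} (hy : y ≠ 0) {a : ℂ}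
    (h : ((‖y‖ ^ b : ℝ) : ℂ) * powFun p a = 0) : a = 0 := by
  have h0 : ‖y‖ ^ b ≠ 0 := (Real.rpow_pos_of_pos (norm_pos_iff.mpr hy) b).ne'
  rcases mul_eq_zero.mp h with h1 | h1
  · exact absurd (Complex.ofReal_eq_zero.mp h1) h0
  · rcases mul_eq_zero.mp h1 with h2 | h2
    · exact norm_eq_zero.mp (eq_zero_of_pow_eq_zero (Complex.ofReal_eq_zero.mp h2))
    · exact h2

theorem IsFlow.exists_asymptotic_force (h : IsFlow b₁ b₂ w n) (hb₁ : 0 ≤ b₁) (hb₂ : 0 ≤ b₂)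
    (hb : b₂ ≤ 2 + b₁) {C : ℝ} (hC : ∀ t, 1 ≤ t →
      potentialEnergy b₁ b₂ (resolvent (w t)) ≤ C * t ^ (b₁ - 2))
    {W : L2} (hW : Tendsto (fun t => lens t (resolvent (w t))) atTop (𝓝 W)) :
    ∃ F : Plane → ℂ, LocallyIntegrable F volume ∧ (∀ᵐ y, F y = 0 → W y = 0) ∧
      ∀ V : Plane → ℝ, Continuous V → HasCompactSupport V → ∀ v : L2, (∀ᵐ y, v y = (V y : ℂ)) →
        Tendsto (fun t => ((t ^ (2 - b₁) : ℝ) : ℂ) * inner ℂ v (lens t (n t))) atTop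
          (𝓝 (∫ y, V y • F y)) := by
  have hne : ∀ᵐ y : Plane, y ≠ 0 := by
    rw [ae_iff]; simp
  have bound4 : ∀ᶠ t in atTop, Integrable (fun y : Plane => ‖y‖ ^ b₁ *
      ‖lens t (resolvent (w t)) y‖ ^ (2 * 0 + 4)) ∧
      ∫ y : Plane, ‖y‖ ^ b₁ * ‖lens t (resolvent (w t)) y‖ ^ (2 * 0 + 4) ≤ 4 * C := by
    filter_upwards [eventually_ge_atTop 1] with t ht
    have ht0 : 0 < t := by linarith
    refine ⟨integrable_lens ht0 (h.isForce t).integrable_four, ?_⟩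
    rw [integral_lens ht0]
    have h1 := hC t ht
    rw [potentialEnergy] at h1
    have h2 := potential_nonneg b₂ 6 (resolvent (w t))
    have e : t ^ (2 - b₁) * t ^ (b₁ - 2) = 1 := by
      rw [← Real.rpow_add ht0]; simp
    calc t ^ (((2 * 0 + 4 : ℕ) : ℝ) - b₁ - 2) * potential b₁ (2 * 0 + 4) (resolvent (w t))
        = t ^ (2 - b₁) * potential b₁ 4 (resolvent (w t)) := by
          congr 2; push_cast; ring
      _ ≤ t ^ (2 - b₁) * (4 * (C * t ^ (b₁ - 2))) := by
          have : potential b₁ 4 (resolvent (w t)) ≤ 4 * (C * t ^ (b₁ - 2)) := by linarith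
          gcongr
      _ = 4 * C * (t ^ (2 - b₁) * t ^ (b₁ - 2)) := by ring
      _ = 4 * C := by rw [e, mul_one]
  have bound6 : ∀ᶠ t : ℝ in atTop, 0 ≤ t ^ (b₂ - 2 - b₁) ∧ Integrable (fun y : Plane => ‖y‖ ^ b₂ *
      ‖lens t (resolvent (w t)) y‖ ^ (2 * 1 + 4)) ∧ t ^ (b₂ - 2 - b₁) *
      ∫ y : Plane, ‖y‖ ^ b₂ * ‖lens t (resolvent (w t)) y‖ ^ (2 * 1 + 4) ≤ 6 * C := by
    filter_upwards [eventually_ge_atTop 1] with t ht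
    have ht0 : 0 < t := by linarith
    refine ⟨by positivity, integrable_lens ht0 (h.isForce t).integrable_six, ?_⟩
    rw [integral_lens ht0]
    have h1 := hC t ht
    rw [potentialEnergy] at h1
    have h2 := potential_nonneg b₁ 4 (resolvent (w t))
    have e : t ^ (b₂ - 2 - b₁) * (t ^ (4 - b₂) * t ^ (b₁ - 2)) = 1 := by
      rw [← Real.rpow_add ht0, ← Real.rpow_add ht0]; ring_nf; simp
    calc t ^ (b₂ - 2 - b₁) *
          (t ^ (((2 * 1 + 4 : ℕ) : ℝ) - b₂ - 2) * potential b₂ (2 * 1 + 4) (resolvent (w t)))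
        = t ^ (b₂ - 2 - b₁) * (t ^ (4 - b₂) * potential b₂ 6 (resolvent (w t))) := by
          congr 3; push_cast; ring
      _ ≤ t ^ (b₂ - 2 - b₁) * (t ^ (4 - b₂) * (6 * (C * t ^ (b₁ - 2)))) := by
          have : potential b₂ 6 (resolvent (w t)) ≤ 6 * (C * t ^ (b₁ - 2)) := by linarith
          gcongr
      _ = 6 * C * (t ^ (b₂ - 2 - b₁) * (t ^ (4 - b₂) * t ^ (b₁ - 2))) := by ring
      _ = 6 * C := by rw [e, mul_one]
  have hW4 := integrable_of_tendsto_of_bounded (m := fun y : Plane => ‖y‖ ^ b₁) (by fun_prop)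
    (fun x => by positivity) hW bound4
  have loc4 := locallyIntegrable_powFun hb₁ hW4
  have key : ∀ V : Plane → ℝ, Continuous V → HasCompactSupport V → ∀ v : L2,
      (∀ᵐ y, v y = (V y : ℂ)) → ∃ M₁ M₂, IsCutoff (fun x => ‖x‖ ^ b₁) V M₁ ∧
        IsCutoff (fun x => ‖x‖ ^ b₂) V M₂ ∧
        (fun t => ((t ^ (2 - b₁) : ℝ) : ℂ) * inner ℂ v (lens t (n t))) =ᶠ[atTop] fun t =>
          (∫ y, ((V y * ‖y‖ ^ b₁ : ℝ) : ℂ) * powFun 1 (lens t (resolvent (w t)) y)) +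
            ((t ^ (b₂ - 2 - b₁) : ℝ) : ℂ) *
              ∫ y, ((V y * ‖y‖ ^ b₂ : ℝ) : ℂ) * powFun 2 (lens t (resolvent (w t)) y) := by
    intro V hV hs v hv
    obtain ⟨M₁, h₁⟩ := isCutoff_of_hasCompactSupport hb₁ hV hs
    obtain ⟨M₂, h₂⟩ := isCutoff_of_hasCompactSupport hb₂ hV hs
    refine ⟨M₁, M₂, h₁, h₂, ?_⟩
    filter_upwards [eventually_gt_atTop 0] with t ht
    exact (h.isForce t).inner_lens ht h₁ h₂ hv
  -- Below the threshold the factor t^(b₂-2-b₁) tends to 0 and the limit is purely cubic; at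
  -- equality it is 1 and the quintic term survives. Both have a positive coefficient, so F vanishes
  -- only where W does.
  rcases hb.lt_or_eq with hlt | heq
  · refine ⟨fun y => ((‖y‖ ^ b₁ : ℝ) : ℂ) * powFun 1 (W y), loc4, ?_, fun V hV hs v hv => ?_⟩
    · filter_upwards [hne] with y hy hF
      exact eq_zero_of_rpow_mul_powFun hy hF
    · obtain ⟨M₁, M₂, h₁, h₂, e⟩ := key V hV hs v hv
      have hθ : Tendsto (fun t : ℝ => t ^ (b₂ - 2 - b₁)) atTop (𝓝 0) := by
        have := tendsto_rpow_neg_atTop (y := 2 + b₁ - b₂) (by linarith)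
        refine this.congr fun t => ?_
        congr 1; ring
      have hB : ∀ᶠ t in atTop, ‖lens t (resolvent (w t))‖ ≤ ‖resolvent (w 0)‖ := by
        filter_upwards [eventually_gt_atTop 0] with t ht
        rw [norm_lens ht, h.norm_eq t 0]
      have l1 := h₁.tendsto_integral (k := 0) hW bound4
      have l2 := h₂.tendsto_mul_integral (k := 1) hθ hB bound6
      refine Tendsto.congr' e.symm ?_
      have l3 := l1.add l2
      rw [add_zero] at l3
      refine l3.trans (le_of_eq ?_)
      congr 1
      refine integral_congr_ae (Eventually.of_forall fun y => ?_)
      simp only [Complex.real_smul]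
      push_cast
      ring
  · have hexp : b₂ - 2 - b₁ = 0 := by rw [heq]; ring
    simp only [hexp, Real.rpow_zero, one_mul, Complex.ofReal_one] at bound6 key
    have bound6' := bound6.mono fun t ht => ht.2
    have hW6 := integrable_of_tendsto_of_bounded (m := fun y : Plane => ‖y‖ ^ b₂) (by fun_prop)
      (fun x => by positivity) hW bound6'
    have loc6 := locallyIntegrable_powFun hb₂ hW6
    refine ⟨fun y => ((‖y‖ ^ b₁ : ℝ) : ℂ) * powFun 1 (W y) + ((‖y‖ ^ b₂ : ℝ) : ℂ) * powFun 2 (W y),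
      loc4.add loc6, ?_, fun V hV hs v hv => ?_⟩
    · filter_upwards [hne] with y hy hF
      refine eq_zero_of_rpow_mul_powFun (b := 0) (p := 0) hy ?_
      have e : ((‖y‖ ^ b₁ : ℝ) : ℂ) * powFun 1 (W y) + ((‖y‖ ^ b₂ : ℝ) : ℂ) * powFun 2 (W y) =
          ((‖y‖ ^ b₁ * ‖W y‖ ^ 2 + ‖y‖ ^ b₂ * ‖W y‖ ^ 4 : ℝ) : ℂ) * W y := by
        rw [powFun, powFun]; push_cast; ring
      rw [e] at hF
      have hW0 : W y = 0 := by
        by_contra hne0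
        have p0 := norm_pos_iff.mpr hne0
        have p1 := Real.rpow_pos_of_pos (norm_pos_iff.mpr hy) b₁
        have : 0 < ‖y‖ ^ b₁ * ‖W y‖ ^ 2 + ‖y‖ ^ b₂ * ‖W y‖ ^ 4 := by positivity
        rcases mul_eq_zero.mp hF with h1 | h1
        · exact this.ne' (Complex.ofReal_eq_zero.mp h1)
        · exact hne0 h1
      simp [powFun, hW0]
    · obtain ⟨M₁, M₂, h₁, h₂, e⟩ := key V hV hs v hv
      have l1 := h₁.tendsto_integral (k := 0) hW bound4
      have l2 := h₂.tendsto_integral (k := 1) hW bound6'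
      refine Tendsto.congr' e.symm ?_
      refine (l1.add l2).trans (le_of_eq ?_)
      congr 1
      rw [← integral_add (h₁.integrable (k := 0) hW4) (h₂.integrable (k := 1) hW6)]
      refine integral_congr_ae (Eventually.of_forall fun y => ?_)
      simp only [Complex.real_smul]
      push_cast
      ring

/-! ### Logarithmic divergence -/

/-- Since b ≥ 1, the factor t^(b-2) is at least 1/t. If L ≠ 0, the derivative of Re(L̄ p) is
eventually at least c/t, and p would grow at least like log t, against its boundedness. -/
theorem eq_zero_of_hasDerivAt_of_tendsto {p j e : ℝ → ℂ} {b A B : ℝ} (hb : 1 ≤ b) {L : ℂ}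
    (hp : ∀ t, 0 < t → HasDerivAt p (j t + e t) t) (he : ∀ t, 0 < t → ‖e t‖ ≤ A / t ^ 2)
    (hB : ∀ t, ‖p t‖ ≤ B)
    (hj : Tendsto (fun t => ((t ^ (2 - b) : ℝ) : ℂ) * j t) atTop (𝓝 L)) : L = 0 := by
  by_contra hL
  have hL0 : 0 < ‖L‖ := norm_pos_iff.mpr hL
  -- The main part is eventually at least ‖L‖²/(2t) = 2c/t, and for t ≥ 4A/‖L‖ the error costs at
  -- most c/t.
  set c := ‖L‖ ^ 2 / 4 with hc
  have hc0 : 0 < c := by positivity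
  have h1 : Tendsto (fun t => (conj L * (((t ^ (2 - b) : ℝ) : ℂ) * j t)).re) atTop
      (𝓝 (‖L‖ ^ 2)) := by
    have := (Complex.continuous_re.tendsto _).comp (hj.const_mul (conj L))
    rw [mul_comm (conj L) L, Complex.mul_conj, Complex.ofReal_re, Complex.normSq_eq_norm_sq] at this
    exact this
  have h2 : ∀ᶠ t in atTop, c / t ≤ (conj L * (j t + e t)).re := by
    filter_upwards [h1.eventually (lt_mem_nhds (half_lt_self (by positivity))),
      eventually_ge_atTop 1, eventually_ge_atTop (4 * A / ‖L‖)] with t k1 k2 k3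
    have ht : 0 < t := by linarith
    have e1 : (conj L * j t).re = t ^ (b - 2) * (conj L * (((t ^ (2 - b) : ℝ) : ℂ) * j t)).re := by
      rw [mul_left_comm, Complex.re_ofReal_mul, ← mul_assoc, ← Real.rpow_add ht]
      simp
    have e2 : 1 / t ≤ t ^ (b - 2) := by
      rw [one_div, ← Real.rpow_neg_one]
      exact Real.rpow_le_rpow_of_exponent_le k2 (by linarith)
    have e3 : 1 / t * (‖L‖ ^ 2 / 2) ≤ (conj L * j t).re := by
      rw [e1]
      exact mul_le_mul e2 k1.le (by positivity) (by positivity)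
    have e4 : -(‖L‖ * (A / t ^ 2)) ≤ (conj L * e t).re := by
      have := (abs_le.mp (Complex.abs_re_le_norm (conj L * e t))).1
      rw [norm_mul, RCLike.norm_conj] at this
      have := mul_le_mul_of_nonneg_left (he t ht) hL0.le
      linarith
    have e5 : ‖L‖ * (A / t ^ 2) ≤ c / t := by
      rw [div_le_iff₀ hL0] at k3
      rw [mul_div_assoc', div_le_div_iff₀ (by positivity) ht, hc]
      nlinarith [mul_pos hL0 ht]
    rw [mul_add, Complex.add_re]
    have e6 : 1 / t * (‖L‖ ^ 2 / 2) = 2 * (c / t) := by rw [hc]; ring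
    linarith
  obtain ⟨T₀, hT₀⟩ := eventually_atTop.mp h2
  set T := max T₀ 1 with hT
  have hT1 : 1 ≤ T := le_max_right _ _
  have hq : ∀ t, T ≤ t → HasDerivAt (fun t => (conj L * p t).re - c * Real.log t)
      ((conj L * (j t + e t)).re - c * t⁻¹) t := by
    intro t ht
    have ht0 : 0 < t := by linarith
    exact (Complex.reCLM.hasFDerivAt.comp_hasDerivAt t ((hp t ht0).const_mul (conj L))).sub
      ((Real.hasDerivAt_log ht0.ne').const_mul c)
  have hmono : MonotoneOn (fun t => (conj L * p t).re - c * Real.log t) (Set.Ici T) := by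
    refine monotoneOn_of_deriv_nonneg (convex_Ici T)
      (fun t ht => (hq t ht).continuousAt.continuousWithinAt) (fun t ht => ?_) fun t ht => ?_
    · rw [interior_Ici] at ht
      exact (hq t (le_of_lt ht)).differentiableAt.differentiableWithinAt
    · rw [interior_Ici] at ht
      rw [(hq t (le_of_lt ht)).deriv]
      have := hT₀ t ((le_max_left _ _).trans (le_of_lt ht))
      rw [div_eq_mul_inv] at this
      linarith
  have hbd : ∀ t, T ≤ t → c * Real.log t ≤
      ‖L‖ * B - ((conj L * p T).re - c * Real.log T) := by
    intro t ht
    have h3 := hmono (Set.mem_Ici.mpr le_rfl) (Set.mem_Ici.mpr ht) ht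
    simp only at h3
    have h4 := (Complex.re_le_norm (conj L * p t))
    rw [norm_mul, RCLike.norm_conj] at h4
    have := mul_le_mul_of_nonneg_left (hB t) hL0.le
    linarith
  have hlog := Real.tendsto_log_atTop.const_mul_atTop hc0
  obtain ⟨t, ht1, ht2⟩ := ((eventually_ge_atTop T).and (hlog.eventually_gt_atTop
    (‖L‖ * B - ((conj L * p T).re - c * Real.log T)))).exists
  exact absurd (hbd t ht1) (not_le.mpr ht2)

/-- Every real test function is the dilated Fourier transform of a function with finite second
moment. -/
theorem exists_dil_fourier_eq {V : Plane → ℝ} (hV : ContDiff ℝ ∞ V) (hs : HasCompactSupport V) :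
    ∃ χ χ₂ : L2, (∀ᵐ x : Plane, χ₂ x = Complex.I * ((‖x‖ ^ 2 : ℝ) : ℂ) * χ x) ∧
      ∀ᵐ y, dil (1 / (4 * Real.pi)) (𝓕 χ) y = (V y : ℂ) := by
  have hpi : (0 : ℝ) < 4 * Real.pi := by positivity
  have hpi' : 0 < 1 / (4 * Real.pi) := by positivity
  -- The argument and the amplitude are scaled by 4π to invert the dilation by 1/(4π).
  set ψ : Plane → ℂ := fun z => ((4 * Real.pi * V ((4 * Real.pi) • z) : ℝ) : ℂ) with hψ
  have hψd : ContDiff ℝ ∞ ψ := Complex.ofRealCLM.contDiff.comp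
    (contDiff_const.mul (hV.comp (contDiff_const_smul _)))
  have hψs : HasCompactSupport ψ := by
    have h1 : HasCompactSupport fun z => V ((4 * Real.pi) • z) := hs.comp_smul hpi.ne'
    exact h1.comp_left (g := fun r => ((4 * Real.pi * r : ℝ) : ℂ)) (by simp)
  set S : 𝓢(Plane, ℂ) := hψs.toSchwartzMap hψd with hS
  set X : 𝓢(Plane, ℂ) := 𝓕⁻ S with hX
  have hg : (fun x : Plane => Complex.I * ((‖x‖ ^ 2 : ℝ) : ℂ)).HasTemperateGrowth := by fun_prop
  refine ⟨X.toLp 2, (SchwartzMap.smulLeftCLM ℂ (fun x : Plane => Complex.I *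
    ((‖x‖ ^ 2 : ℝ) : ℂ)) X).toLp 2, ?_, ?_⟩
  · filter_upwards [X.coeFn_toLp 2, (SchwartzMap.smulLeftCLM ℂ (fun x : Plane => Complex.I *
      ((‖x‖ ^ 2 : ℝ) : ℂ)) X).coeFn_toLp 2] with x h1 h2
    rw [h1, h2, SchwartzMap.smulLeftCLM_apply_apply hg, smul_eq_mul]
  · rw [SchwartzMap.toLp_fourier_eq, hX, FourierTransform.fourier_fourierInv_eq]
    filter_upwards [coeFn_dil hpi' (S.toLp 2),
      (quasiMeasurePreserving_smul_plane hpi'.ne').ae (S.coeFn_toLp 2 volume)] with y h1 h2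
    rw [h1, h2]
    have e : S ((1 / (4 * Real.pi)) • y) = ψ ((1 / (4 * Real.pi)) • y) := rfl
    rw [e, hψ]
    simp only [smul_smul]
    rw [mul_one_div_cancel hpi.ne', one_smul, ← Complex.ofReal_mul, ← mul_assoc,
      one_div_mul_cancel hpi.ne', one_mul]

/-- For each test function V a state χ is chosen whose pairing sees exactly ∫ V F in the limit;
logarithmic divergence forces this to vanish, and F = 0 gives W = 0. -/
theorem IsFlow.asymptotic_state_eq_zero (h : IsFlow b₁ b₂ w n) (hb₁ : 1 ≤ b₁) (hb₂ : 0 ≤ b₂)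
    (hb : b₂ ≤ 2 + b₁) (hξ : ∀ t, ∃ ξ, IsPosition (resolvent (w t)) ξ)
    {W : L2} (hW : Tendsto (fun t => lens t (resolvent (w t))) atTop (𝓝 W)) : W = 0 := by
  have hb₁' : 0 ≤ b₁ := by linarith
  obtain ⟨C, _, hC⟩ := h.exists_potentialEnergy_le hb₁' hb₂ hb hξ
  obtain ⟨F, hF, hFW, hlim⟩ := h.exists_asymptotic_force hb₁' hb₂ hb hC hW
  have hF0 : ∀ᵐ y, F y = 0 := by
    refine ae_eq_zero_of_integral_contDiff_smul_eq_zero hF fun V hV hs => ?_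
    obtain ⟨χ, χ₂, hχ, hv⟩ := exists_dil_fourier_eq hV hs
    have hd := fun (t : ℝ) (ht : 0 < t) => h.hasDerivAt_lensPairing hχ ht
    choose! e he hde using hd
    exact eq_zero_of_hasDerivAt_of_tendsto hb₁ hde he
      (fun t => (norm_lensPairing_le χ w t).trans_eq (by rw [h.norm_eq t 0]))
      (hlim V hV.continuous hs _ hv)
  refine Lp.ext ?_
  filter_upwards [hF0, hFW, Lp.coeFn_zero ℂ 2 (volume : Measure Plane)] with y h1 h2 h3
  rw [h3, Pi.zero_apply]
  exact h2 h1

end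

end ICQNLS

end

/-! ### Conclusion: from the vanishing profile to the vanishing solution. -/

theorem theorem1p3 (b₁ b₂ : ℝ) (hb₁ : 1 ≤ b₁) (hb₂ : 0 ≤ b₂) (hb₂' : b₂ ≤ 2 + b₁)
    (φ : ICQNLS.L2) (u : ℝ → ICQNLS.L2)
    (hu : ICQNLS.IsGlobalSmoothSolution (ICQNLS.powerCoeff b₁) (ICQNLS.powerCoeff b₂) φ u)
    (hxu : ICQNLS.ContinuousMulPosition u)
    (φp φm : ICQNLS.L2) (hφp : ICQNLS.IsSmooth φp) (hφm : ICQNLS.IsSmooth φm)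
    (hscat : ICQNLS.ScattersTo u φp φm) :
    (∀ t, u t = 0) ∧ (∀ t, ICQNLS.propagator t φp = 0) ∧ (∀ t, ICQNLS.propagator t φm = 0) := by
  obtain ⟨w, n, h, huw⟩ := hu.exists_isFlow
  obtain ⟨W, hWn, hW⟩ := hscat.exists_tendsto_lens
  have hξ : ∀ t, ∃ ξ, ICQNLS.IsPosition (ICQNLS.resolvent (w t)) ξ := by
    intro t
    choose ξ _ hξ using hxu
    exact ⟨fun j => ξ j t, fun j => by rw [← huw]; exact hξ j t⟩
  simp only [huw] at hW
  have hφp0 : φp = 0 := by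
    rw [← norm_eq_zero, ← hWn, h.asymptotic_state_eq_zero hb₁ hb₂ hb₂' hξ hW, norm_zero]
  have hu0 : ∀ t, u t = 0 := by
    have hlim : Tendsto (fun t => ‖u t‖) atTop (𝓝 0) := by
      refine hscat.1.congr fun t => ?_
      have h0 : ICQNLS.propagator t φp = 0 := by
        rw [← norm_eq_zero, ICQNLS.norm_propagator, hφp0, norm_zero]
      rw [h0, sub_zero]
    intro t
    -- The norm of u tends to 0 at +∞ and is constant by conservation of mass.
    have hconst : (fun s => ‖u s‖) = fun _ => ‖u t‖ := by
      funext s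
      rw [huw, huw, h.norm_eq s t]
    rw [hconst] at hlim
    exact norm_eq_zero.mp (tendsto_nhds_unique tendsto_const_nhds hlim)
  have hφm0 : ‖φm‖ = 0 := by
    have hlim := hscat.2
    simp only [hu0, zero_sub, norm_neg, ICQNLS.norm_propagator] at hlim
    exact tendsto_nhds_unique tendsto_const_nhds hlim
  refine ⟨hu0, fun t => ?_, fun t => ?_⟩
  · rw [← norm_eq_zero, ICQNLS.norm_propagator, hφp0, norm_zero]
  · rw [← norm_eq_zero, ICQNLS.norm_propagator, hφm0]
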